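/- Let $A=\{p_j\}_{j\in J}\subset\mathbb R^3$ be a closed, discrete, countable set, with the $p_j$ pairwise distinct (for instance $J=\mathbb N^+$), and let $U=\mathbb R^3\setminus A$. Then $H^2(U,\mathbb Z)=\prod_{j\in J}\mathbb Z$, where the coordinate $e_j$ of a class is its value on a small sphere around $p_j$ oriented by the outward normal. Since this group is torsion-free, a class in $H^2(U,\mathbb Z)$ is regarded as a de Rham class in $H^2(U,\mathbb R)$ (smooth closed $2$-forms on $U$ modulo exact ones) whose integral over every sufficiently small sphere centred at $p_j$ is the integer $e_j$, for each $j$. Let $\star$ be the Hodge star of the Euclidean metric and the standard orientation, so that $\star dV=V_x\,dy\wedge dz+V_y\,dz\wedge dx+V_z\,dx\wedge dy$. **Theorem.** Let $\boldsymbol e=(e_j)_{j\in J}\in H^2(U,\mathbb Z)$ be a nontrivial cohomology class. There is a positive harmonic function $V$ on $U$ with $[\star dV]=\boldsymbol e$ in $H^2(U,\mathbb R)$ if and only if $e_j\le 0$ for all $j\in J$ and there is a point $x\in U$ such that $$\sum_{j\in J}\frac{|e_j|}{|x-p_j|}<\infty .$$ -/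

import Mathlib

open Set Filter Topology InnerProductSpace
open scoped ContDiff

noncomputable section

/-- Euclidean three-space. -/
abbrev E3 : Type := EuclideanSpace ℝ (Fin 3)

/-- Differential `k`-forms; those on an open set `U` are treated through their values on `U`. -/
abbrev DiffForm (k : ℕ) : Type := E3 → E3 [⋀^Fin k]→L[ℝ] ℝ

/-- The smooth closed `k`-forms on `U` (meant for `U` open; values outside `U` are irrelevant). -/
def closedForms (k : ℕ) (U : Set E3) : AddSubgroup (DiffForm k) where
  carrier := {η | ∀ x ∈ U, ContDiffAt ℝ ∞ η x ∧ extDeriv η x = 0}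
  add_mem' {η ζ} hη hζ x hx := by
    refine ⟨(hη x hx).1.add (hζ x hx).1, ?_⟩
    rw [extDeriv_add ((hη x hx).1.differentiableAt (by simp))
      ((hζ x hx).1.differentiableAt (by simp)), (hη x hx).2, (hζ x hx).2, add_zero]
  zero_mem' x _ := ⟨contDiffAt_const, by
    have h := extDeriv_smul (x := x) (0 : ℝ) (0 : DiffForm k)
    simpa using h⟩
  neg_mem' {η} hη x hx := by
    refine ⟨(hη x hx).1.neg, ?_⟩
    rw [← neg_one_smul ℝ η, extDeriv_smul, (hη x hx).2, smul_zero]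

/-- The exact 2-forms on `U`: those equal to `dα` on `U` for some smooth 1-form `α` on `U`. -/
def exactForms (U : Set E3) : AddSubgroup (closedForms 2 U) where
  carrier := {η | ∃ α : DiffForm 1,
    ∀ x ∈ U, ContDiffAt ℝ ∞ α x ∧ extDeriv α x = (η : DiffForm 2) x}
  add_mem' {η ζ} := by
    rintro ⟨α, hα⟩ ⟨β, hβ⟩
    refine ⟨α + β, fun x hx => ⟨(hα x hx).1.add (hβ x hx).1, ?_⟩⟩
    rw [extDeriv_add ((hα x hx).1.differentiableAt (by simp))
      ((hβ x hx).1.differentiableAt (by simp)), (hα x hx).2, (hβ x hx).2]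
    rfl
  zero_mem' := ⟨0, fun x _ => ⟨contDiffAt_const, by
    have h := extDeriv_smul (x := x) (0 : ℝ) (0 : DiffForm 1)
    simpa using h⟩⟩
  neg_mem' {η} := by
    rintro ⟨α, hα⟩
    refine ⟨-α, fun x hx => ⟨(hα x hx).1.neg, ?_⟩⟩
    rw [← neg_one_smul ℝ α, extDeriv_smul, (hα x hx).2, neg_one_smul]
    rfl

/-- The second de Rham cohomology `H²(U; ℝ)`: closed 2-forms on `U` modulo exact ones. -/
abbrev DeRhamH2 (U : Set E3) : Type := closedForms 2 U ⧸ exactForms U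

/-- The class `[η]` of a closed 2-form. -/
def deRhamClass {U : Set E3} (η : closedForms 2 U) : DeRhamH2 U :=
  QuotientAddGroup.mk η

/-- The standard volume form `dx ∧ dy ∧ dz`. -/
def volForm : E3 [⋀^Fin 3]→L[ℝ] ℝ :=
  { (EuclideanSpace.basisFun (Fin 3) ℝ).toBasis.det with
    cont := by
      change Continuous fun v : Fin 3 → E3 =>
        (EuclideanSpace.basisFun (Fin 3) ℝ).toBasis.det v
      simp only [Module.Basis.det_apply, Matrix.det_fin_three, Module.Basis.toMatrix_apply,
        OrthonormalBasis.coe_toBasis_repr_apply, EuclideanSpace.basisFun_repr]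
      fun_prop }

/-- The Hodge star of a covector for the Euclidean metric and the standard orientation: the
contraction of the volume form with the dual vector, so that
`⋆(a dx + b dy + c dz) = a dy ∧ dz + b dz ∧ dx + c dx ∧ dy`. -/
def hodgeStar (α : E3 →L[ℝ] ℝ) : E3 [⋀^Fin 2]→L[ℝ] ℝ :=
  volForm.curryLeft ((InnerProductSpace.toDual ℝ E3).symm α)

/-- The 2-form `⋆dV`. -/
def starD (V : E3 → ℝ) : DiffForm 2 := fun x => hodgeStar (fderiv ℝ V x)

/-- The integral of a 2-form over the sphere of centre `q` and radius `r`, oriented by the outward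
normal: in spherical coordinates `σ(θ, φ) = q + r (sin θ cos φ, sin θ sin φ, cos θ)` it is
`∫_0^π ∫_0^{2π} η(σ)(∂σ/∂θ, ∂σ/∂φ) dφ dθ`. -/
def sphereIntegral (q : E3) (r : ℝ) (η : DiffForm 2) : ℝ :=
  ∫ θ in (0 : ℝ)..Real.pi, ∫ φ in (0 : ℝ)..(2 * Real.pi),
    η (q + r • !₂[Real.sin θ * Real.cos φ, Real.sin θ * Real.sin φ, Real.cos θ])
      ![r • !₂[Real.cos θ * Real.cos φ, Real.cos θ * Real.sin φ, -Real.sin θ],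
        r • !₂[-(Real.sin θ * Real.sin φ), Real.sin θ * Real.cos φ, 0]]

/-- The value of the class `c` on a small sphere around `q` is `a`: a closed form representing `c`
has integral `a` over all sufficiently small spheres centred at `q`. -/
def HasSphereValue {U : Set E3} (c : DeRhamH2 U) (q : E3) (a : ℝ) : Prop :=
  ∃ η : closedForms 2 U, deRhamClass η = c ∧
    ∀ᶠ r in 𝓝[>] (0 : ℝ), sphereIntegral q r (η : DiffForm 2) = a

/-- `c` is the integral class `(e_j)` on the complement of the points `p_j`, under
`H²(U; ℤ) = ∏_j ℤ ⊆ H²(U; ℝ)`: its value on a small sphere around `p_j` is the integer `e_j`. -/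
def IsIntegralClass {ι : Type*} (p : ι → E3) (c : DeRhamH2 (range p)ᶜ) (e : ι → ℤ) : Prop :=
  ∀ j, HasSphereValue c (p j) (e j)

/-- `⋆dV` is (on `U`) a closed form in the class `c`. -/
def StarDRepresents {U : Set E3} (V : E3 → ℝ) (c : DeRhamH2 U) : Prop :=
  ∃ η : closedForms 2 U, EqOn (η : DiffForm 2) (starD V) U ∧ deRhamClass η = c

end

/-! View `V` as an electrostatic potential. The Newton kernel 1/|x - p| has flux -4π through every
sphere around p, so charges |e_j|/(4π) at the p_j produce the periods e_j when e_j ≤ 0.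

Sufficiency. Convergence of the series at one point of U gives convergence on all of U, and V = 1 +
∑ |e_j|/(4π|x - p_j|) is positive. Harmonicity of the sum is `smoothHarmonicAt_tsum_newton`: after a
change of parameters the series is an integral of a smooth kernel over a compact set against a
finite measure. That V has the right class follows because periods determine the class: on the
complement of a closed discrete set in a star-convex open set, a closed 2-form with zero integrals
over small spheres is exact (`exists_primitive_of_sphereIntegral_eq_zero`). Its local primitives on
punctured balls, cut off and subtracted, leave a closed form that extends over the punctures, and
the Poincaré lemma applies to it.

Necessity. Around p_j the spherical means of V have the form -e_j/s + b; since V ≥ 0, letting s tend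
to 0 gives e_j ≤ 0 (`flux_nonpos`). For q in U take u = 1/|x - q| - 1/R, which vanishes on the
sphere of radius R about q. The flux form of u∇V - V∇u is closed off q and the p_j, with residue
4πV(q) at q and u(p_j)e_j at p_j, while its integral over the large sphere is a mean of V, hence
nonnegative. So ∑ |e_j|(1/|q - p_j| - 1/R) ≤ 4πV(q), and R → ∞ bounds the series (`flux_sum_le`).
The residue at p_j is the delicate point, since V is only known to be nonnegative there;
`greenFlux_eq` obtains it from spherical means, with no classification of singularities.

The sum of residues (`sphereIntegral_eq_sum_residues`) is itself a consequence of the exactness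
theorem, after subtraction of monopoles. Thus Stokes' theorem is only needed on spheres in
coordinates, never on a domain with holes. -/

noncomputable section

set_option maxSynthPendingDepth 3

/-! ### Smooth dependence of integrals on parameters -/

section ParametricIntegral

open MeasureTheory

variable {X P F : Type} [NormedAddCommGroup X] [NormedSpace ℝ X] [NormedAddCommGroup P]
  [NormedSpace ℝ P] [MeasurableSpace P] [BorelSpace P] [NormedAddCommGroup F] [NormedSpace ℝ F]

/-- Differentiation under the integral over a compact set, for a jointly `C¹` integrand. -/
theorem hasFDerivAt_setIntegral_of_contDiffAt {μ : Measure P} [IsFiniteMeasureOnCompacts μ]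
    {K : Set P} (hK : IsCompact K) {H : X × P → F} {x₀ : X}
    (hH : ∀ m ∈ K, ContDiffAt ℝ 1 H (x₀, m)) :
    HasFDerivAt (fun x => ∫ m in K, H (x, m) ∂μ)
      (∫ m in K, (fderiv ℝ H (x₀, m)).comp (ContinuousLinearMap.inl ℝ X P) ∂μ) x₀ := by
  have hKm : MeasurableSet K := hK.measurableSet
  have hD : ∀ m ∈ K, ContinuousAt (fderiv ℝ H) (x₀, m) := fun m hm =>
    ((hH m hm).fderiv_right (m := 0) (by simp)).continuousAt
  have hslice : ContinuousOn (fun m => fderiv ℝ H (x₀, m)) K := fun m hm =>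
    ((hD m hm).comp (f := fun m => (x₀, m)) (by fun_prop)).continuousWithinAt
  obtain ⟨C, hC⟩ := hK.exists_bound_of_continuousOn hslice
  -- By compactness of `K`, one neighbourhood of `x₀` serves all `m` at once, with the uniform
  -- derivative bound `C + 1` that domination requires.
  have hev : ∀ᶠ x in 𝓝 x₀, ∀ m ∈ K, ContDiffAt ℝ 1 H (x, m) ∧ ‖fderiv ℝ H (x, m)‖ < C + 1 := by
    refine hK.eventually_forall_of_forall_eventually fun m hm => ?_
    refine ((hH m hm).eventually (by simp)).and ?_
    exact ((hD m hm).norm).eventually_lt continuousAt_const (by linarith [hC m hm])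
  have hcont : ∀ x, (∀ m ∈ K, ContDiffAt ℝ 1 H (x, m)) → ContinuousOn (fun m => H (x, m)) K :=
    fun x hx m hm => ((hx m hm).continuousAt.comp (f := fun m => (x, m))
      (by fun_prop)).continuousWithinAt
  have hae : ∀ {p : P → Prop}, (∀ m ∈ K, p m) → ∀ᵐ m ∂(μ.restrict K), p m := fun h =>
    (ae_restrict_iff' hKm).2 (Eventually.of_forall h)
  refine hasFDerivAt_integral_of_dominated_of_fderiv_le (𝕜 := ℝ) (F := fun x m => H (x, m))
    (F' := fun x m => (fderiv ℝ H (x, m)).comp (ContinuousLinearMap.inl ℝ X P))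
    (bound := fun _ => (C + 1) * ‖ContinuousLinearMap.inl ℝ X P‖) hev ?_ ?_ ?_ ?_ ?_ ?_
  · filter_upwards [hev] with x hx
    exact (hcont x fun m hm => (hx m hm).1).aestronglyMeasurable_of_isCompact hK hKm
  · exact (hcont x₀ hH).integrableOn_compact hK
  · exact (hslice.clm_comp continuousOn_const).aestronglyMeasurable_of_isCompact hK hKm
  · refine hae fun m hm x hx => ?_
    refine (ContinuousLinearMap.opNorm_comp_le _ _).trans ?_
    exact mul_le_mul_of_nonneg_right (hx m hm).2.le (norm_nonneg _)
  · exact integrableOn_const hK.measure_lt_top.ne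
  · refine hae fun m hm x hx => ?_
    have h1 := ((hx m hm).1.differentiableAt (by simp)).hasFDerivAt
    exact h1.comp x ((hasFDerivAt_id x).prodMk (hasFDerivAt_const m x))

/-- The derivative is again a parametric integral, with values in a space of linear maps; the
codomain is therefore quantified inside the induction on `n`. One order of smoothness is lost, which
is harmless for smooth integrands. -/
theorem contDiffAt_setIntegral_nat {μ : Measure P} [IsFiniteMeasureOnCompacts μ]
    {K : Set P} (hK : IsCompact K) {x₀ : X} (n : ℕ) : ∀ {F : Type} [NormedAddCommGroup F]
    [NormedSpace ℝ F] {H : X × P → F}, (∀ m ∈ K, ContDiffAt ℝ (n + 1 : ℕ) H (x₀, m)) →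
    ContDiffAt ℝ n (fun x => ∫ m in K, H (x, m) ∂μ) x₀ := by
  have hev : ∀ (n : ℕ) {F : Type} [NormedAddCommGroup F] [NormedSpace ℝ F] {H : X × P → F},
      (∀ m ∈ K, ContDiffAt ℝ (n + 1 : ℕ) H (x₀, m)) →
      ∀ᶠ x in 𝓝 x₀, HasFDerivAt (fun x => ∫ m in K, H (x, m) ∂μ)
        (∫ m in K, (fderiv ℝ H (x, m)).comp (ContinuousLinearMap.inl ℝ X P) ∂μ) x := by
    intro n F _ _ H hH
    have : ∀ᶠ x in 𝓝 x₀, ∀ m ∈ K, ContDiffAt ℝ 1 H (x, m) := by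
      refine hK.eventually_forall_of_forall_eventually fun m hm => ?_
      exact (((hH m hm).of_le (by norm_cast; omega)).eventually (by simp))
    filter_upwards [this] with x hx using hasFDerivAt_setIntegral_of_contDiffAt hK hx
  induction n with
  | zero =>
    intro F _ _ H hH
    refine contDiffAt_zero.2 ⟨_, hev 0 hH, fun x hx => ?_⟩
    exact (show HasFDerivAt _ _ x from hx).continuousAt.continuousWithinAt
  | succ n ih =>
    intro F _ _ H hH
    rw [Nat.cast_succ, contDiffAt_succ_iff_hasFDerivAt]
    refine ⟨_, ⟨_, hev (n + 1) hH, fun x hx => hx⟩, ?_⟩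
    refine ih (H := fun z => (fderiv ℝ H z).comp (ContinuousLinearMap.inl ℝ X P)) fun m hm => ?_
    exact ((hH m hm).fderiv_right (m := (n + 1 : ℕ)) (by norm_cast)).clm_comp contDiffAt_const

/-- An integral over a compact set depends smoothly on parameters. -/
theorem contDiffAt_setIntegral {μ : Measure P} [IsFiniteMeasureOnCompacts μ]
    {K : Set P} (hK : IsCompact K) {x₀ : X} {H : X × P → F}
    (hH : ∀ m ∈ K, ContDiffAt ℝ ∞ H (x₀, m)) :
    ContDiffAt ℝ ∞ (fun x => ∫ m in K, H (x, m) ∂μ) x₀ :=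
  contDiffAt_infty.2 fun n => contDiffAt_setIntegral_nat hK n fun m hm =>
    (hH m hm).of_le (by exact_mod_cast le_top)

end ParametricIntegral

/-! ### The Poincaré lemma by the homotopy operator -/

section Poincare

open MeasureTheory ContinuousAlternatingMap

variable {E : Type} [NormedAddCommGroup E] [NormedSpace ℝ E]

theorem two_le_smooth : minSmoothness ℝ 2 ≤ (∞ : WithTop ℕ∞) := by
  rw [minSmoothness_of_isRCLikeNormedField]
  exact WithTop.coe_le_coe.2 (le_top : (2 : ℕ∞) ≤ ⊤)

theorem ContDiffAt.extDeriv {k : ℕ} {η : E → E [⋀^Fin k]→L[ℝ] ℝ} {x : E}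
    (h : ContDiffAt ℝ ∞ η x) : ContDiffAt ℝ ∞ (extDeriv η) x :=
  ((alternatizeUncurryFinCLM (n := k) ℝ E ℝ).contDiff (n := ∞)).contDiffAt.comp x
    (h.fderiv_right (m := ∞) (by simp))

theorem ContDiffAt.continuousAlternatingMap_apply_const {X : Type} [NormedAddCommGroup X]
    [NormedSpace ℝ X] {k : ℕ} {n : WithTop ℕ∞} {η : X → E [⋀^Fin k]→L[ℝ] ℝ} {x : X}
    (h : ContDiffAt ℝ n η x) (v : Fin k → E) : ContDiffAt ℝ n (fun y => η y v) x :=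
  (apply ℝ E ℝ v).contDiff.contDiffAt.comp x h

theorem ContDiffAt.continuousAlternatingMap_curryLeft_apply {X : Type} [NormedAddCommGroup X]
    [NormedSpace ℝ X] {k : ℕ} {n : WithTop ℕ∞} {η : X → E [⋀^Fin (k + 1)]→L[ℝ] ℝ} {a : X → E}
    {x : X} (h : ContDiffAt ℝ n η x) (ha : ContDiffAt ℝ n a x) :
    ContDiffAt ℝ n (fun y => (η y).curryLeft (a y)) x :=
  (((curryLeftLI (𝕜 := ℝ) (E := E) (F := ℝ) (n := k)).contDiff (n := n)).contDiffAt.comp x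
    h).clm_apply ha

/-- The contraction `(x, t) ↦ q + t (x - q)` of `E` to `q`. -/
def contraction (q : E) (z : E × ℝ) : E := q + z.2 • (z.1 - q)

theorem contDiff_contraction (q : E) : ContDiff ℝ ∞ (contraction q) := by
  unfold contraction; fun_prop

theorem fderiv_contraction_apply (q : E) (z w : E × ℝ) :
    fderiv ℝ (contraction q) z w = z.2 • w.1 + w.2 • (z.1 - q) := by
  have : HasFDerivAt (contraction q) _ z :=
    ((hasFDerivAt_snd (𝕜 := ℝ) (E := E) (F := ℝ) (p := z)).smul
      ((hasFDerivAt_fst (𝕜 := ℝ) (E := E) (F := ℝ) (p := z)).sub_const q)).const_add q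
  rw [this.fderiv]
  simp

/-- The integrand of the homotopy operator. -/
def homotopyIntegrand {k : ℕ} (q : E) (η : E → E [⋀^Fin (k + 1)]→L[ℝ] ℝ) (z : E × ℝ) :
    E [⋀^Fin k]→L[ℝ] ℝ :=
  z.2 ^ k • (η (contraction q z)).curryLeft (z.1 - q)

theorem contDiffAt_homotopyIntegrand {k : ℕ} {q : E} {η : E → E [⋀^Fin (k + 1)]→L[ℝ] ℝ}
    {z : E × ℝ} (h : ContDiffAt ℝ ∞ η (contraction q z)) :
    ContDiffAt ℝ ∞ (homotopyIntegrand q η) z := by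
  unfold homotopyIntegrand
  refine ContDiffAt.smul (contDiff_snd.pow k).contDiffAt ?_
  exact (h.comp z (contDiff_contraction q).contDiffAt).continuousAlternatingMap_curryLeft_apply
    (by fun_prop)

/-- Cartan's formula for the pullback under the contraction, evaluated on vectors tangent to `E`. -/
theorem sum_fderiv_homotopyIntegrand {k : ℕ} {q : E} {η : E → E [⋀^Fin (k + 1)]→L[ℝ] ℝ}
    {x : E} {t : ℝ} (h : ContDiffAt ℝ ∞ η (contraction q (x, t)))
    (hd : extDeriv η (contraction q (x, t)) = 0) (v : Fin (k + 1) → E) :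
    ∑ i : Fin (k + 1), (-1 : ℝ) ^ (i : ℕ) *
        fderiv ℝ (homotopyIntegrand q η) (x, t) (v i, 0) (i.removeNth v) =
      fderiv ℝ (fun z : E × ℝ => z.2 ^ (k + 1) * η (contraction q z) v) (x, t) (0, 1) := by
  -- `W` is the pullback of `η` under the contraction, so it is closed at `(x, t)`. Evaluating `dW =
  -- 0` on the time vector followed by the `v i` gives the formula.
  set W : E × ℝ → (E × ℝ) [⋀^Fin (k + 1)]→L[ℝ] ℝ := fun z =>
    (η (contraction q z)).compContinuousLinearMap (fderiv ℝ (contraction q) z) with hW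
  have hWd : DifferentiableAt ℝ W (x, t) := by
    refine DifferentiableAt.continuousAlternatingMapCompContinuousLinearMap ?_ ?_
    · exact ((h.comp (x, t) (contDiff_contraction q).contDiffAt).differentiableAt (by simp))
    · exact ((contDiff_contraction q).contDiffAt.fderiv_right (m := ∞)
        (by simp)).differentiableAt (by simp)
  have hext : extDeriv W (x, t) = 0 := by
    rw [hW, extDeriv_pullback (h.differentiableAt (by simp))
      (contDiff_contraction q).contDiffAt two_le_smooth, hd]
    ext; simp
  set v' : Fin (k + 1) → E × ℝ := fun i => (v i, 0) with hv'
  have key := extDeriv_apply hWd (Fin.cons (0, 1) v')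
  rw [hext, Fin.sum_univ_succ, show (0 : (E × ℝ) [⋀^Fin (k + 1 + 1)]→L[ℝ] ℝ)
    (Fin.cons (0, 1) v') = 0 from rfl] at key
  have h0 : (fun z => W z v') = fun z : E × ℝ => z.2 ^ (k + 1) * η (contraction q z) v := by
    funext z
    simp only [hW, compContinuousLinearMap_apply, Function.comp_def]
    have : (fun i => fderiv ℝ (contraction q) z (v' i)) = fun i => z.2 • v i := by
      funext i; simp [fderiv_contraction_apply, hv']
    rw [this, (η (contraction q z)).map_smul_univ]
    simp
  -- The contraction moves with velocity `x - q` in time and scales space vectors by `t`: with one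
  -- time slot filled, `k` factors `t` come out, against `k + 1` in `h0`.
  have h1 : ∀ i : Fin (k + 1), (fun z => W z (Fin.cons (0, 1) (i.removeNth v'))) =
      fun z => homotopyIntegrand q η z (i.removeNth v) := by
    intro i
    funext z
    have : (fun j => fderiv ℝ (contraction q) z
        ((Fin.cons (0, 1) (i.removeNth v') : Fin (k + 1) → E × ℝ) j)) =
        Fin.cons (z.1 - q) (fun j => z.2 • i.removeNth v j) := by
      funext j
      refine Fin.cases ?_ (fun j => ?_) j
      · simp [fderiv_contraction_apply]
      · simp [fderiv_contraction_apply, hv', Fin.removeNth]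
    simp only [hW, compContinuousLinearMap_apply, homotopyIntegrand,
      ContinuousAlternatingMap.smul_apply, curryLeft_apply_apply, Function.comp_def]
    rw [this]
    have := ((η (contraction q z)).curryLeft (z.1 - q)).map_smul_univ (fun _ => z.2)
      (i.removeNth v)
    simp only [curryLeft_apply_apply, Finset.prod_const, Finset.card_univ, Fintype.card_fin] at this
    exact this
  have hr : ∀ i : Fin (k + 1), (i.succ.removeNth (Fin.cons (0, 1) v' : Fin (k + 2) → E × ℝ)) =
      (Fin.cons (0, 1) (i.removeNth v') : Fin (k + 1) → E × ℝ) := by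
    intro i
    funext j
    refine Fin.cases ?_ (fun j => ?_) j
    · simp [Fin.removeNth]
    · simp [Fin.removeNth]
  have hJ := (contDiffAt_homotopyIntegrand h).differentiableAt (by simp : (∞ : WithTop ℕ∞) ≠ 0)
  simp only [hr, h1, Fin.removeNth_zero, Fin.tail_cons, h0, Fin.cons_zero, Fin.cons_succ,
    Fin.val_zero, pow_zero, one_smul, Fin.val_succ, pow_succ, mul_neg, mul_one,
    neg_smul, Finset.sum_neg_distrib] at key
  have e : ∀ i : Fin (k + 1), fderiv ℝ (homotopyIntegrand q η) (x, t) (v i, 0) (i.removeNth v) =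
      fderiv ℝ (fun z => homotopyIntegrand q η z (i.removeNth v)) (x, t) (v' i) := fun i => by
    rw [fderiv_continuousAlternatingMap_apply_const_apply hJ]
  simp only [e]
  simp only [zsmul_eq_mul, Int.cast_pow, Int.cast_neg, Int.cast_one, ← pow_succ] at key
  linarith

/-- The Poincaré lemma on a star-convex set. -/
theorem exists_extDeriv_eq_of_starConvex {k : ℕ} {S : Set E} {q : E}
    (hq : StarConvex ℝ q S) {η : E → E [⋀^Fin (k + 1)]→L[ℝ] ℝ}
    (hη : ∀ x ∈ S, ContDiffAt ℝ ∞ η x ∧ extDeriv η x = 0) :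
    ∃ α : E → E [⋀^Fin k]→L[ℝ] ℝ, ∀ x ∈ S, ContDiffAt ℝ ∞ α x ∧ extDeriv α x = η x := by
  have hmem : ∀ x ∈ S, ∀ t ∈ Icc (0 : ℝ) 1, contraction q (x, t) ∈ S := fun x hx t ht => by
    have := hq hx (sub_nonneg.2 ht.2) ht.1 (by ring)
    convert this using 1
    simp only [contraction]; module
  have hJ : ∀ x ∈ S, ∀ t ∈ Icc (0 : ℝ) 1, ContDiffAt ℝ ∞ (homotopyIntegrand q η) (x, t) :=
    fun x hx t ht => contDiffAt_homotopyIntegrand (hη _ (hmem x hx t ht)).1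
  -- The primitive is the homotopy operator ∫₀¹ t^k ι_{x-q} η(q + t(x - q)) dt. Its exterior
  -- derivative is the integral of the time derivative of t^(k+1) η(q + t(x - q)).
  refine ⟨fun x => ∫ t in Icc (0 : ℝ) 1, homotopyIntegrand q η (x, t), fun x hx =>
    ⟨contDiffAt_setIntegral isCompact_Icc (hJ x hx), ?_⟩⟩
  have hder := hasFDerivAt_setIntegral_of_contDiffAt (μ := volume) isCompact_Icc
    (fun t ht => (hJ x hx t ht).of_le (by simp : (1 : WithTop ℕ∞) ≤ ∞))
  have hcont : ContinuousOn (fun t : ℝ => (fderiv ℝ (homotopyIntegrand q η) (x, t)).comp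
      (ContinuousLinearMap.inl ℝ E ℝ)) (Icc 0 1) := by
    intro t ht
    refine ContinuousAt.continuousWithinAt ?_
    refine ContinuousAt.clm_comp ?_ continuousAt_const
    exact ContinuousAt.comp (f := fun t : ℝ => (x, t))
      ((hJ x hx t ht).fderiv_right (m := 0) (by simp)).continuousAt (by fun_prop)
  have hint : IntegrableOn (fun t : ℝ => (fderiv ℝ (homotopyIntegrand q η) (x, t)).comp
      (ContinuousLinearMap.inl ℝ E ℝ)) (Icc 0 1) :=
    ContinuousOn.integrableOn_compact isCompact_Icc hcont
  ext v
  rw [extDeriv, alternatizeUncurryFin_apply, hder.fderiv]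
  have hI : ∀ i : Fin (k + 1), ((∫ t in Icc (0 : ℝ) 1, (fderiv ℝ (homotopyIntegrand q η)
      (x, t)).comp (ContinuousLinearMap.inl ℝ E ℝ)) (v i)) (i.removeNth v) =
      ∫ t in Icc (0 : ℝ) 1, fderiv ℝ (homotopyIntegrand q η) (x, t) (v i, 0) (i.removeNth v) := by
    intro i
    rw [ContinuousLinearMap.integral_apply hint, ← apply_apply (𝕜 := ℝ) (m := i.removeNth v),
      ← ContinuousLinearMap.integral_comp_comm]
    · simp
    · exact (hcont.clm_apply continuousOn_const).integrableOn_compact isCompact_Icc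
  simp only [hI, zsmul_eq_mul, Int.cast_pow, Int.cast_neg, Int.cast_one]
  have hint' : ∀ i : Fin (k + 1), IntegrableOn (fun t : ℝ => fderiv ℝ (homotopyIntegrand q η)
      (x, t) (v i, 0) (i.removeNth v)) (Icc 0 1) := fun i => by
    refine ContinuousOn.integrableOn_compact isCompact_Icc ?_
    have := hcont.clm_apply (continuousOn_const (c := v i))
    exact (apply ℝ E ℝ (i.removeNth v)).continuous.comp_continuousOn this
  simp only [← integral_const_mul]
  rw [← integral_finsetSum _ fun i _ => (hint' i).const_mul _]
  have hcongr := setIntegral_congr_fun (μ := volume) (measurableSet_Icc (a := (0 : ℝ)) (b := 1))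
    (fun t ht => sum_fderiv_homotopyIntegrand (hη _ (hmem x hx t ht)).1
      (hη _ (hmem x hx t ht)).2 v)
  refine hcongr.trans ?_
  have hg : ∀ t ∈ Icc (0 : ℝ) 1,
      ContDiffAt ℝ ∞ (fun z : E × ℝ => z.2 ^ (k + 1) * η (contraction q z) v) (x, t) := fun t ht =>
    ContDiffAt.mul (by fun_prop) ((((hη _ (hmem x hx t ht)).1.comp (x, t)
      (contDiff_contraction q).contDiffAt).continuousAlternatingMap_apply_const v))
  -- At `t = 1` the boundary value is `η x v`; at `t = 0` it vanishes because of the positive power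
  -- of `t`.
  rw [integral_Icc_eq_integral_Ioc, ← intervalIntegral.integral_of_le zero_le_one,
    intervalIntegral.integral_eq_sub_of_hasDerivAt
      (f := fun t => t ^ (k + 1) * η (contraction q (x, t)) v)]
  · simp [contraction]
  · intro t ht
    rw [uIcc_of_le zero_le_one] at ht
    have := ((hg t ht).differentiableAt (by simp)).hasFDerivAt.comp_hasDerivAt t
      ((hasDerivAt_const t x).prodMk (hasDerivAt_id t))
    exact this
  · refine ContinuousOn.intervalIntegrable ?_
    rw [uIcc_of_le zero_le_one]
    intro t ht
    refine ContinuousAt.continuousWithinAt (ContinuousAt.clm_apply ?_ continuousAt_const)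
    exact ContinuousAt.comp (f := fun t : ℝ => (x, t))
      ((hg t ht).fderiv_right (m := 0) (by simp)).continuousAt (by fun_prop)

end Poincare

/-! ### Stokes' theorem on spheres in spherical coordinates -/

section Sphere

open MeasureTheory ContinuousAlternatingMap

theorem ContDiffAt.form_apply_one {E X : Type} [NormedAddCommGroup E] [NormedSpace ℝ E]
    [NormedAddCommGroup X] [NormedSpace ℝ X] {n : WithTop ℕ∞} {η : X → E [⋀^Fin 1]→L[ℝ] ℝ}
    {a : X → E} {x : X} (h : ContDiffAt ℝ n η x) (ha : ContDiffAt ℝ n a x) :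
    ContDiffAt ℝ n (fun y => η y ![a y]) x :=
  (h.continuousAlternatingMap_curryLeft_apply ha).continuousAlternatingMap_apply_const ![]

theorem ContDiffAt.form_apply_two {E X : Type} [NormedAddCommGroup E] [NormedSpace ℝ E]
    [NormedAddCommGroup X] [NormedSpace ℝ X] {n : WithTop ℕ∞} {η : X → E [⋀^Fin 2]→L[ℝ] ℝ}
    {a b : X → E} {x : X} (h : ContDiffAt ℝ n η x) (ha : ContDiffAt ℝ n a x)
    (hb : ContDiffAt ℝ n b x) : ContDiffAt ℝ n (fun y => η y ![a y, b y]) x :=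
  (h.continuousAlternatingMap_curryLeft_apply ha).form_apply_one hb

/-- The unit sphere in spherical coordinates `(θ, φ)`. -/
def sphereMap (z : ℝ × ℝ) : E3 :=
  !₂[Real.sin z.1 * Real.cos z.2, Real.sin z.1 * Real.sin z.2, Real.cos z.1]

/-- The `θ`-derivative of `sphereMap`. -/
def sphereMapTheta (z : ℝ × ℝ) : E3 :=
  !₂[Real.cos z.1 * Real.cos z.2, Real.cos z.1 * Real.sin z.2, -Real.sin z.1]

/-- The `φ`-derivative of `sphereMap`. -/
def sphereMapPhi (z : ℝ × ℝ) : E3 :=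
  !₂[-(Real.sin z.1 * Real.sin z.2), Real.sin z.1 * Real.cos z.2, 0]

theorem contDiff_sphereMap : ContDiff ℝ ∞ sphereMap := by
  refine contDiff_euclidean.2 fun i => ?_
  fin_cases i <;> simp [sphereMap] <;> fun_prop

theorem contDiff_sphereMapTheta : ContDiff ℝ ∞ sphereMapTheta := by
  refine contDiff_euclidean.2 fun i => ?_
  fin_cases i <;> simp [sphereMapTheta] <;> fun_prop

theorem contDiff_sphereMapPhi : ContDiff ℝ ∞ sphereMapPhi := by
  refine contDiff_euclidean.2 fun i => ?_
  fin_cases i <;> simp [sphereMapPhi] <;> fun_prop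

theorem hasFDerivAt_sphereMap (z : ℝ × ℝ) :
    HasFDerivAt sphereMap ((ContinuousLinearMap.fst ℝ ℝ ℝ).smulRight (sphereMapTheta z) +
      (ContinuousLinearMap.snd ℝ ℝ ℝ).smulRight (sphereMapPhi z)) z := by
  have h1 : HasFDerivAt (fun z : ℝ × ℝ => z.1) (ContinuousLinearMap.fst ℝ ℝ ℝ) z := hasFDerivAt_fst
  have h2 : HasFDerivAt (fun z : ℝ × ℝ => z.2) (ContinuousLinearMap.snd ℝ ℝ ℝ) z := hasFDerivAt_snd
  rw [← hasFDerivWithinAt_univ, hasFDerivWithinAt_euclidean]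
  intro i
  rw [hasFDerivWithinAt_univ]
  fin_cases i
  · refine (h1.sin.mul h2.cos).congr_fderiv ?_
    ext <;> simp [sphereMapTheta, sphereMapPhi, mul_comm]
  · refine (h1.sin.mul h2.sin).congr_fderiv ?_
    ext <;> simp [sphereMapTheta, sphereMapPhi, mul_comm]
  · refine h1.cos.congr_fderiv ?_
    ext <;> simp [sphereMapTheta, sphereMapPhi]

theorem norm_sphereMap (z : ℝ × ℝ) : ‖sphereMap z‖ = 1 := by
  have h1 := Real.sin_sq_add_cos_sq z.1
  have h2 := Real.sin_sq_add_cos_sq z.2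
  rw [EuclideanSpace.norm_eq, Fin.sum_univ_three]
  simp only [sphereMap, Real.norm_eq_abs, sq_abs]
  rw [Real.sqrt_eq_one]
  simp
  linear_combination h1 + Real.sin z.1 ^ 2 * h2

theorem sphereIntegral_eq (q : E3) (r : ℝ) (η : DiffForm 2) :
    sphereIntegral q r η = ∫ θ in (0 : ℝ)..Real.pi, ∫ φ in (0 : ℝ)..(2 * Real.pi),
      η (q + r • sphereMap (θ, φ)) ![r • sphereMapTheta (θ, φ), r • sphereMapPhi (θ, φ)] := rfl

/-- The parameter rectangle of the sphere. -/
def sphereRect : Set (ℝ × ℝ) := Icc 0 Real.pi ×ˢ Icc 0 (2 * Real.pi)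

theorem isCompact_sphereRect : IsCompact sphereRect := isCompact_Icc.prod isCompact_Icc

theorem integral_sphereRect {g : ℝ × ℝ → ℝ} (hg : ContinuousOn g sphereRect) :
    ∫ θ in (0 : ℝ)..Real.pi, ∫ φ in (0 : ℝ)..(2 * Real.pi), g (θ, φ) = ∫ z in sphereRect, g z := by
  have hi : IntegrableOn g (Icc 0 Real.pi ×ˢ Icc 0 (2 * Real.pi)) (volume.prod volume) :=
    hg.integrableOn_compact isCompact_sphereRect
  rw [sphereRect, Measure.volume_eq_prod, setIntegral_prod _ hi,
    intervalIntegral.integral_of_le Real.pi_pos.le, integral_Icc_eq_integral_Ioc]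
  refine integral_congr_ae (Eventually.of_forall fun θ => ?_)
  simp only
  rw [intervalIntegral.integral_of_le Real.two_pi_pos.le, integral_Icc_eq_integral_Ioc]

/-- Green's theorem on a band of the parameter rectangle, for data periodic in `φ`. -/
theorem integral_band_divergence {f g : ℝ × ℝ → ℝ} {a b : ℝ}
    (hf : ∀ θ ∈ uIcc a b, ∀ φ, ContDiffAt ℝ 1 f (θ, φ))
    (hg : ∀ θ ∈ uIcc a b, ∀ φ, ContDiffAt ℝ 1 g (θ, φ))
    (hper : ∀ θ, g (θ, 2 * Real.pi) = g (θ, 0)) :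
    ∫ θ in a..b, ∫ φ in (0 : ℝ)..(2 * Real.pi),
        (fderiv ℝ f (θ, φ) (1, 0) + fderiv ℝ g (θ, φ) (0, 1)) =
      (∫ φ in (0 : ℝ)..(2 * Real.pi), f (b, φ)) - ∫ φ in (0 : ℝ)..(2 * Real.pi), f (a, φ) := by
  have hsub : Ioo (min a b) (max a b) ⊆ uIcc a b := Ioo_subset_Icc_self
  rw [integral2_divergence_prod_of_hasFDerivAt_off_countable f g (fderiv ℝ f) (fderiv ℝ g) a 0 b
    (2 * Real.pi) ∅ countable_empty]
  -- The edges φ = 0 and φ = 2π cancel by periodicity.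
  · simp only [hper]; ring
  · rintro ⟨θ, φ⟩ hz
    exact (hf θ hz.1 φ).continuousAt.continuousWithinAt
  · rintro ⟨θ, φ⟩ hz
    exact (hg θ hz.1 φ).continuousAt.continuousWithinAt
  · rintro ⟨θ, φ⟩ hz
    exact ((hf θ (hsub hz.1.1) φ).differentiableAt (by simp)).hasFDerivAt
  · rintro ⟨θ, φ⟩ hz
    exact ((hg θ (hsub hz.1.1) φ).differentiableAt (by simp)).hasFDerivAt
  · refine ContinuousOn.integrableOn_compact (isCompact_uIcc.prod isCompact_uIcc) ?_
    rintro ⟨θ, φ⟩ hz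
    refine ContinuousAt.continuousWithinAt (ContinuousAt.add ?_ ?_)
    · exact ((hf θ hz.1 φ).fderiv_right (m := 0) (by simp)).continuousAt.clm_apply
        continuousAt_const
    · exact ((hg θ hz.1 φ).fderiv_right (m := 0) (by simp)).continuousAt.clm_apply
        continuousAt_const

/-- The pullback of a form under a smooth map is differentiable. -/
theorem differentiableAt_pullback {E X : Type} [NormedAddCommGroup E] [NormedSpace ℝ E]
    [NormedAddCommGroup X] [NormedSpace ℝ X] {k : ℕ} {η : E → E [⋀^Fin k]→L[ℝ] ℝ} {σ : X → E}
    {z : X} (hσ : ContDiff ℝ ∞ σ) (h : ContDiffAt ℝ ∞ η (σ z)) :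
    DifferentiableAt ℝ (fun z => (η (σ z)).compContinuousLinearMap (fderiv ℝ σ z)) z :=
  DifferentiableAt.continuousAlternatingMapCompContinuousLinearMap
    ((h.comp z hσ.contDiffAt).differentiableAt (by simp))
    ((hσ.contDiffAt.fderiv_right (m := ∞) (by simp)).differentiableAt (by simp))

theorem contDiff_sphereMap_affine (q : E3) (r : ℝ) :
    ContDiff ℝ ∞ (fun z => q + r • sphereMap z) :=
  contDiff_const.add (contDiff_sphereMap.const_smul r)

theorem fderiv_sphereMap_affine (q : E3) (r : ℝ) (z w : ℝ × ℝ) :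
    fderiv ℝ (fun z => q + r • sphereMap z) z w =
      w.1 • r • sphereMapTheta z + w.2 • r • sphereMapPhi z := by
  have h : HasFDerivAt (fun z => q + r • sphereMap z) _ z :=
    ((hasFDerivAt_sphereMap z).const_smul r).const_add q
  rw [h.fderiv]
  simp [smul_comm r]

/-- Stokes' theorem on a band of a sphere. -/
theorem integral_band_extDeriv {α : DiffForm 1} {q : E3} {r a b : ℝ}
    (hα : ∀ θ ∈ uIcc a b, ∀ φ, ContDiffAt ℝ ∞ α (q + r • sphereMap (θ, φ))) :
    ∫ θ in a..b, ∫ φ in (0 : ℝ)..(2 * Real.pi), extDeriv α (q + r • sphereMap (θ, φ))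
        ![r • sphereMapTheta (θ, φ), r • sphereMapPhi (θ, φ)] =
      (∫ φ in (0 : ℝ)..(2 * Real.pi), α (q + r • sphereMap (b, φ)) ![r • sphereMapPhi (b, φ)]) -
      ∫ φ in (0 : ℝ)..(2 * Real.pi), α (q + r • sphereMap (a, φ)) ![r • sphereMapPhi (a, φ)] := by
  set σ : ℝ × ℝ → E3 := fun z => q + r • sphereMap z with hσ
  have hσs : ContDiff ℝ ∞ σ := contDiff_sphereMap_affine q r
  -- The pullback of `α` is -g dθ + f dφ, so its exterior derivative has the coefficient ∂f/∂θ +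
  -- ∂g/∂φ.
  set f : ℝ × ℝ → ℝ := fun z => α (σ z) ![r • sphereMapPhi z] with hf
  set g : ℝ × ℝ → ℝ := fun z => -α (σ z) ![r • sphereMapTheta z] with hg
  have hασ : ∀ θ ∈ uIcc a b, ∀ φ, ContDiffAt ℝ ∞ (fun z => α (σ z)) (θ, φ) := fun θ hθ φ =>
    (hα θ hθ φ).comp (θ, φ) hσs.contDiffAt
  have hf' : ∀ θ ∈ uIcc a b, ∀ φ, ContDiffAt ℝ ∞ f (θ, φ) := fun θ hθ φ =>
    (hασ θ hθ φ).form_apply_one (contDiff_sphereMapPhi.const_smul r).contDiffAt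
  have hg' : ∀ θ ∈ uIcc a b, ∀ φ, ContDiffAt ℝ ∞ g (θ, φ) := fun θ hθ φ =>
    ((hασ θ hθ φ).form_apply_one (contDiff_sphereMapTheta.const_smul r).contDiffAt).neg
  have h1 : (1 : WithTop ℕ∞) ≤ ∞ := by simp
  rw [← integral_band_divergence (f := f) (g := g) (fun θ hθ φ => (hf' θ hθ φ).of_le h1)
    (fun θ hθ φ => (hg' θ hθ φ).of_le h1) (fun θ => by
      simp [hg, hσ, sphereMap, sphereMapTheta])]
  refine intervalIntegral.integral_congr fun θ hθ => ?_
  refine intervalIntegral.integral_congr fun φ _ => ?_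
  have hW := differentiableAt_pullback (z := (θ, φ)) hσs (hα θ hθ φ)
  have key := extDeriv_apply hW ![(1, 0), (0, 1)]
  rw [extDeriv_pullback (f := σ) ((hα θ hθ φ).differentiableAt (by simp)) hσs.contDiffAt two_le_smooth]
    at key
  have hr0 : Fin.removeNth 0 (![(1, 0), (0, 1)] : Fin 2 → ℝ × ℝ) = ![(0, 1)] := by
    ext i <;> fin_cases i <;> rfl
  have hr1 : Fin.removeNth 1 (![(1, 0), (0, 1)] : Fin 2 → ℝ × ℝ) = ![(1, 0)] := by
    ext i <;> fin_cases i <;> rfl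
  have hσf : ∀ z w, fderiv ℝ σ z w = w.1 • r • sphereMapTheta z + w.2 • r • sphereMapPhi z :=
    fderiv_sphereMap_affine q r
  have hc : ∀ z, (⇑(fderiv ℝ σ z) ∘ ![(1, 0), (0, 1)] : Fin 2 → E3) =
      ![r • sphereMapTheta z, r • sphereMapPhi z] := fun z => by
    funext i; fin_cases i <;> simp [hσf]
  have hc0 : ∀ z, (⇑(fderiv ℝ σ z) ∘ ![(0, 1)] : Fin 1 → E3) = ![r • sphereMapPhi z] := fun z => by
    funext i; fin_cases i; simp [hσf]
  have hc1 : ∀ z, (⇑(fderiv ℝ σ z) ∘ ![(1, 0)] : Fin 1 → E3) = ![r • sphereMapTheta z] :=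
    fun z => by funext i; fin_cases i; simp [hσf]
  rw [Fin.sum_univ_two, hr0, hr1] at key
  simp only [compContinuousLinearMap_apply, ← Function.comp_def, hc, hc0, hc1] at key
  simp only [hg, fderiv_fun_neg]
  simpa using key

/-- The integral of an exact form over a sphere vanishes. -/
theorem sphereIntegral_extDeriv {α : DiffForm 1} {η : DiffForm 2} {q : E3} {r : ℝ}
    (hα : ∀ z, ContDiffAt ℝ ∞ α (q + r • sphereMap z))
    (hη : ∀ z, extDeriv α (q + r • sphereMap z) = η (q + r • sphereMap z)) :
    sphereIntegral q r η = 0 := by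
  simp only [sphereIntegral_eq, ← hη]
  have hz : ∀ w : E3, w = 0 → ∀ y, α y ![w] = 0 := fun w hw y => by
    subst hw; exact (α y).map_coord_zero 0 rfl
  -- Both boundary circles of the full band degenerate to poles, where the φ-derivative vanishes.
  have h0 : ∀ φ, r • sphereMapPhi (0, φ) = 0 := fun φ => by
    ext i; fin_cases i <;> simp [sphereMapPhi]
  have hpi : ∀ φ, r • sphereMapPhi (Real.pi, φ) = 0 := fun φ => by
    ext i; fin_cases i <;> simp [sphereMapPhi]
  rw [integral_band_extDeriv fun θ _ φ => hα _]
  simp [hz _ (h0 _), hz _ (hpi _)]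

/-- A family of spheres whose centre and radius move linearly with time. -/
def movingSphere (q v : E3) (r s : ℝ) (z : ℝ × ℝ × ℝ) : E3 :=
  q + z.1 • v + (r + z.1 * s) • sphereMap z.2

theorem contDiff_movingSphere (q v : E3) (r s : ℝ) : ContDiff ℝ ∞ (movingSphere q v r s) := by
  unfold movingSphere
  have := contDiff_sphereMap.comp (contDiff_snd (𝕜 := ℝ) (E := ℝ) (F := ℝ × ℝ) (n := ∞))
  exact ContDiff.add (by fun_prop)
    (ContDiff.smul (f := fun z : ℝ × ℝ × ℝ => r + z.1 * s) (by fun_prop) this)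

theorem fderiv_movingSphere (q v : E3) (r s : ℝ) (z w : ℝ × ℝ × ℝ) :
    fderiv ℝ (movingSphere q v r s) z w = w.1 • (v + s • sphereMap z.2) +
      w.2.1 • (r + z.1 * s) • sphereMapTheta z.2 + w.2.2 • (r + z.1 * s) • sphereMapPhi z.2 := by
  have h1 : HasFDerivAt (fun z : ℝ × ℝ × ℝ => z.1) (ContinuousLinearMap.fst ℝ ℝ (ℝ × ℝ)) z :=
    hasFDerivAt_fst
  have h2 : HasFDerivAt (fun z : ℝ × ℝ × ℝ => z.2) (ContinuousLinearMap.snd ℝ ℝ (ℝ × ℝ)) z :=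
    hasFDerivAt_snd
  have h3 : HasFDerivAt (fun z : ℝ × ℝ × ℝ => sphereMap z.2) _ z :=
    (hasFDerivAt_sphereMap z.2).comp z h2
  have h : HasFDerivAt (movingSphere q v r s) _ z :=
    ((h1.smul_const v).const_add q).add (((h1.mul_const s).const_add r).smul h3)
  rw [h.fderiv]
  simp
  module

/-- The integral of a closed 2-form over a moving sphere is constant. -/
theorem sphereIntegral_eq_of_closed {η : DiffForm 2} {q v : E3} {r s : ℝ}
    (h : ∀ t ∈ Icc (0 : ℝ) 1, ∀ z, ContDiffAt ℝ ∞ η (movingSphere q v r s (t, z)) ∧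
      extDeriv η (movingSphere q v r s (t, z)) = 0) :
    sphereIntegral (q + v) (r + s) η = sphereIntegral q r η := by
  set N := movingSphere q v r s with hN
  have hNs : ContDiff ℝ ∞ N := contDiff_movingSphere q v r s
  set T : ℝ × ℝ × ℝ → E3 := fun z => v + s • sphereMap z.2
  set A : ℝ × ℝ × ℝ → E3 := fun z => (r + z.1 * s) • sphereMapTheta z.2
  set B : ℝ × ℝ × ℝ → E3 := fun z => (r + z.1 * s) • sphereMapPhi z.2
  have hT : ContDiff ℝ ∞ T :=
    contDiff_const.add ((contDiff_sphereMap.comp contDiff_snd).const_smul s)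
  have hA : ContDiff ℝ ∞ A := ContDiff.smul (f := fun z : ℝ × ℝ × ℝ => r + z.1 * s)
    (by fun_prop) (contDiff_sphereMapTheta.comp contDiff_snd)
  have hB : ContDiff ℝ ∞ B := ContDiff.smul (f := fun z : ℝ × ℝ × ℝ => r + z.1 * s)
    (by fun_prop) (contDiff_sphereMapPhi.comp contDiff_snd)
  -- `H`, `f` and `-g` are the components of the pullback of `η` on the pairs (θ, φ), (t, φ) and (t,
  -- θ). Closedness then reads ∂H/∂t = ∂f/∂θ + ∂g/∂φ.
  set H : ℝ × ℝ × ℝ → ℝ := fun z => η (N z) ![A z, B z] with hH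
  set f : ℝ × ℝ × ℝ → ℝ := fun z => η (N z) ![T z, B z] with hf
  set g : ℝ × ℝ × ℝ → ℝ := fun z => -η (N z) ![T z, A z] with hg
  have hη : ∀ t ∈ Icc (0 : ℝ) 1, ∀ z, ContDiffAt ℝ ∞ (fun z => η (N z)) (t, z) := fun t ht z =>
    (h t ht z).1.comp (t, z) hNs.contDiffAt
  have hHs : ∀ t ∈ Icc (0 : ℝ) 1, ∀ z, ContDiffAt ℝ ∞ H (t, z) := fun t ht z =>
    (hη t ht z).form_apply_two hA.contDiffAt hB.contDiffAt
  have hfs : ∀ t ∈ Icc (0 : ℝ) 1, ∀ z, ContDiffAt ℝ ∞ f (t, z) := fun t ht z =>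
    (hη t ht z).form_apply_two hT.contDiffAt hB.contDiffAt
  have hgs : ∀ t ∈ Icc (0 : ℝ) 1, ∀ z, ContDiffAt ℝ ∞ g (t, z) := fun t ht z =>
    ((hη t ht z).form_apply_two hT.contDiffAt hA.contDiffAt).neg
  have h1 : (1 : WithTop ℕ∞) ≤ ∞ := by simp
  have hI : ∀ t ∈ Icc (0 : ℝ) 1,
      ∫ z in sphereRect, H (t, z) = sphereIntegral (q + t • v) (r + t * s) η := by
    intro t ht
    rw [sphereIntegral_eq, ← integral_sphereRect (g := fun z => H (t, z)) fun z _ =>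
      ((hHs t ht z).continuousAt.comp (f := fun z => (t, z)) (by fun_prop)).continuousWithinAt]
    rfl
  have hclosed : ∀ t ∈ Icc (0 : ℝ) 1, ∀ z, fderiv ℝ H (t, z) (1, 0) =
      fderiv ℝ f (t, z) (0, 1, 0) + fderiv ℝ g (t, z) (0, 0, 1) := by
    intro t ht z
    have hW := differentiableAt_pullback (z := (t, z)) hNs (h t ht z).1
    have key := extDeriv_apply hW ![(1, 0), (0, 1, 0), (0, 0, 1)]
    rw [extDeriv_pullback (f := N) ((h t ht z).1.differentiableAt (by simp)) hNs.contDiffAt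
      two_le_smooth, (h t ht z).2] at key
    have hr0 : Fin.removeNth 0 (![(1, 0), (0, 1, 0), (0, 0, 1)] : Fin 3 → ℝ × ℝ × ℝ) =
        ![(0, 1, 0), (0, 0, 1)] := by ext i <;> fin_cases i <;> rfl
    have hr1 : Fin.removeNth 1 (![(1, 0), (0, 1, 0), (0, 0, 1)] : Fin 3 → ℝ × ℝ × ℝ) =
        ![(1, 0), (0, 0, 1)] := by ext i <;> fin_cases i <;> rfl
    have hr2 : Fin.removeNth 2 (![(1, 0), (0, 1, 0), (0, 0, 1)] : Fin 3 → ℝ × ℝ × ℝ) =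
        ![(1, 0), (0, 1, 0)] := by ext i <;> fin_cases i <;> rfl
    have hc0 : ∀ z, (⇑(fderiv ℝ N z) ∘ ![(0, 1, 0), (0, 0, 1)] : Fin 2 → E3) = ![A z, B z] :=
      fun z => by funext i; fin_cases i <;> simp [hN, fderiv_movingSphere, A, B]
    have hc1 : ∀ z, (⇑(fderiv ℝ N z) ∘ ![(1, 0), (0, 0, 1)] : Fin 2 → E3) = ![T z, B z] :=
      fun z => by funext i; fin_cases i <;> simp [hN, fderiv_movingSphere, T, B]
    have hc2 : ∀ z, (⇑(fderiv ℝ N z) ∘ ![(1, 0), (0, 1, 0)] : Fin 2 → E3) = ![T z, A z] :=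
      fun z => by funext i; fin_cases i <;> simp [hN, fderiv_movingSphere, T, A]
    rw [Fin.sum_univ_three, hr0, hr1, hr2] at key
    simp only [compContinuousLinearMap_apply, ← Function.comp_def, hc0, hc1, hc2] at key
    simp only [hg, fderiv_fun_neg, hH, hf]
    simp at key
    simp
    linarith
  -- The time derivative is the integral of a divergence over the rectangle: its φ-edges cancel by
  -- periodicity and its θ-edges vanish at the poles.
  have hder : ∀ t ∈ Icc (0 : ℝ) 1, HasDerivAt (fun t => ∫ z in sphereRect, H (t, z)) 0 t := by
    intro t ht
    have hd := (hasFDerivAt_setIntegral_of_contDiffAt (μ := volume) isCompact_sphereRect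
      (fun z _ => (hHs t ht z).of_le h1)).hasDerivAt
    refine hd.congr_deriv ?_
    have hcont : ContinuousOn (fun z => (fderiv ℝ H (t, z)).comp
        (ContinuousLinearMap.inl ℝ ℝ (ℝ × ℝ))) sphereRect := fun z _ => by
      refine ContinuousAt.continuousWithinAt (ContinuousAt.clm_comp ?_ continuousAt_const)
      exact ContinuousAt.comp (f := fun z => (t, z))
        ((hHs t ht z).fderiv_right (m := 0) (by simp)).continuousAt (by fun_prop)
    rw [ContinuousLinearMap.integral_apply (hcont.integrableOn_compact isCompact_sphereRect),
      ← integral_sphereRect (hcont.clm_apply continuousOn_const)]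
    have hslice : ∀ {u : ℝ × ℝ × ℝ → ℝ} (z w : ℝ × ℝ), ContDiffAt ℝ ∞ u (t, z) →
        fderiv ℝ u (t, z) (0, w) = fderiv ℝ (fun z => u (t, z)) z w := by
      intro u z w hu
      have hc := (hu.differentiableAt (by simp)).hasFDerivAt.comp z
        ((hasFDerivAt_const t z).prodMk (hasFDerivAt_id z))
      have hc' : HasFDerivAt (fun z => u (t, z)) _ z := hc
      rw [hc'.fderiv]
      simp
    have hsl : ∀ {u : ℝ × ℝ × ℝ → ℝ}, (∀ z, ContDiffAt ℝ ∞ u (t, z)) →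
        ∀ z, ContDiffAt ℝ 1 (fun z => u (t, z)) z := fun hu z =>
      ((hu z).comp (f := fun z => (t, z)) z (by fun_prop)).of_le h1
    have hband := integral_band_divergence (f := fun z => f (t, z)) (g := fun z => g (t, z))
      (a := 0) (b := Real.pi) (fun θ _ φ => hsl (hfs t ht) _) (fun θ _ φ => hsl (hgs t ht) _)
      (fun θ => by simp [hg, hN, movingSphere, T, A, sphereMap, sphereMapTheta])
    have hz : ∀ w : E3, w = 0 → ∀ y u, η y ![u, w] = 0 := fun w hw y u => by
      subst hw; exact (η y).map_coord_zero 1 rfl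
    have h0 : ∀ φ, B (t, 0, φ) = 0 := fun φ => by
      ext i; fin_cases i <;> simp [B, sphereMapPhi]
    have hpi : ∀ φ, B (t, Real.pi, φ) = 0 := fun φ => by
      ext i; fin_cases i <;> simp [B, sphereMapPhi]
    simp only [hf, hz _ (h0 _), hz _ (hpi _), intervalIntegral.integral_zero, sub_zero] at hband
    refine Eq.trans ?_ hband
    refine intervalIntegral.integral_congr fun θ _ => intervalIntegral.integral_congr fun φ _ => ?_
    rw [← hslice _ _ (hgs t ht _), ← hslice (u := fun z => η (N z) ![T z, B z]) _ _ (hfs t ht _)]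
    have := hclosed t ht (θ, φ)
    simpa using this
  have hconst := constant_of_has_deriv_right_zero (f := fun t => ∫ z in sphereRect, H (t, z))
    (a := 0) (b := 1) (fun t ht => (hder t ht).continuousAt.continuousWithinAt)
    (fun t ht => (hder t ⟨ht.1, ht.2.le⟩).hasDerivWithinAt) 1 (by simp)
  rw [hI 1 (by simp), hI 0 (by simp)] at hconst
  simpa using hconst

end Sphere

/-! ### Exactness of closed 2-forms with vanishing periods -/

section Primitives

open MeasureTheory ContinuousAlternatingMap Metric

/-- Functions that agree on overlaps glue to one function. -/
theorem exists_eqOn_of_eqOn_inter {X Y ι : Type*} [Nonempty Y] (O : ι → Set X) (f : ι → X → Y)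
    (h : ∀ i j, EqOn (f i) (f j) (O i ∩ O j)) : ∃ g : X → Y, ∀ i, EqOn g (f i) (O i) := by
  classical
  refine ⟨fun x => if hx : ∃ i, x ∈ O i then f hx.choose x else Classical.arbitrary Y,
    fun i x hx => ?_⟩
  have hex : ∃ i, x ∈ O i := ⟨i, hx⟩
  simp only [dif_pos hex]
  exact h _ _ ⟨hex.choose_spec, hx⟩

/-- `α` is a smooth primitive of `η` on `S`. -/
def IsPrimitiveOn {k : ℕ} (α : DiffForm k) (η : DiffForm (k + 1)) (S : Set E3) : Prop :=
  ∀ x ∈ S, ContDiffAt ℝ ∞ α x ∧ extDeriv α x = η x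

/-- `η` is smooth and closed on `S`. -/
def IsClosedFormOn {k : ℕ} (η : DiffForm k) (S : Set E3) : Prop :=
  ∀ x ∈ S, ContDiffAt ℝ ∞ η x ∧ extDeriv η x = 0

theorem IsClosedFormOn.mono {k : ℕ} {η : DiffForm k} {S T : Set E3} (h : IsClosedFormOn η T)
    (hST : S ⊆ T) : IsClosedFormOn η S := fun x hx => h x (hST hx)

theorem extDeriv_sub_of_contDiffAt {k : ℕ} {η ζ : DiffForm k} {x : E3} (hη : ContDiffAt ℝ ∞ η x)
    (hζ : ContDiffAt ℝ ∞ ζ x) :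
    extDeriv (fun y => η y - ζ y) x = extDeriv η x - extDeriv ζ x := by
  have h : (fun y => η y - ζ y) = η + (-1 : ℝ) • ζ := by
    funext y; simp [sub_eq_add_neg]
  have hζ' : DifferentiableAt ℝ ((-1 : ℝ) • ζ) x := (hζ.differentiableAt (by simp)).const_smul _
  rw [h, extDeriv_add (hη.differentiableAt (by simp)) hζ', extDeriv_smul]
  simp [sub_eq_add_neg]

theorem extDeriv_extDeriv_of_contDiffAt {k : ℕ} {η : DiffForm k} {x : E3}
    (h : ContDiffAt ℝ ∞ η x) : extDeriv (extDeriv η) x = 0 :=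
  extDeriv_extDeriv_apply h two_le_smooth

/-- The ball around `p` without the points `x` with `L (x - p) = 0` and `ℓ (x - p) ≥ 0`. -/
def slitBall {F : Type} [NormedAddCommGroup F] [NormedSpace ℝ F] (p : E3) (ρ : ℝ)
    (L : E3 →L[ℝ] F) (l : E3 →L[ℝ] ℝ) : Set E3 :=
  {x | x ∈ ball p ρ ∧ ¬(L (x - p) = 0 ∧ 0 ≤ l (x - p))}

theorem isOpen_slitBall {F : Type} [NormedAddCommGroup F] [NormedSpace ℝ F] (p : E3) (ρ : ℝ)
    (L : E3 →L[ℝ] F) (l : E3 →L[ℝ] ℝ) : IsOpen (slitBall p ρ L l) := by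
  refine isOpen_ball.inter (isOpen_compl_iff (s := {x | L (x - p) = 0 ∧ 0 ≤ l (x - p)}).2 ?_)
  exact (isClosed_eq (by fun_prop) continuous_const).inter
    (isClosed_le continuous_const (l.continuous.comp (continuous_id.sub continuous_const)))

/-- The centre is placed on the line of the slit, on the side opposite to it. There `L` vanishes and
`l` is negative, so a segment that ends in the slit must have started in it. -/
theorem starConvex_slitBall {F : Type} [NormedAddCommGroup F] [NormedSpace ℝ F] {p : E3} {ρ : ℝ}
    (hρ : 0 < ρ) {L : E3 →L[ℝ] F} {l : E3 →L[ℝ] ℝ} {w : E3} (hw : ‖w‖ = 1) (hLw : L w = 0)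
    (hlw : 0 < l w) : StarConvex ℝ (p - (ρ / 2) • w) (slitBall p ρ L l) := by
  have hq : p - (ρ / 2) • w ∈ ball p ρ := by
    rw [mem_ball, dist_eq_norm]
    simp only [sub_sub_cancel_left, norm_neg, norm_smul, hw, Real.norm_eq_abs, mul_one]
    rw [abs_of_pos (by positivity)]; linarith
  rintro x ⟨hxb, hx⟩ a b ha hb hab
  refine ⟨(convex_ball p ρ) hq hxb ha hb hab, ?_⟩
  rintro ⟨h1, h2⟩
  have e : a • (p - (ρ / 2) • w) + b • x - p = b • (x - p) - (a * (ρ / 2)) • w := by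
    have : a = 1 - b := by linarith
    subst this; module
  rw [e] at h1 h2
  simp only [map_sub, map_smul, hLw, smul_zero, sub_zero, smul_eq_mul] at h1 h2
  rcases hb.eq_or_lt with rfl | hb
  · have : a = 1 := by linarith
    subst this
    nlinarith [mul_pos hρ hlw]
  · have hL : L (x - p) = 0 := by
      rw [map_sub]; exact (smul_eq_zero.1 h1).resolve_left hb.ne'
    have hl : l (x - p) < 0 := not_le.1 fun h => hx ⟨hL, h⟩
    rw [map_sub] at hl
    have := mul_neg_of_pos_of_neg hb hl
    have : 0 ≤ a * (ρ / 2) * l w := by positivity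
    linarith

/-- The coordinate functional `x ↦ x i`. -/
abbrev coordE3 (i : Fin 3) : E3 →L[ℝ] ℝ := EuclideanSpace.proj i

theorem exists_primitive_slitBall {k : ℕ} {F : Type} [NormedAddCommGroup F] [NormedSpace ℝ F]
    {p : E3} {ρ : ℝ} (hρ : 0 < ρ) {L : E3 →L[ℝ] F} {l : E3 →L[ℝ] ℝ} {w : E3} (hw : ‖w‖ = 1)
    (hLw : L w = 0) (hlw : 0 < l w) {η : DiffForm (k + 1)}
    (hη : IsClosedFormOn η (slitBall p ρ L l)) :
    ∃ α : DiffForm k, IsPrimitiveOn α η (slitBall p ρ L l) :=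
  exists_extDeriv_eq_of_starConvex (starConvex_slitBall hρ hw hLw hlw) hη

/-- The ball around `p` without the vertical axis through `p`. -/
def ballOffAxis (p : E3) (ρ : ℝ) : Set E3 :=
  {x | x ∈ ball p ρ ∧ ¬(x 0 = p 0 ∧ x 1 = p 1)}

theorem isOpen_ballOffAxis (p : E3) (ρ : ℝ) : IsOpen (ballOffAxis p ρ) := by
  refine isOpen_ball.inter (isOpen_compl_iff (s := {x : E3 | x 0 = p 0 ∧ x 1 = p 1}).2 ?_)
  exact (isClosed_eq (by fun_prop) continuous_const).inter
    (isClosed_eq (by fun_prop) continuous_const)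

/-- A function is a primitive of a 1-form as soon as the corresponding 0-form is. -/
theorem IsPrimitiveOn.fderiv_eq {f : DiffForm 0} {β : DiffForm 1} {S : Set E3}
    (h : IsPrimitiveOn f β S) {x : E3} (hx : x ∈ S) :
    ContDiffAt ℝ ∞ (fun y => f y ![]) x ∧ ∀ v, fderiv ℝ (fun y => f y ![]) x v = β x ![v] := by
  refine ⟨(h x hx).1.continuousAlternatingMap_apply_const _, fun v => ?_⟩
  rw [← (h x hx).2, extDeriv_apply ((h x hx).1.differentiableAt (by simp))]
  rw [Fin.sum_univ_one]
  simp only [Fin.val_zero, pow_zero, one_smul, Matrix.cons_val_zero]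
  congr 3

theorem eq_of_fderiv_eq_on_convex {S : Set E3} (hS : IsOpen S) (hc : Convex ℝ S) {F G : E3 → ℝ}
    (hF : ∀ x ∈ S, DifferentiableAt ℝ F x) (hG : ∀ x ∈ S, DifferentiableAt ℝ G x)
    (h : ∀ x ∈ S, ∀ v, fderiv ℝ F x v = fderiv ℝ G x v) {x y : E3} (hx : x ∈ S) (hy : y ∈ S) :
    F x - G x = F y - G y := by
  refine hc.is_const_of_fderivWithin_eq_zero (𝕜 := ℝ) (f := fun x => F x - G x)
    (fun z hz => ((hF z hz).sub (hG z hz)).differentiableWithinAt) (fun z hz => ?_) hx hy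
  rw [fderivWithin_of_isOpen hS hz, fderiv_fun_sub (hF z hz) (hG z hz)]
  ext v
  simp [h z hz v]

/-- A closed 1-form off the vertical axis whose integral over a horizontal circle vanishes has a
primitive. -/
theorem exists_primitive_ballOffAxis {p : E3} {ρ r : ℝ} (hr : 0 < r) (hrρ : r < ρ) {β : DiffForm 1}
    (hβ : IsClosedFormOn β (ballOffAxis p ρ))
    (hper : ∫ φ in (0 : ℝ)..(2 * Real.pi), β (p + r • sphereMap (Real.pi / 2, φ))
      ![r • sphereMapPhi (Real.pi / 2, φ)] = 0) :
    ∃ G : E3 → ℝ, ∀ x ∈ ballOffAxis p ρ, ContDiffAt ℝ ∞ G x ∧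
      ∀ v, fderiv ℝ G x v = β x ![v] := by
  have hρ : 0 < ρ := hr.trans hrρ
  -- The two balls, slit along opposite vertical half-planes, cover the ball off the axis. Their
  -- overlap has two convex pieces, on each of which the primitives differ by a constant.
  set D₁ := slitBall p ρ (coordE3 1) (-coordE3 0) with hD₁
  set D₂ := slitBall p ρ (coordE3 1) (coordE3 0) with hD₂
  have hm₁ : ∀ x, x ∈ D₁ ↔ x ∈ ball p ρ ∧ ¬(x 1 = p 1 ∧ x 0 ≤ p 0) := fun x => by
    simp [hD₁, slitBall, sub_eq_zero]
  have hm₂ : ∀ x, x ∈ D₂ ↔ x ∈ ball p ρ ∧ ¬(x 1 = p 1 ∧ p 0 ≤ x 0) := fun x => by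
    simp [hD₂, slitBall, sub_eq_zero]
  have hsub₁ : D₁ ⊆ ballOffAxis p ρ := fun x hx =>
    ⟨((hm₁ x).1 hx).1, fun h => ((hm₁ x).1 hx).2 ⟨h.2, h.1.le⟩⟩
  have hsub₂ : D₂ ⊆ ballOffAxis p ρ := fun x hx =>
    ⟨((hm₂ x).1 hx).1, fun h => ((hm₂ x).1 hx).2 ⟨h.2, h.1.ge⟩⟩
  obtain ⟨f₁, hf₁⟩ := exists_primitive_slitBall (p := p) hρ (L := coordE3 1) (l := -coordE3 0)
    (w := -EuclideanSpace.single 0 1) (by simp) (by simp) (by simp) (hβ.mono hsub₁)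
  obtain ⟨f₂, hf₂⟩ := exists_primitive_slitBall (p := p) hρ (L := coordE3 1) (l := coordE3 0)
    (w := EuclideanSpace.single 0 1) (by simp) (by simp) (by simp) (hβ.mono hsub₂)
  set F₁ : E3 → ℝ := fun y => f₁ y ![]
  set F₂ : E3 → ℝ := fun y => f₂ y ![]
  have hF₁ : ∀ x ∈ D₁, ContDiffAt ℝ ∞ F₁ x ∧ ∀ v, fderiv ℝ F₁ x v = β x ![v] := fun x hx =>
    hf₁.fderiv_eq hx
  have hF₂ : ∀ x ∈ D₂, ContDiffAt ℝ ∞ F₂ x ∧ ∀ v, fderiv ℝ F₂ x v = β x ![v] := fun x hx =>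
    hf₂.fderiv_eq hx
  set c : ℝ → E3 := fun φ => p + r • sphereMap (Real.pi / 2, φ) with hc
  set b : ℝ → ℝ := fun φ => β (c φ) ![r • sphereMapPhi (Real.pi / 2, φ)] with hb
  have hc0 : ∀ φ, c φ 0 = p 0 + r * Real.cos φ := fun φ => by simp [hc, sphereMap]
  have hc1 : ∀ φ, c φ 1 = p 1 + r * Real.sin φ := fun φ => by simp [hc, sphereMap]
  have hcb : ∀ φ, c φ ∈ ball p ρ := fun φ => by
    simp [hc, norm_smul, norm_sphereMap, abs_of_pos hr, hrρ]
  have hcD₁ : ∀ φ, 0 ≤ Real.cos φ → c φ ∈ D₁ := fun φ hφ => by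
    refine (hm₁ _).2 ⟨hcb φ, fun ⟨h1, h2⟩ => ?_⟩
    rw [hc1, add_eq_left] at h1
    rw [hc0] at h2
    have hs : Real.sin φ = 0 := (mul_eq_zero.1 h1).resolve_left hr.ne'
    have hc' : Real.cos φ = 0 := by nlinarith
    have := Real.sin_sq_add_cos_sq φ
    rw [hs, hc'] at this; norm_num at this
  have hcD₂ : ∀ φ, Real.cos φ ≤ 0 → c φ ∈ D₂ := fun φ hφ => by
    refine (hm₂ _).2 ⟨hcb φ, fun ⟨h1, h2⟩ => ?_⟩
    rw [hc1, add_eq_left] at h1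
    rw [hc0] at h2
    have hs : Real.sin φ = 0 := (mul_eq_zero.1 h1).resolve_left hr.ne'
    have hc' : Real.cos φ = 0 := by nlinarith
    have := Real.sin_sq_add_cos_sq φ
    rw [hs, hc'] at this; norm_num at this
  have hcT : ∀ φ, c φ ∈ ballOffAxis p ρ := fun φ => by
    rcases le_total 0 (Real.cos φ) with h | h
    exacts [hsub₁ (hcD₁ φ h), hsub₂ (hcD₂ φ h)]
  have hcder : ∀ φ, HasDerivAt c (r • sphereMapPhi (Real.pi / 2, φ)) φ := fun φ => by
    have h1 : HasDerivAt (fun φ => sphereMap (Real.pi / 2, φ)) _ φ :=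
      (hasFDerivAt_sphereMap (Real.pi / 2, φ)).comp_hasDerivAt φ
      ((hasDerivAt_const φ (Real.pi / 2)).prodMk (hasDerivAt_id φ))
    refine ((h1.const_smul r).const_add p).congr_deriv ?_
    simp
  have hccont : ContDiff ℝ ∞ c :=
    contDiff_const.add ((contDiff_sphereMap.comp (contDiff_const.prodMk contDiff_id)).const_smul r)
  have hbcont : Continuous b := continuous_iff_continuousAt.2 fun φ =>
    (((hβ _ (hcT φ)).1.comp φ hccont.contDiffAt).form_apply_one (a := fun φ =>
      r • sphereMapPhi (Real.pi / 2, φ)) ((contDiff_sphereMapPhi.comp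
        (contDiff_const.prodMk contDiff_id)).const_smul r).contDiffAt).continuousAt
  have hFTC : ∀ {F : E3 → ℝ} {D : Set E3}, (∀ x ∈ D, ContDiffAt ℝ ∞ F x ∧
      ∀ v, fderiv ℝ F x v = β x ![v]) → ∀ u v, (∀ φ ∈ uIcc u v, c φ ∈ D) →
      ∫ φ in u..v, b φ = F (c v) - F (c u) := by
    intro F D hF u v huv
    refine intervalIntegral.integral_eq_sub_of_hasDerivAt (f := fun φ => F (c φ)) (fun φ hφ => ?_)
      (hbcont.intervalIntegrable _ _)
    have := ((hF _ (huv φ hφ)).1.differentiableAt (by simp)).hasFDerivAt.comp_hasDerivAt φ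
      (hcder φ)
    rwa [(hF _ (huv φ hφ)).2] at this
  have hbper : Function.Periodic b (2 * Real.pi) := fun φ => by
    simp [hb, hc, sphereMap, sphereMapPhi]
  have hpi := Real.pi_pos
  -- The circle consists of a half in `D₁` and a half in `D₂`. Its zero integral says that the
  -- differences of the primitives at the two crossing points agree, so one constant `K` serves both
  -- pieces.
  have hcirc : F₁ (c (Real.pi / 2)) - F₂ (c (Real.pi / 2)) =
      F₁ (c (-(Real.pi / 2))) - F₂ (c (-(Real.pi / 2))) := by
    have h1 := hFTC hF₁ (-(Real.pi / 2)) (Real.pi / 2) fun φ hφ => by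
      rw [uIcc_of_le (by linarith)] at hφ
      exact hcD₁ φ (Real.cos_nonneg_of_mem_Icc hφ)
    have h2 := hFTC hF₂ (Real.pi / 2) (-(Real.pi / 2) + 2 * Real.pi) fun φ hφ => by
      rw [uIcc_of_le (by linarith)] at hφ
      exact hcD₂ φ (Real.cos_nonpos_of_pi_div_two_le_of_le hφ.1 (by linarith [hφ.2]))
    have h3 := intervalIntegral.integral_add_adjacent_intervals
      (hbcont.intervalIntegrable (μ := volume) (-(Real.pi / 2)) (Real.pi / 2))
      (hbcont.intervalIntegrable _ (-(Real.pi / 2) + 2 * Real.pi))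
    rw [hbper.intervalIntegral_add_eq (-(Real.pi / 2)) 0, zero_add, hper, h1, h2] at h3
    have h4 : c (-(Real.pi / 2) + 2 * Real.pi) = c (-(Real.pi / 2)) := by
      simp [hc, sphereMap]
    rw [h4] at h3
    linarith
  set K := F₁ (c (Real.pi / 2)) - F₂ (c (Real.pi / 2)) with hK
  have hconst : ∀ x ∈ D₁ ∩ D₂, F₁ x - F₂ x = K := by
    rintro x ⟨hx₁, hx₂⟩
    have hx₁' := (hm₁ x).1 hx₁
    have hx₂' := (hm₂ x).1 hx₂
    have hne : x 1 ≠ p 1 := fun h => (le_total (x 0) (p 0)).elim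
      (fun h' => hx₁'.2 ⟨h, h'⟩) (fun h' => hx₂'.2 ⟨h, h'⟩)
    have hgen : ∀ S : Set E3, IsOpen S → Convex ℝ S → (∀ y ∈ S, y 1 ≠ p 1) → S ⊆ ball p ρ →
        ∀ y ∈ S, ∀ z ∈ S, F₁ y - F₂ y = F₁ z - F₂ z := by
      intro S hSo hSc hS hSb y hy z hz
      have h1 : ∀ y ∈ S, y ∈ D₁ := fun y hy => (hm₁ y).2 ⟨hSb hy, fun h => hS y hy h.1⟩
      have h2 : ∀ y ∈ S, y ∈ D₂ := fun y hy => (hm₂ y).2 ⟨hSb hy, fun h => hS y hy h.1⟩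
      exact eq_of_fderiv_eq_on_convex hSo hSc
        (fun y hy => (hF₁ y (h1 y hy)).1.differentiableAt (by simp))
        (fun y hy => (hF₂ y (h2 y hy)).1.differentiableAt (by simp))
        (fun y hy v => by rw [(hF₁ y (h1 y hy)).2, (hF₂ y (h2 y hy)).2]) hy hz
    have hlin : IsLinearMap ℝ fun y : E3 => y 1 := ⟨fun _ _ => rfl, fun _ _ => rfl⟩
    rcases hne.lt_or_gt with h | h
    · rw [hcirc]
      refine hgen ({y | y 1 < p 1} ∩ ball p ρ) ((isOpen_lt (by fun_prop) continuous_const).inter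
        isOpen_ball) ((convex_halfSpace_lt hlin _).inter (convex_ball _ _))
        (fun y hy => (show y 1 < p 1 from hy.1).ne) inter_subset_right x ⟨h, hx₁'.1⟩ _
        ⟨?_, hcb _⟩
      simp only [mem_ofPred_eq, hc1]
      simp [hr]
    · refine hgen ({y | p 1 < y 1} ∩ ball p ρ) ((isOpen_lt continuous_const (by fun_prop)).inter
        isOpen_ball) ((convex_halfSpace_gt hlin _).inter (convex_ball _ _))
        (fun y hy => (show p 1 < y 1 from hy.1).ne') inter_subset_right x ⟨h, hx₁'.1⟩ _
        ⟨?_, hcb _⟩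
      simp only [mem_ofPred_eq, hc1]
      simp [hr]
  obtain ⟨G, hG⟩ := exists_eqOn_of_eqOn_inter (fun i : Bool => if i then D₁ else D₂)
    (fun i x => if i then F₁ x else F₂ x + K) (by
      rintro (_ | _) (_ | _) x hx
      · rfl
      · have := hconst x ⟨by simpa using hx.2, by simpa using hx.1⟩
        simp; linarith
      · have := hconst x ⟨by simpa using hx.1, by simpa using hx.2⟩
        simp; linarith
      · rfl)
  have hG₁ : EqOn G F₁ D₁ := by simpa using hG true
  have hG₂ : EqOn G (fun x => F₂ x + K) D₂ := by simpa using hG false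
  refine ⟨G, fun x hx => ?_⟩
  by_cases hx₁ : x ∈ D₁
  · have he : G =ᶠ[𝓝 x] F₁ := hG₁.eventuallyEq_of_mem ((isOpen_slitBall _ _ _ _).mem_nhds hx₁)
    exact ⟨(hF₁ x hx₁).1.congr_of_eventuallyEq he, fun v => by rw [he.fderiv_eq, (hF₁ x hx₁).2]⟩
  · have hx₂ : x ∈ D₂ := by
      rw [hm₁] at hx₁
      rw [hm₂]
      refine ⟨hx.1, fun h => hx₁ ⟨hx.1, fun h' => hx.2 ⟨le_antisymm h'.2 h.2, h.1⟩⟩⟩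
    have he : G =ᶠ[𝓝 x] fun x => F₂ x + K :=
      hG₂.eventuallyEq_of_mem ((isOpen_slitBall _ _ _ _).mem_nhds hx₂)
    refine ⟨((hF₂ x hx₂).1.add contDiffAt_const).congr_of_eventuallyEq he, fun v => ?_⟩
    rw [he.fderiv_eq, fderiv_add_const, (hF₂ x hx₂).2]

theorem IsPrimitiveOn.congr {k : ℕ} {α α' : DiffForm k} {η : DiffForm (k + 1)} {S : Set E3}
    (h : IsPrimitiveOn α η S) (hS : IsOpen S) (he : EqOn α' α S) : IsPrimitiveOn α' η S :=
  fun x hx => by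
    have hx' := he.eventuallyEq_of_mem (hS.mem_nhds hx)
    exact ⟨(h x hx).1.congr_of_eventuallyEq hx', by rw [hx'.extDeriv_eq, (h x hx).2]⟩

/-- The differential of a function as a 1-form. -/
def differential (f : E3 → ℝ) : DiffForm 1 :=
  extDeriv fun y => constOfIsEmpty ℝ E3 (Fin 0) (f y)

theorem differential_apply (f : E3 → ℝ) (x : E3) (v : Fin 1 → E3) :
    differential f x v = fderiv ℝ f x (v 0) := by
  rw [differential, extDeriv_constOfIsEmpty]; rfl

theorem isClosedFormOn_differential {f : E3 → ℝ} {x : E3} (h : ContDiffAt ℝ ∞ f x) :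
    ContDiffAt ℝ ∞ (differential f) x ∧ extDeriv (differential f) x = 0 := by
  have : ContDiffAt ℝ ∞ (fun y => constOfIsEmpty ℝ E3 (Fin 0) (f y)) x :=
    (constOfIsEmptyLIE ℝ E3 ℝ (Fin 0)).contDiff.contDiffAt.comp x h
  exact ⟨this.extDeriv, extDeriv_extDeriv_of_contDiffAt this⟩

/-- A closed 2-form on a punctured ball with vanishing integral over one sphere is exact. -/
theorem exists_primitive_punctured_ball {p : E3} {ρ r : ℝ} (hr : 0 < r) (hrρ : r < ρ)
    {η : DiffForm 2} (hη : IsClosedFormOn η (ball p ρ \ {p})) (hper : sphereIntegral p r η = 0) :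
    ∃ α : DiffForm 1, IsPrimitiveOn α η (ball p ρ \ {p}) := by
  have hρ : 0 < ρ := hr.trans hrρ
  have hpi := Real.pi_pos
  -- `N` omits the upper half-axis and `M` the lower one, both with `p`. They cover the punctured
  -- ball and overlap off the axis. There the difference of the primitives will be `dG`, and a
  -- cutoff of `G` merges them.
  set L := (coordE3 0).prod (coordE3 1) with hL
  set N := slitBall p ρ L (coordE3 2) with hN
  set M := slitBall p ρ L (-coordE3 2) with hM
  have hmN : ∀ x, x ∈ N ↔ x ∈ ball p ρ ∧ ¬((x 0 = p 0 ∧ x 1 = p 1) ∧ p 2 ≤ x 2) := fun x => by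
    simp [hN, hL, slitBall, sub_eq_zero]
  have hmM : ∀ x, x ∈ M ↔ x ∈ ball p ρ ∧ ¬((x 0 = p 0 ∧ x 1 = p 1) ∧ x 2 ≤ p 2) := fun x => by
    simp [hM, hL, slitBall, sub_eq_zero]
  have hNo : IsOpen N := isOpen_slitBall _ _ _ _
  have hMo : IsOpen M := isOpen_slitBall _ _ _ _
  have hNsub : N ⊆ ball p ρ \ {p} := fun x hx => ⟨((hmN x).1 hx).1, by
    rintro rfl; exact ((hmN _).1 hx).2 ⟨⟨rfl, rfl⟩, le_rfl⟩⟩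
  have hMsub : M ⊆ ball p ρ \ {p} := fun x hx => ⟨((hmM x).1 hx).1, by
    rintro rfl; exact ((hmM _).1 hx).2 ⟨⟨rfl, rfl⟩, le_rfl⟩⟩
  have hTN : ballOffAxis p ρ ⊆ N := fun x hx => (hmN x).2 ⟨hx.1, fun h => hx.2 h.1⟩
  have hTM : ballOffAxis p ρ ⊆ M := fun x hx => (hmM x).2 ⟨hx.1, fun h => hx.2 h.1⟩
  obtain ⟨αN, hαN⟩ := exists_primitive_slitBall (p := p) hρ (L := L) (l := coordE3 2)
    (w := EuclideanSpace.single 2 1) (by simp) (by simp [hL]) (by simp) (hη.mono hNsub)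
  obtain ⟨αM, hαM⟩ := exists_primitive_slitBall (p := p) hρ (L := L) (l := -coordE3 2)
    (w := -EuclideanSpace.single 2 1) (by simp) (by simp [hL]) (by simp) (hη.mono hMsub)
  set β : DiffForm 1 := fun x => αN x - αM x with hβ
  have hβc : IsClosedFormOn β (ballOffAxis p ρ) := fun x hx => by
    refine ⟨(hαN x (hTN hx)).1.sub (hαM x (hTM hx)).1, ?_⟩
    rw [hβ, extDeriv_sub_of_contDiffAt (hαN x (hTN hx)).1 (hαM x (hTM hx)).1,
      (hαN x (hTN hx)).2, (hαM x (hTM hx)).2, sub_self]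
  -- the circle integral of `β` is, by Stokes on both hemispheres, the integral of `η`
  set σ : ℝ × ℝ → E3 := fun z => p + r • sphereMap z with hσ
  have hσb : ∀ z, σ z ∈ ball p ρ := fun z => by
    simp [hσ, norm_smul, norm_sphereMap, abs_of_pos hr, hrρ]
  have hσs : ContDiff ℝ ∞ σ := contDiff_sphereMap_affine p r
  have haxis : ∀ θ φ, σ (θ, φ) 0 = p 0 ∧ σ (θ, φ) 1 = p 1 → Real.sin θ = 0 := by
    rintro θ φ ⟨h0, h1⟩
    have e0 : σ (θ, φ) 0 = p 0 + r * (Real.sin θ * Real.cos φ) := by simp [hσ, sphereMap]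
    have e1 : σ (θ, φ) 1 = p 1 + r * (Real.sin θ * Real.sin φ) := by simp [hσ, sphereMap]
    rw [e0, add_eq_left, mul_eq_zero, or_iff_right hr.ne'] at h0
    rw [e1, add_eq_left, mul_eq_zero, or_iff_right hr.ne'] at h1
    have := Real.sin_sq_add_cos_sq φ
    have : Real.sin θ ^ 2 = 0 := by
      linear_combination Real.sin θ * Real.cos φ * h0 + Real.sin θ * Real.sin φ * h1 -
        Real.sin θ ^ 2 * this
    exact pow_eq_zero_iff (two_ne_zero) |>.1 this
  have hσ2 : ∀ θ φ, σ (θ, φ) 2 = p 2 + r * Real.cos θ := fun θ φ => by simp [hσ, sphereMap]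
  have hσN : ∀ θ φ, Real.cos θ ≤ 0 → σ (θ, φ) ∈ N := fun θ φ hθ => by
    refine (hmN _).2 ⟨hσb _, fun ⟨h1, h2⟩ => ?_⟩
    have hs := haxis θ φ h1
    rw [hσ2] at h2
    have hc' : Real.cos θ = 0 := by nlinarith
    have := Real.sin_sq_add_cos_sq θ
    rw [hs, hc'] at this; norm_num at this
  have hσM : ∀ θ φ, 0 ≤ Real.cos θ → σ (θ, φ) ∈ M := fun θ φ hθ => by
    refine (hmM _).2 ⟨hσb _, fun ⟨h1, h2⟩ => ?_⟩
    have hs := haxis θ φ h1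
    rw [hσ2] at h2
    have hc' : Real.cos θ = 0 := by nlinarith
    have := Real.sin_sq_add_cos_sq θ
    rw [hs, hc'] at this; norm_num at this
  have hσp : ∀ z, σ z ∈ ball p ρ \ {p} := fun z => by
    rcases le_total 0 (Real.cos z.1) with h | h
    exacts [hMsub (hσM _ _ h), hNsub (hσN _ _ h)]
  have hcirc : ∫ φ in (0 : ℝ)..(2 * Real.pi), β (p + r • sphereMap (Real.pi / 2, φ))
      ![r • sphereMapPhi (Real.pi / 2, φ)] = 0 := by
    set g : ℝ × ℝ → ℝ := fun z => η (σ z) ![r • sphereMapTheta z, r • sphereMapPhi z]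
    have hgc : Continuous g := continuous_iff_continuousAt.2 fun z =>
      (((hη _ (hσp z)).1.comp z hσs.contDiffAt).form_apply_two
        (contDiff_sphereMapTheta.const_smul r).contDiffAt
        (contDiff_sphereMapPhi.const_smul r).contDiffAt).continuousAt
    have hgi : Continuous fun θ => ∫ φ in (0 : ℝ)..(2 * Real.pi), g (θ, φ) :=
      intervalIntegral.continuous_parametric_intervalIntegral_of_continuous'
        (f := fun θ φ => g (θ, φ)) hgc 0 (2 * Real.pi)
    have hsplit := intervalIntegral.integral_add_adjacent_intervals
      (hgi.intervalIntegrable (μ := volume) 0 (Real.pi / 2)) (hgi.intervalIntegrable _ Real.pi)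
    have hband : ∀ {α : DiffForm 1} {D : Set E3} {a b : ℝ}, IsPrimitiveOn α η D →
        (∀ θ ∈ uIcc a b, ∀ φ, σ (θ, φ) ∈ D) →
        ∫ θ in a..b, ∫ φ in (0 : ℝ)..(2 * Real.pi), g (θ, φ) =
        (∫ φ in (0 : ℝ)..(2 * Real.pi), α (p + r • sphereMap (b, φ)) ![r • sphereMapPhi (b, φ)]) -
        ∫ φ in (0 : ℝ)..(2 * Real.pi), α (p + r • sphereMap (a, φ)) ![r • sphereMapPhi (a, φ)] := by
      intro α D a b hα hD
      rw [← integral_band_extDeriv fun θ hθ φ => (hα _ (hD θ hθ φ)).1]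
      refine intervalIntegral.integral_congr fun θ hθ =>
        intervalIntegral.integral_congr fun φ _ => ?_
      have := (hα _ (hD θ hθ φ)).2
      simp only [hσ] at this
      simp only [this, g, hσ]
    have hz : ∀ (α : DiffForm 1) (w : E3), w = 0 → ∀ y, α y ![w] = 0 := fun α w hw y => by
      subst hw; exact (α y).map_coord_zero 0 rfl
    have h0 : ∀ φ, r • sphereMapPhi (0, φ) = 0 := fun φ => by
      ext i; fin_cases i <;> simp [sphereMapPhi]
    have h0' : ∀ φ, r • sphereMapPhi (Real.pi, φ) = 0 := fun φ => by
      ext i; fin_cases i <;> simp [sphereMapPhi]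
    have hup := hband (a := 0) (b := Real.pi / 2) hαM fun θ hθ φ => by
      rw [uIcc_of_le (by linarith)] at hθ
      exact hσM θ φ (Real.cos_nonneg_of_mem_Icc ⟨by linarith [hθ.1], hθ.2⟩)
    have hlow := hband (a := Real.pi / 2) (b := Real.pi) hαN fun θ hθ φ => by
      rw [uIcc_of_le (by linarith)] at hθ
      exact hσN θ φ (Real.cos_nonpos_of_pi_div_two_le_of_le hθ.1 (by linarith [hθ.2]))
    simp only [hz _ _ (h0 _), hz _ _ (h0' _), intervalIntegral.integral_zero, sub_zero,
      zero_sub] at hup hlow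
    rw [hup, hlow, show (∫ θ in (0 : ℝ)..Real.pi, ∫ φ in (0 : ℝ)..(2 * Real.pi), g (θ, φ)) =
      sphereIntegral p r η from rfl, hper] at hsplit
    have hint : ∀ {α : DiffForm 1} {D : Set E3}, IsPrimitiveOn α η D →
        (∀ φ, σ (Real.pi / 2, φ) ∈ D) → IntervalIntegrable (fun φ =>
          α (p + r • sphereMap (Real.pi / 2, φ)) ![r • sphereMapPhi (Real.pi / 2, φ)])
          volume 0 (2 * Real.pi) := by
      intro α D hα hD
      have hc : ContDiff ℝ ∞ fun φ : ℝ => (Real.pi / 2, φ) := contDiff_const.prodMk contDiff_id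
      refine Continuous.intervalIntegrable (continuous_iff_continuousAt.2 fun φ => ?_) _ _
      exact (((hα _ (hD φ)).1.comp φ (hσs.comp hc).contDiffAt).form_apply_one
        (a := fun φ => r • sphereMapPhi (Real.pi / 2, φ))
        ((contDiff_sphereMapPhi.comp hc).const_smul r).contDiffAt).continuousAt
    simp only [hβ, ContinuousAlternatingMap.sub_apply]
    rw [intervalIntegral.integral_sub (hint hαN fun φ => hσN _ _ (by simp))
      (hint hαM fun φ => hσM _ _ (by simp))]
    linarith
  obtain ⟨G, hG⟩ := exists_primitive_ballOffAxis hr hrρ hβc hcirc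
  -- The cutoff depends only on the direction from `p`: it is 1 on the upper cone `Cp`, 0 on the
  -- lower cone `Cm`, and smooth away from `p`.
  set χ : E3 → ℝ := fun x => Real.smoothTransition ((x 2 - p 2) / ‖x - p‖ + 1 / 2) with hχ
  set Cp : Set E3 := {x | x ∈ ball p ρ ∧ ‖x - p‖ / 2 < x 2 - p 2} with hCp
  set Cm : Set E3 := {x | x ∈ ball p ρ ∧ x 2 - p 2 < -(‖x - p‖ / 2)} with hCm
  have hCpo : IsOpen Cp := isOpen_ball.inter
    (isOpen_lt (f := fun x : E3 => ‖x - p‖ / 2) (g := fun x => x 2 - p 2) (by fun_prop)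
      (by fun_prop))
  have hCmo : IsOpen Cm := isOpen_ball.inter
    (isOpen_lt (f := fun x : E3 => x 2 - p 2) (g := fun x => -(‖x - p‖ / 2)) (by fun_prop)
      (by fun_prop))
  have hpos : ∀ {x}, x ∈ ball p ρ \ {p} → 0 < ‖x - p‖ := fun hx =>
    norm_pos_iff.2 (sub_ne_zero.2 hx.2)
  have hCpM : Cp ⊆ M := fun x hx => (hmM x).2 ⟨hx.1, fun h => by
    linarith [hx.2, norm_nonneg (x - p), h.2]⟩
  have hCmN : Cm ⊆ N := fun x hx => (hmN x).2 ⟨hx.1, fun h => by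
    linarith [hx.2, norm_nonneg (x - p), h.2]⟩
  have hTp : ballOffAxis p ρ ⊆ ball p ρ \ {p} := hTN.trans hNsub
  have hχp : ∀ x ∈ Cp, χ x = 1 := fun x hx => by
    refine Real.smoothTransition.one_of_one_le ?_
    have := (le_div_iff₀ (hpos (hMsub (hCpM hx)))).2 (by linarith [hx.2] :
      1 / 2 * ‖x - p‖ ≤ x 2 - p 2)
    linarith
  have hχm : ∀ x ∈ Cm, χ x = 0 := fun x hx => by
    refine Real.smoothTransition.zero_of_nonpos ?_
    have := (div_le_iff₀ (hpos (hNsub (hCmN hx)))).2 (by linarith [hx.2] :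
      x 2 - p 2 ≤ -(1 / 2) * ‖x - p‖)
    linarith
  have hχs : ∀ x ∈ ball p ρ \ {p}, ContDiffAt ℝ ∞ χ x := fun x hx => by
    refine Real.smoothTransition.contDiff.contDiffAt.comp x ?_
    refine ContDiffAt.add (ContDiffAt.div ?_ ?_ (hpos hx).ne') contDiffAt_const
    · exact ((coordE3 2).contDiff.contDiffAt).sub contDiffAt_const
    · exact (contDiffAt_norm ℝ (sub_ne_zero.2 hx.2)).comp x (contDiffAt_id.sub contDiffAt_const)
  -- Where χ = 1 this is αN - dG = αM, and where χ = 0 it is αN, so it continues across both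
  -- half-axes.
  set αT : DiffForm 1 := fun x => αN x - differential (fun y => χ y * G y) x with hαT
  have hαTp : IsPrimitiveOn αT η (ballOffAxis p ρ) := fun x hx => by
    have hd := isClosedFormOn_differential ((hχs x (hTp hx)).mul (hG x hx).1)
    refine ⟨(hαN x (hTN hx)).1.sub hd.1, ?_⟩
    rw [hαT, extDeriv_sub_of_contDiffAt (hαN x (hTN hx)).1 hd.1, hd.2, sub_zero,
      (hαN x (hTN hx)).2]
  have hagp : ∀ x ∈ ballOffAxis p ρ, x ∈ Cp → αT x = αM x := fun x hx hxp => by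
    have he : (fun y => χ y * G y) =ᶠ[𝓝 x] G := by
      filter_upwards [hCpo.mem_nhds hxp] with y hy
      rw [hχp y hy, one_mul]
    ext v
    have hv : v = ![v 0] := by ext i; fin_cases i; rfl
    simp only [hαT, ContinuousAlternatingMap.sub_apply, differential_apply]
    rw [he.fderiv_eq, (hG x hx).2, ← hv]
    simp [hβ]
  have hagm : ∀ x ∈ Cm, αT x = αN x := fun x hxm => by
    have he : (fun y => χ y * G y) =ᶠ[𝓝 x] fun _ => 0 := by
      filter_upwards [hCmo.mem_nhds hxm] with y hy
      rw [hχm y hy, zero_mul]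
    ext v
    simp only [hαT, ContinuousAlternatingMap.sub_apply, differential_apply]
    rw [he.fderiv_eq]
    simp
  have hdisj : ∀ x ∈ Cp, x ∉ Cm := fun x hp hm => by
    linarith [hp.2, hm.2, norm_nonneg (x - p)]
  obtain ⟨α, hα⟩ := exists_eqOn_of_eqOn_inter
    (fun i : Fin 3 => (![ballOffAxis p ρ, Cp, Cm] : Fin 3 → Set E3) i)
    (fun i => (![αT, αM, αN] : Fin 3 → DiffForm 1) i) (by
      intro i j x hx
      fin_cases i <;> fin_cases j <;> simp at hx ⊢
      · exact hagp x hx.1 hx.2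
      · exact hagm x hx.2
      · exact (hagp x hx.2 hx.1).symm
      · exact absurd hx.2 (hdisj x hx.1)
      · exact (hagm x hx.1).symm
      · exact absurd hx.1 (hdisj x hx.2))
  have hα0 := hαTp.congr (isOpen_ballOffAxis p ρ) (by simpa using hα 0)
  have hα1 := (show IsPrimitiveOn αM η Cp from fun x hx => hαM x (hCpM hx)).congr hCpo
    (by simpa using hα 1)
  have hα2 := (show IsPrimitiveOn αN η Cm from fun x hx => hαN x (hCmN hx)).congr hCmo
    (by simpa using hα 2)
  refine ⟨α, fun x hx => ?_⟩
  by_cases hxT : x 0 = p 0 ∧ x 1 = p 1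
  · have hn : ‖x - p‖ = |x 2 - p 2| := by
      rw [EuclideanSpace.norm_eq, Fin.sum_univ_three]
      simp [hxT.1, hxT.2, Real.sqrt_sq_eq_abs]
    have h0 := hpos hx
    rcases le_or_gt 0 (x 2 - p 2) with h | h
    · refine hα1 x ⟨hx.1, ?_⟩
      rw [abs_of_nonneg h] at hn
      linarith
    · refine hα2 x ⟨hx.1, ?_⟩
      rw [abs_of_neg h] at hn
      linarith
  · exact hα0 x ⟨hx.1, hxT⟩

/-- Around each point of a closed discrete set there is a ball inside `Ω`; the balls can be chosen
pairwise disjoint. -/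
theorem exists_disjoint_balls {Ω A : Set E3} (hΩ : IsOpen Ω) (hA : IsDiscrete A) :
    ∃ ρ : E3 → ℝ, (∀ p ∈ A ∩ Ω, 0 < ρ p ∧ ball p (ρ p) ⊆ Ω ∧ ball p (ρ p) ∩ A = {p}) ∧
      ∀ p ∈ A ∩ Ω, ∀ q ∈ A ∩ Ω, p ≠ q → Disjoint (ball p (ρ p)) (ball q (ρ q)) := by
  have h : ∀ p ∈ A ∩ Ω, ∃ δ > 0, ball p δ ⊆ Ω ∧ ball p δ ∩ A = {p} := by
    rintro p ⟨hpA, hpΩ⟩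
    obtain ⟨δ₁, h1, h1'⟩ := Metric.isOpen_iff.1 hΩ p hpΩ
    obtain ⟨δ₂, h2, h2'⟩ := Metric.exists_ball_inter_eq_singleton_of_mem_discrete hA hpA
    refine ⟨min δ₁ δ₂, lt_min h1 h2, (ball_subset_ball (min_le_left _ _)).trans h1', ?_⟩
    refine Subset.antisymm ?_ ?_
    · rw [← h2']
      exact inter_subset_inter_left _ (ball_subset_ball (min_le_right _ _))
    · rintro _ rfl
      exact ⟨mem_ball_self (lt_min h1 h2), hpA⟩
  choose! δ hδ using h
  -- Halving makes the balls disjoint: a common point would put one centre within the larger of the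
  -- two original radii of the other.
  refine ⟨fun p => δ p / 2, fun p hp => ⟨half_pos (hδ p hp).1, ?_, ?_⟩, ?_⟩
  · exact (ball_subset_ball (half_le_self (hδ p hp).1.le)).trans (hδ p hp).2.1
  · refine Subset.antisymm ?_ ?_
    · rw [← (hδ p hp).2.2]
      exact inter_subset_inter_left _ (ball_subset_ball (half_le_self (hδ p hp).1.le))
    · rintro _ rfl
      exact ⟨mem_ball_self (half_pos (hδ _ hp).1), hp.1⟩
  · intro p hp q hq hpq
    refine Set.disjoint_left.2 fun x hxp hxq => ?_
    rw [mem_ball] at hxp hxq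
    have hd : dist p q < δ p / 2 + δ q / 2 := by
      linarith [dist_triangle_left p q x]
    rcases le_total (δ p) (δ q) with h | h
    · have : p ∈ ball q (δ q) ∩ A := ⟨by rw [mem_ball]; linarith, hp.1⟩
      rw [(hδ q hq).2.2] at this
      exact hpq this
    · have : q ∈ ball p (δ p) ∩ A := ⟨by rw [mem_ball, dist_comm]; linarith, hq.1⟩
      rw [(hδ p hp).2.2] at this
      exact hpq this.symm

/-- On the complement of a closed discrete set in a star-convex open set, a closed 2-form with
vanishing integrals over small spheres around the removed points is exact. -/
theorem exists_primitive_of_sphereIntegral_eq_zero {Ω A : Set E3} (hΩ : IsOpen Ω) {q : E3}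
    (hq : StarConvex ℝ q Ω) (hAc : IsClosed A) (hA : IsDiscrete A) {η : DiffForm 2}
    (hη : IsClosedFormOn η (Ω \ A))
    (hper : ∀ p ∈ A ∩ Ω, ∀ᶠ r in 𝓝[>] (0 : ℝ), sphereIntegral p r η = 0) :
    ∃ α : DiffForm 1, IsPrimitiveOn α η (Ω \ A) := by
  classical
  obtain ⟨ρ, hρ, hdisj⟩ := exists_disjoint_balls hΩ hA
  have hpunct : ∀ p ∈ A ∩ Ω, ball p (ρ p) \ {p} ⊆ Ω \ A := fun p hp x hx => by
    refine ⟨(hρ p hp).2.1 hx.1, fun hxA => hx.2 ?_⟩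
    rw [← (hρ p hp).2.2]
    exact ⟨hx.1, hxA⟩
  have hloc : ∀ p ∈ A ∩ Ω, ∃ α : DiffForm 1, IsPrimitiveOn α η (ball p (ρ p) \ {p}) := by
    intro p hp
    obtain ⟨r, hr0, hr⟩ := ((hper p hp).and (Ioo_mem_nhdsGT (hρ p hp).1)).exists
    exact exists_primitive_punctured_ball hr.1 hr.2 (hη.mono (hpunct p hp)) hr0
  choose! a ha using hloc
  -- The cutoff is 1 on the ball of radius `ρ p / 4` and 0 outside that of radius `ρ p / 2`. The
  -- squared norm keeps it smooth at `p`.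
  let χ : E3 → E3 → ℝ := fun p x => Real.smoothTransition (2 - 4 * (‖x - p‖ ^ 2 / (ρ p / 2) ^ 2))
  have hχs : ∀ p, ContDiff ℝ ∞ (χ p) := fun p => by
    refine Real.smoothTransition.contDiff.comp ?_
    exact contDiff_const.sub (contDiff_const.mul
      (((contDiff_id.sub contDiff_const).norm_sq ℝ).div_const _))
  have hχ1 : ∀ p ∈ A ∩ Ω, ∀ x ∈ ball p (ρ p / 4), χ p x = 1 := fun p hp x hx => by
    refine Real.smoothTransition.one_of_one_le ?_
    have h0 := (hρ p hp).1
    rw [mem_ball, dist_eq_norm] at hx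
    have : ‖x - p‖ ^ 2 / (ρ p / 2) ^ 2 ≤ 1 / 4 := by
      rw [div_le_iff₀ (by positivity)]
      nlinarith [norm_nonneg (x - p)]
    linarith
  have hχ0 : ∀ p ∈ A ∩ Ω, ∀ x ∉ ball p (ρ p / 2), χ p x = 0 := fun p hp x hx => by
    refine Real.smoothTransition.zero_of_nonpos ?_
    have h0 := (hρ p hp).1
    rw [mem_ball, dist_eq_norm, not_lt] at hx
    have : 1 ≤ ‖x - p‖ ^ 2 / (ρ p / 2) ^ 2 := by
      rw [le_div_iff₀ (by positivity)]
      nlinarith [norm_nonneg (x - p)]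
    linarith
  -- the sum of the truncated local primitives
  let O : Option ↥(A ∩ Ω) → Set E3 := fun i => i.elim
    ((Ω \ A) ∩ interior {x | ∀ p ∈ A ∩ Ω, x ∉ ball p (ρ p / 2)})
    fun p => ball (p : E3) (ρ p) \ {(p : E3)}
  let f : Option ↥(A ∩ Ω) → DiffForm 1 := fun i => i.elim 0 fun p x => χ p x • a p x
  obtain ⟨β, hβ⟩ := exists_eqOn_of_eqOn_inter O f (by
    rintro (_ | p) (_ | p') x hx
    · rfl
    · have := hχ0 p' p'.2 x (interior_subset hx.1.2 p' p'.2)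
      simp [f, this]
    · have := hχ0 p p.2 x (interior_subset hx.2.2 p p.2)
      simp [f, this]
    · have : p = p' := by
        by_contra hne
        exact Set.disjoint_left.1 (hdisj p p.2 p' p'.2 fun h => hne (Subtype.ext h))
          hx.1.1 hx.2.1
      rw [this])
  have hO : ∀ i, IsOpen (O i) := by
    rintro (_ | p)
    · exact (hΩ.sdiff hAc).inter isOpen_interior
    · exact isOpen_ball.sdiff isClosed_singleton
  have hcover : ∀ x ∈ Ω \ A, ∃ i, x ∈ O i := by
    intro x hx
    by_cases hex : ∃ p ∈ A ∩ Ω, x ∈ ball p (ρ p)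
    · obtain ⟨p, hp, hxp⟩ := hex
      exact ⟨some ⟨p, hp⟩, hxp, fun h => hx.2 (by rw [mem_singleton_iff.1 h]; exact hp.1)⟩
    · push Not at hex
      -- Let `d` be a radius of a ball about `x` that misses `A`. A point of a half ball about `p`
      -- within `d/2` of `x` would give |x - p| < (d + ρ_p)/2, although |x - p| is at least `d` and
      -- at least ρ_p.
      refine ⟨none, hx, ?_⟩
      obtain ⟨d, hd, hdA⟩ := Metric.isOpen_iff.1 hAc.isOpen_compl x hx.2
      rw [mem_interior_iff_mem_nhds]
      filter_upwards [ball_mem_nhds x (half_pos hd)] with y hy p hp hyp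
      have h1 := hex p hp
      rw [mem_ball] at hy hyp
      rw [mem_ball, not_lt] at h1
      have h2 : d ≤ dist x p := by
        by_contra hlt
        exact hdA (by rw [mem_ball, dist_comm]; linarith) hp.1
      linarith [dist_triangle_left x p y]
  have hfs : ∀ i, ∀ x ∈ O i, ContDiffAt ℝ ∞ (f i) x := by
    rintro (_ | p) x hx
    · exact contDiffAt_const
    · exact (hχs p).contDiffAt.smul (ha p p.2 x hx).1
  have hβs : ∀ x ∈ Ω \ A, ContDiffAt ℝ ∞ β x := fun x hx => by
    obtain ⟨i, hi⟩ := hcover x hx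
    exact (hfs i x hi).congr_of_eventuallyEq ((hβ i).eventuallyEq_of_mem ((hO i).mem_nhds hi))
  -- Near a puncture `β` is a primitive of `η`, so `η - dβ` vanishes there and extends by zero to a
  -- closed form on all of `Ω`.
  let ζ : DiffForm 2 := fun x => if x ∈ A then 0 else η x - extDeriv β x
  have hζc : IsClosedFormOn ζ Ω := by
    intro x hx
    by_cases hxA : x ∈ A
    · have hp : x ∈ A ∩ Ω := ⟨hxA, hx⟩
      have hz : ζ =ᶠ[𝓝 x] fun _ => 0 := by
        have h0 := (hρ x hp).1
        filter_upwards [ball_mem_nhds x (by positivity : 0 < ρ x / 4)] with y hy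
        by_cases hyA : y ∈ A
        · exact if_pos hyA
        · have hyx : y ≠ x := fun h => hyA (h ▸ hxA)
          have hyb : y ∈ ball x (ρ x) \ {x} := ⟨ball_subset_ball (by linarith) hy, hyx⟩
          have he : β =ᶠ[𝓝 y] a x := by
            filter_upwards [(hO (some ⟨x, hp⟩)).mem_nhds hyb, isOpen_ball.mem_nhds hy] with z hz hz'
            rw [hβ (some ⟨x, hp⟩) hz]
            simp [f, hχ1 x hp z hz']
          simp only [ζ, if_neg hyA]
          rw [he.extDeriv_eq, (ha x hp y hyb).2, sub_self]
      refine ⟨contDiffAt_const.congr_of_eventuallyEq hz, ?_⟩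
      rw [hz.extDeriv_eq]
      have h := extDeriv_smul (x := x) (0 : ℝ) (0 : DiffForm 2)
      change extDeriv (0 : DiffForm 2) x = 0
      simpa using h
    · have hz : ζ =ᶠ[𝓝 x] fun y => η y - extDeriv β y := by
        filter_upwards [hAc.isOpen_compl.mem_nhds hxA] with y hy
        exact if_neg hy
      have hb := hβs x ⟨hx, hxA⟩
      have hηx := hη x ⟨hx, hxA⟩
      refine ⟨(hηx.1.sub hb.extDeriv).congr_of_eventuallyEq hz, ?_⟩
      rw [hz.extDeriv_eq, extDeriv_sub_of_contDiffAt hηx.1 hb.extDeriv, hηx.2,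
        extDeriv_extDeriv_of_contDiffAt hb, sub_zero]
  obtain ⟨γ, hγ⟩ := exists_extDeriv_eq_of_starConvex hq hζc
  refine ⟨γ + β, fun x hx => ⟨(hγ x hx.1).1.add (hβs x hx), ?_⟩⟩
  rw [extDeriv_add ((hγ x hx.1).1.differentiableAt (by simp))
    ((hβs x hx).differentiableAt (by simp)), (hγ x hx.1).2]
  simp [ζ, hx.2]

end Primitives

/-! ### Flux forms and spherical means -/

section Flux

open MeasureTheory ContinuousAlternatingMap Metric

theorem volForm_apply (a b c : E3) : volForm ![a, b, c] =
    a 0 * (b 1 * c 2 - b 2 * c 1) + a 1 * (b 2 * c 0 - b 0 * c 2) +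
      a 2 * (b 0 * c 1 - b 1 * c 0) := by
  change (EuclideanSpace.basisFun (Fin 3) ℝ).toBasis.det ![a, b, c] = _
  simp only [Module.Basis.det_apply, Matrix.det_fin_three, Module.Basis.toMatrix_apply,
    OrthonormalBasis.coe_toBasis_repr_apply, EuclideanSpace.basisFun_repr, Matrix.cons_val_zero,
    Matrix.cons_val_one, Matrix.cons_val]
  ring

/-- The 2-form whose integral over a surface is the flux of the vector field `X`. -/
def fluxForm (X : E3 → E3) : DiffForm 2 := fun x => volForm.curryLeft (X x)

/-- The divergence of a vector field. -/
def divergence (X : E3 → E3) (x : E3) : ℝ :=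
  ∑ i, fderiv ℝ (fun y => X y i) x (EuclideanSpace.single i 1)

theorem starD_eq_fluxForm (V : E3 → ℝ) : starD V = fluxForm (gradient V) := rfl

theorem ContDiffAt.fluxForm {X : E3 → E3} {x : E3} (h : ContDiffAt ℝ ∞ X x) :
    ContDiffAt ℝ ∞ (fluxForm X) x :=
  volForm.curryLeft.contDiff.contDiffAt.comp x h

theorem gradient_apply_eq (f : E3 → ℝ) (x : E3) (i : Fin 3) :
    gradient f x i = fderiv ℝ f x (EuclideanSpace.single i 1) := by
  have h : ⟪gradient f x, EuclideanSpace.single i (1 : ℝ)⟫_ℝ = _ := toDual_symm_apply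
  rw [← h, EuclideanSpace.inner_single_right]
  simp

theorem inner_gradient (f : E3 → ℝ) (x v : E3) : ⟪gradient f x, v⟫_ℝ = fderiv ℝ f x v :=
  toDual_symm_apply

theorem ContDiffAt.gradient {f : E3 → ℝ} {x : E3} (h : ContDiffAt ℝ ∞ f x) :
    ContDiffAt ℝ ∞ (gradient f) x := by
  refine contDiffAt_euclidean.2 fun i => ?_
  simp only [gradient_apply_eq]
  exact (h.fderiv_right (m := ∞) (by simp)).clm_apply contDiffAt_const

/-- With D the derivative of X, the algebra behind this is that vol(Da, b, c) + vol(a, Db, c) +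
vol(a, b, Dc) is the trace of D times vol(a, b, c). It is checked by expanding D in the standard
basis. -/
theorem extDeriv_fluxForm {X : E3 → E3} {x : E3} (h : ContDiffAt ℝ ∞ X x) :
    extDeriv (fluxForm X) x = divergence X x • volForm := by
  have hd : HasFDerivAt X (fderiv ℝ X x) x := (h.differentiableAt (by simp)).hasFDerivAt
  set D := fderiv ℝ X x
  have hflux : fderiv ℝ (fluxForm X) x = volForm.curryLeft.comp D :=
    (volForm.curryLeft.hasFDerivAt.comp x hd).fderiv
  have hcomp : ∀ i v, fderiv ℝ (fun y => X y i) x v = D v i := fun i v => by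
    have : HasFDerivAt (fun y => X y i) ((EuclideanSpace.proj i : E3 →L[ℝ] ℝ).comp D) x :=
      (EuclideanSpace.proj i : E3 →L[ℝ] ℝ).hasFDerivAt.comp x hd
    rw [this.fderiv]; rfl
  have hexp : ∀ v i, D v i = v 0 * D (EuclideanSpace.single 0 1) i +
      v 1 * D (EuclideanSpace.single 1 1) i + v 2 * D (EuclideanSpace.single 2 1) i := fun v i => by
    have : v = v 0 • EuclideanSpace.single (0 : Fin 3) (1 : ℝ) +
        v 1 • EuclideanSpace.single (1 : Fin 3) (1 : ℝ) +
        v 2 • EuclideanSpace.single (2 : Fin 3) (1 : ℝ) := by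
      ext j; fin_cases j <;> simp
    conv_lhs => rw [this]
    simp
  ext v
  have hv : v = ![v 0, v 1, v 2] := by ext i; fin_cases i <;> rfl
  have h0 : Fin.removeNth 0 v = ![v 1, v 2] := by ext i; fin_cases i <;> rfl
  have h1 : Fin.removeNth 1 v = ![v 0, v 2] := by ext i; fin_cases i <;> rfl
  have h2 : Fin.removeNth 2 v = ![v 0, v 1] := by ext i; fin_cases i <;> rfl
  rw [extDeriv, alternatizeUncurryFin_apply, Fin.sum_univ_three, h0, h1, h2, hflux,
    ContinuousAlternatingMap.smul_apply]
  conv_rhs => rw [hv]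
  simp only [ContinuousLinearMap.comp_apply, curryLeft_apply_apply, volForm_apply, divergence,
    Fin.sum_univ_three, hcomp]
  rw [show volForm ![D (v 0), v 1, v 2] = _ from volForm_apply _ _ _,
    show volForm ![D (v 1), v 0, v 2] = _ from volForm_apply _ _ _,
    show volForm ![D (v 2), v 0, v 1] = _ from volForm_apply _ _ _]
  rw [hexp (v 0) 0, hexp (v 0) 1, hexp (v 0) 2, hexp (v 1) 0, hexp (v 1) 1, hexp (v 1) 2,
    hexp (v 2) 0, hexp (v 2) 1, hexp (v 2) 2]
  simp
  ring

theorem isClosedFormOn_fluxForm {X : E3 → E3} {S : Set E3} (h : ∀ x ∈ S, ContDiffAt ℝ ∞ X x)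
    (hdiv : ∀ x ∈ S, divergence X x = 0) : IsClosedFormOn (fluxForm X) S := fun x hx =>
  ⟨(h x hx).fluxForm, by rw [extDeriv_fluxForm (h x hx), hdiv x hx, zero_smul]⟩

theorem laplacian_eq_divergence_gradient {f : E3 → ℝ} {x : E3} (h : ContDiffAt ℝ 2 f x) :
    Laplacian.laplacian f x = divergence (gradient f) x := by
  rw [laplacian_eq_iteratedFDeriv_orthonormalBasis f (EuclideanSpace.basisFun (Fin 3) ℝ)]
  simp only [divergence, gradient_apply_eq]
  refine Finset.sum_congr rfl fun i _ => ?_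
  rw [iteratedFDeriv_two_apply]
  have hd : DifferentiableAt ℝ (fderiv ℝ f) x :=
    (h.fderiv_right (m := 1) (by norm_num)).differentiableAt (by simp)
  rw [fderiv_clm_apply hd (differentiableAt_const _)]
  simp

/-- This is the area element r² sin θ dθ dφ with the outward normal; it turns fluxes into the
weighted means of `sphereAvg`. -/
theorem volForm_sphere (X : E3) (r : ℝ) (z : ℝ × ℝ) :
    volForm ![X, r • sphereMapTheta z, r • sphereMapPhi z] =
      r ^ 2 * (Real.sin z.1 * ⟪X, sphereMap z⟫_ℝ) := by
  have h1 := Real.sin_sq_add_cos_sq z.1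
  have h2 := Real.sin_sq_add_cos_sq z.2
  rw [volForm_apply]
  simp [sphereMapTheta, sphereMapPhi, sphereMap, PiLp.inner_apply, Fin.sum_univ_three]
  linear_combination (r ^ 2 * Real.sin z.1 * X 2 * Real.cos z.1) * h2

/-- The integral of `f` over the sphere of centre `p` and radius `s`, divided by `s ^ 2`. -/
def sphereAvg (f : E3 → ℝ) (p : E3) (s : ℝ) : ℝ :=
  ∫ z in sphereRect, Real.sin z.1 * f (p + s • sphereMap z)

theorem continuous_sphereMap_affine (p : E3) (s : ℝ) : Continuous fun z => p + s • sphereMap z :=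
  (contDiff_sphereMap_affine p s).continuous

theorem integrableOn_sphereRect {f : E3 → ℝ} {p : E3} {s : ℝ}
    (h : ∀ z, ContinuousAt f (p + s • sphereMap z)) :
    IntegrableOn (fun z => Real.sin z.1 * f (p + s • sphereMap z)) sphereRect := by
  refine ContinuousOn.integrableOn_compact isCompact_sphereRect (Continuous.continuousOn ?_)
  refine Continuous.mul (by fun_prop) (continuous_iff_continuousAt.2 fun z => ?_)
  exact (h z).comp (f := fun z => p + s • sphereMap z) (continuous_sphereMap_affine p s).continuousAt

theorem sin_nonneg_of_mem_sphereRect {z : ℝ × ℝ} (hz : z ∈ sphereRect) : 0 ≤ Real.sin z.1 :=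
  Real.sin_nonneg_of_mem_Icc hz.1

theorem sphereAvg_nonneg {f : E3 → ℝ} {p : E3} {s : ℝ}
    (h : ∀ z, 0 ≤ f (p + s • sphereMap z)) : 0 ≤ sphereAvg f p s :=
  setIntegral_nonneg isCompact_sphereRect.measurableSet fun z hz =>
    mul_nonneg (sin_nonneg_of_mem_sphereRect hz) (h z)

theorem sphereAvg_congr {f g : E3 → ℝ} {p : E3} {s : ℝ}
    (h : ∀ z, f (p + s • sphereMap z) = g (p + s • sphereMap z)) :
    sphereAvg f p s = sphereAvg g p s := by
  simp only [sphereAvg, h]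

/-- Only the majorant has to be integrable, so no regularity of `f` is required. -/
theorem abs_sphereAvg_le {f g : E3 → ℝ} {p : E3} {s M : ℝ}
    (hg : ∀ z, ContinuousAt g (p + s • sphereMap z))
    (h : ∀ z, |f (p + s • sphereMap z)| ≤ M * g (p + s • sphereMap z)) :
    |sphereAvg f p s| ≤ M * sphereAvg g p s := by
  rw [sphereAvg, sphereAvg, ← integral_const_mul, ← Real.norm_eq_abs]
  refine norm_integral_le_of_norm_le ((integrableOn_sphereRect hg).const_mul M) ?_
  refine (ae_restrict_iff' isCompact_sphereRect.measurableSet).2 (Eventually.of_forall fun z hz => ?_)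
  rw [Real.norm_eq_abs, abs_mul, abs_of_nonneg (sin_nonneg_of_mem_sphereRect hz)]
  nlinarith [h z, sin_nonneg_of_mem_sphereRect hz]

theorem sphereAvg_const (a : ℝ) (p : E3) (s : ℝ) :
    sphereAvg (fun _ => a) p s = 4 * Real.pi * a := by
  rw [sphereAvg, ← integral_sphereRect (g := fun z => Real.sin z.1 * a) (by fun_prop)]
  simp
  ring

theorem sphereIntegral_fluxForm {X : E3 → E3} {p : E3} {s : ℝ}
    (h : ∀ z, ContinuousAt X (p + s • sphereMap z)) :
    sphereIntegral p s (fluxForm X) =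
      s ^ 2 * ∫ z in sphereRect, Real.sin z.1 * ⟪X (p + s • sphereMap z), sphereMap z⟫_ℝ := by
  rw [← integral_const_mul, ← integral_sphereRect, sphereIntegral_eq]
  · refine intervalIntegral.integral_congr fun θ _ => intervalIntegral.integral_congr fun φ _ => ?_
    simp only [fluxForm, curryLeft_apply_apply]
    exact volForm_sphere _ _ _
  · have h1 : Continuous fun z => X (p + s • sphereMap z) :=
      continuous_iff_continuousAt.2 fun z => (h z).comp (f := fun z => p + s • sphereMap z)
        (continuous_sphereMap_affine p s).continuousAt
    have h2 := contDiff_sphereMap.continuous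
    have h3 : Continuous fun z => ⟪X (p + s • sphereMap z), sphereMap z⟫_ℝ := h1.inner h2
    exact (continuous_const.mul (Continuous.mul (by fun_prop) h3)).continuousOn

/-- The derivative of the spherical average is the flux of the gradient. -/
theorem hasDerivAt_sphereAvg {f : E3 → ℝ} {p : E3} {s : ℝ} (hs : s ≠ 0)
    (h : ∀ z, ContDiffAt ℝ ∞ f (p + s • sphereMap z)) :
    HasDerivAt (sphereAvg f p) (sphereIntegral p s (fluxForm (gradient f)) / s ^ 2) s := by
  have hmap : ContDiff ℝ ∞ fun y : ℝ × ℝ × ℝ => p + y.1 • sphereMap y.2 :=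
    contDiff_const.add (contDiff_fst.smul (contDiff_sphereMap.comp contDiff_snd))
  have hH : ∀ z, ContDiffAt ℝ ∞ (fun y : ℝ × ℝ × ℝ =>
      Real.sin y.2.1 * f (p + y.1 • sphereMap y.2)) (s, z) := fun z =>
    ContDiffAt.mul (by fun_prop) (ContDiffAt.comp (s, z) (h z) hmap.contDiffAt)
  have hd := (hasFDerivAt_setIntegral_of_contDiffAt (μ := volume) isCompact_sphereRect
      (fun z _ => (hH z).of_le (by simp : (1 : WithTop ℕ∞) ≤ ∞))).hasDerivAt
  refine hd.congr_deriv ?_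
  rw [sphereIntegral_fluxForm fun z => (h z).gradient.continuousAt,
    mul_div_cancel_left₀ _ (pow_ne_zero 2 hs), ContinuousLinearMap.integral_apply]
  · refine integral_congr_ae (Eventually.of_forall fun z => ?_)
    simp only [ContinuousLinearMap.comp_apply, ContinuousLinearMap.inl_apply]
    have h1 : HasFDerivAt (fun y : ℝ × ℝ × ℝ => Real.sin y.2.1 * f (p + y.1 • sphereMap y.2)) _
      (s, z) := ((hH z).differentiableAt (by simp)).hasFDerivAt
    have h2 : HasDerivAt (fun t => Real.sin z.1 * f (p + t • sphereMap z)) _ s :=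
      HasFDerivAt.comp_hasDerivAt (f := fun t => (t, z)) s h1
        ((hasDerivAt_id s).prodMk (hasDerivAt_const s z))
    have h3 : HasDerivAt (fun t => Real.sin z.1 * f (p + t • sphereMap z)) _ s :=
      (((h z).differentiableAt (by simp)).hasFDerivAt.comp_hasDerivAt s
        (((hasDerivAt_id s).smul_const (sphereMap z)).const_add p)).const_mul (Real.sin z.1)
    have h4 := h2.unique h3
    rw [inner_gradient]
    simpa using h4
  · refine ContinuousOn.integrableOn_compact isCompact_sphereRect fun z _ => ?_
    refine ContinuousAt.continuousWithinAt (ContinuousAt.clm_comp ?_ continuousAt_const)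
    exact ContinuousAt.comp (f := fun z => (s, z))
      ((hH z).fderiv_right (m := 0) (by simp)).continuousAt (by fun_prop)

theorem continuousAt_sphereAvg_zero {f : E3 → ℝ} {p : E3} (h : ContDiffAt ℝ ∞ f p) :
    ContinuousAt (sphereAvg f p) 0 := by
  have hmap : ContDiff ℝ ∞ fun y : ℝ × ℝ × ℝ => p + y.1 • sphereMap y.2 :=
    contDiff_const.add (contDiff_fst.smul (contDiff_sphereMap.comp contDiff_snd))
  have hH : ∀ z, ContDiffAt ℝ ∞ (fun y : ℝ × ℝ × ℝ =>
      Real.sin y.2.1 * f (p + y.1 • sphereMap y.2)) (0, z) := fun z =>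
    ContDiffAt.mul (by fun_prop) (ContDiffAt.comp ((0 : ℝ), z) (by simpa using h) hmap.contDiffAt)
  exact (contDiffAt_setIntegral (μ := volume) isCompact_sphereRect fun z _ => hH z).continuousAt

theorem sphereAvg_zero (f : E3 → ℝ) (p : E3) : sphereAvg f p 0 = 4 * Real.pi * f p := by
  rw [← sphereAvg_const (f p) p 0]
  exact sphereAvg_congr fun z => by simp

/-- Linearity of the integral over a sphere. -/
theorem sphereIntegral_sub {η ζ : DiffForm 2} {q : E3} {r : ℝ}
    (hη : ∀ z, ContDiffAt ℝ ∞ η (q + r • sphereMap z))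
    (hζ : ∀ z, ContDiffAt ℝ ∞ ζ (q + r • sphereMap z)) :
    sphereIntegral q r (fun x => η x - ζ x) = sphereIntegral q r η - sphereIntegral q r ζ := by
  have hc : ∀ {η : DiffForm 2}, (∀ z, ContDiffAt ℝ ∞ η (q + r • sphereMap z)) →
      ContinuousOn (fun z => η (q + r • sphereMap z)
        ![r • sphereMapTheta z, r • sphereMapPhi z]) sphereRect := fun {η} h z _ =>
    (((h z).comp z (contDiff_sphereMap_affine q r).contDiffAt).form_apply_two
        (contDiff_sphereMapTheta.const_smul r).contDiffAt
        (contDiff_sphereMapPhi.const_smul r).contDiffAt).continuousAt.continuousWithinAt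
  have he : ∀ {η : DiffForm 2}, (∀ z, ContDiffAt ℝ ∞ η (q + r • sphereMap z)) →
      sphereIntegral q r η = ∫ z in sphereRect, η (q + r • sphereMap z)
        ![r • sphereMapTheta z, r • sphereMapPhi z] := fun h => by
    rw [← integral_sphereRect (hc h)]; rfl
  rw [he hη, he hζ, he fun z => (hη z).sub (hζ z), ← integral_sub
    ((hc hη).integrableOn_compact isCompact_sphereRect)
    ((hc hζ).integrableOn_compact isCompact_sphereRect)]
  rfl

theorem sphereIntegral_smul (a : ℝ) (η : DiffForm 2) (q : E3) (r : ℝ) :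
    sphereIntegral q r (fun x => a • η x) = a * sphereIntegral q r η := by
  simp [sphereIntegral]

theorem sphereIntegral_congr {η ζ : DiffForm 2} {q : E3} {r : ℝ}
    (h : ∀ z, η (q + r • sphereMap z) = ζ (q + r • sphereMap z)) :
    sphereIntegral q r η = sphereIntegral q r ζ := by
  simp only [sphereIntegral_eq, h]

end Flux

/-! ### The Newton kernel and the residue theorem -/

section Newton

open MeasureTheory ContinuousAlternatingMap Metric

theorem hasFDerivAt_norm_sub {p x : E3} (hx : x ≠ p) :
    HasFDerivAt (fun y => ‖y - p‖) (‖x - p‖⁻¹ • innerSL ℝ (x - p)) x := by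
  have h0 : ‖x - p‖ ≠ 0 := norm_ne_zero_iff.2 (sub_ne_zero.2 hx)
  have h1 : HasFDerivAt (fun y : E3 => ‖y - p‖ ^ 2) _ x :=
    ((hasFDerivAt_id x).sub_const p).norm_sq
  have h2 := h1.sqrt (pow_ne_zero 2 h0)
  simp only [Real.sqrt_sq (norm_nonneg _)] at h2
  refine h2.congr_fderiv ?_
  ext v
  simp
  field_simp

/-- The vector field `-(x - p) / ‖x - p‖ ^ 3`, the gradient of `1 / ‖x - p‖`. -/
def newtonField (p x : E3) : E3 := -(‖x - p‖ ^ 3)⁻¹ • (x - p)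

/-- The Newton kernel `1 / ‖x - p‖`. -/
def newton (p x : E3) : ℝ := ‖x - p‖⁻¹

theorem contDiffAt_norm_sub {p x : E3} (hx : x ≠ p) : ContDiffAt ℝ ∞ (fun y => ‖y - p‖) x :=
  (contDiffAt_norm ℝ (sub_ne_zero.2 hx)).comp x (contDiffAt_id.sub contDiffAt_const)

theorem contDiffAt_newton {p x : E3} (hx : x ≠ p) : ContDiffAt ℝ ∞ (newton p) x :=
  (contDiffAt_norm_sub hx).inv (norm_ne_zero_iff.2 (sub_ne_zero.2 hx))

theorem contDiffAt_newtonField {p x : E3} (hx : x ≠ p) : ContDiffAt ℝ ∞ (newtonField p) x :=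
  (((contDiffAt_norm_sub hx).pow 3).inv
    (pow_ne_zero 3 (norm_ne_zero_iff.2 (sub_ne_zero.2 hx)))).neg.smul
    (contDiffAt_id.sub contDiffAt_const)

theorem gradient_newton {p x : E3} (hx : x ≠ p) : gradient (newton p) x = newtonField p x := by
  have h0 : ‖x - p‖ ≠ 0 := norm_ne_zero_iff.2 (sub_ne_zero.2 hx)
  have h : HasFDerivAt (newton p) _ x :=
    (hasDerivAt_inv h0).comp_hasFDerivAt x (hasFDerivAt_norm_sub hx)
  refine ext_inner_right ℝ fun v => ?_
  rw [inner_gradient, h.fderiv]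
  simp only [newtonField, neg_smul, FunLike.coe_neg, FunLike.coe_smul, Pi.neg_apply, Pi.smul_apply,
    innerSL_apply_apply, smul_eq_mul, inner_neg_left, real_inner_smul_left]
  field_simp

theorem divergence_newtonField {p x : E3} (hx : x ≠ p) : divergence (newtonField p) x = 0 := by
  have h0 : ‖x - p‖ ≠ 0 := norm_ne_zero_iff.2 (sub_ne_zero.2 hx)
  have h1 : HasFDerivAt (fun y => -(‖y - p‖ ^ 3)⁻¹) _ x :=
    ((hasDerivAt_inv (pow_ne_zero 3 h0)).comp_hasFDerivAt x ((hasFDerivAt_norm_sub hx).pow 3)).neg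
  have h2 : ∀ i : Fin 3, HasFDerivAt (fun y : E3 => y i - p i)
      (EuclideanSpace.proj i : E3 →L[ℝ] ℝ) x :=
    fun i => ((EuclideanSpace.proj i : E3 →L[ℝ] ℝ).hasFDerivAt (x := x)).sub_const (p i)
  have h3 : ∀ i, fderiv ℝ (fun y => newtonField p y i) x (EuclideanSpace.single i 1) =
      3 * (‖x - p‖ ^ 5)⁻¹ * (x i - p i) ^ 2 - (‖x - p‖ ^ 3)⁻¹ := by
    intro i
    have h : HasFDerivAt (fun y => newtonField p y i) _ x := h1.mul (h2 i)
    rw [h.fderiv]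
    simp [EuclideanSpace.inner_single_right]
    field_simp
    ring
  have h4 : ‖x - p‖ ^ 2 = (x 0 - p 0) ^ 2 + (x 1 - p 1) ^ 2 + (x 2 - p 2) ^ 2 := by
    rw [EuclideanSpace.norm_sq_eq, Fin.sum_univ_three]
    simp
  simp only [divergence, h3, Fin.sum_univ_three]
  have h5 : 3 * (‖x - p‖ ^ 5)⁻¹ * ‖x - p‖ ^ 2 = 3 * (‖x - p‖ ^ 3)⁻¹ := by
    field_simp
  rw [h4] at h5
  linear_combination h5

theorem divergence_congr {X Y : E3 → E3} {x : E3} (h : X =ᶠ[𝓝 x] Y) :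
    divergence X x = divergence Y x := by
  refine Finset.sum_congr rfl fun i _ => ?_
  have : (fun y => X y i) =ᶠ[𝓝 x] fun y => Y y i := h.mono fun y hy => by simp only [hy]
  rw [this.fderiv_eq]

theorem gradient_newton_eventuallyEq {p x : E3} (hx : x ≠ p) :
    gradient (newton p) =ᶠ[𝓝 x] newtonField p := by
  filter_upwards [isOpen_compl_singleton.mem_nhds hx] with y hy using gradient_newton hy

theorem divergence_gradient_newton {p x : E3} (hx : x ≠ p) :
    divergence (gradient (newton p)) x = 0 := by
  rw [divergence_congr (gradient_newton_eventuallyEq hx), divergence_newtonField hx]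

/-- The closed 2-form of a point charge at `p`. -/
def monopole (p : E3) : DiffForm 2 := fluxForm (newtonField p)

theorem isClosedFormOn_monopole (p : E3) : IsClosedFormOn (monopole p) {p}ᶜ :=
  isClosedFormOn_fluxForm (fun _ hx => contDiffAt_newtonField hx)
    fun _ hx => divergence_newtonField hx

theorem norm_sub_sphere {p : E3} {s : ℝ} (hs : 0 ≤ s) (z : ℝ × ℝ) :
    ‖p + s • sphereMap z - p‖ = s := by
  simp [norm_smul, norm_sphereMap, abs_of_nonneg hs]

theorem sphere_ne_center {p : E3} {s : ℝ} (hs : 0 < s) (z : ℝ × ℝ) : p + s • sphereMap z ≠ p :=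
  fun h => by
    have := norm_sub_sphere (p := p) hs.le z
    rw [h, sub_self, norm_zero] at this
    exact hs.ne this

theorem sphereIntegral_fluxForm_eq_sphereAvg {X : E3 → E3} {p : E3} {s : ℝ} (hs : s ≠ 0)
    (h : ∀ z, ContinuousAt X (p + s • sphereMap z)) :
    sphereIntegral p s (fluxForm X) = s ^ 2 * sphereAvg (fun x => ⟪X x, s⁻¹ • (x - p)⟫_ℝ) p s := by
  rw [sphereIntegral_fluxForm h, sphereAvg]
  simp [smul_smul, inv_mul_cancel₀ hs]

theorem sphereIntegral_monopole_self {p : E3} {s : ℝ} (hs : 0 < s) :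
    sphereIntegral p s (monopole p) = -(4 * Real.pi) := by
  rw [monopole, sphereIntegral_fluxForm fun z =>
    (contDiffAt_newtonField (sphere_ne_center hs z)).continuousAt]
  have h : ∀ z : ℝ × ℝ, Real.sin z.1 * ⟪newtonField p (p + s • sphereMap z), sphereMap z⟫_ℝ =
      Real.sin z.1 * (-(s ^ 2)⁻¹) := fun z => by
    rw [newtonField, norm_sub_sphere hs.le, add_sub_cancel_left, inner_smul_left, inner_smul_left,
      real_inner_self_eq_norm_sq, norm_sphereMap]
    simp
    left
    field_simp
  simp only [h]
  have := sphereAvg_const (-(s ^ 2)⁻¹) p s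
  rw [sphereAvg] at this
  rw [this]
  field_simp

/-- The flux of a point charge through any sphere around it. -/
theorem sphereIntegral_monopole {p q : E3} {r : ℝ} (h : ‖p - q‖ < r) :
    sphereIntegral q r (monopole p) = -(4 * Real.pi) := by
  have hr : 0 < r := (norm_nonneg _).trans_lt h
  rw [← sphereIntegral_monopole_self (p := p) hr]
  -- The centre slides from `p` to `q` at constant radius; the charge stays strictly inside because
  -- its distance to the moving centre is at most |p - q| < r.
  have := sphereIntegral_eq_of_closed (η := monopole p) (q := p) (v := q - p) (r := r) (s := 0)
    fun t ht z => isClosedFormOn_monopole p _ fun hz => by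
      simp only [movingSphere, mul_zero, add_zero, mem_singleton_iff] at hz
      have h1 : r • sphereMap z = t • (p - q) := by
        have : p + t • (q - p) + r • sphereMap z - p = 0 := by rw [hz, sub_self]
        rw [← sub_eq_zero, ← this]; module
      have h2 := congrArg norm h1
      rw [norm_smul, norm_smul, norm_sphereMap, Real.norm_eq_abs, Real.norm_eq_abs,
        abs_of_pos hr, abs_of_nonneg ht.1] at h2
      nlinarith [norm_nonneg (p - q), ht.2]
  simpa using this

theorem sphere_mem_ball {p : E3} {s ρ : ℝ} (hs : 0 ≤ s) (hρ : s < ρ) (z : ℝ × ℝ) :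
    p + s • sphereMap z ∈ ball p ρ := by
  rw [mem_ball, dist_eq_norm, norm_sub_sphere hs]; exact hρ

theorem sphereIntegral_eq_zero_of_isClosedFormOn_ball {η : DiffForm 2} {q : E3} {r ρ : ℝ}
    (hη : IsClosedFormOn η (ball q ρ)) (hr : 0 ≤ r) (hrρ : r < ρ) : sphereIntegral q r η = 0 := by
  obtain ⟨α, hα⟩ := exists_extDeriv_eq_of_starConvex
    ((convex_ball q ρ).starConvex (mem_ball_self (hr.trans_lt hrρ))) hη
  exact sphereIntegral_extDeriv (fun z => (hα _ (sphere_mem_ball hr hrρ z)).1)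
    fun z => (hα _ (sphere_mem_ball hr hrρ z)).2

theorem IsClosedFormOn.sub {k : ℕ} {η ζ : DiffForm k} {S : Set E3} (hη : IsClosedFormOn η S)
    (hζ : IsClosedFormOn ζ S) : IsClosedFormOn (fun x => η x - ζ x) S := fun x hx =>
  ⟨(hη x hx).1.sub (hζ x hx).1, by
    rw [extDeriv_sub_of_contDiffAt (hη x hx).1 (hζ x hx).1, (hη x hx).2, (hζ x hx).2, sub_self]⟩

theorem IsClosedFormOn.const_smul {k : ℕ} {η : DiffForm k} {S : Set E3} (hη : IsClosedFormOn η S)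
    (a : ℝ) : IsClosedFormOn (fun x => a • η x) S := fun x hx =>
  ⟨(hη x hx).1.const_smul a, by
    change extDeriv (a • η) x = 0
    rw [extDeriv_smul, (hη x hx).2, smul_zero]⟩

theorem isClosedFormOn_sub_sum {ι : Type*} [DecidableEq ι] (T : Finset ι) (a : ι → ℝ)
    {ζ : ι → DiffForm 2} {S : Set E3} (hζ : ∀ i ∈ T, IsClosedFormOn (ζ i) S) :
    ∀ {η : DiffForm 2}, IsClosedFormOn η S →
      IsClosedFormOn (fun x => η x - ∑ i ∈ T, a i • ζ i x) S := by
  induction T using Finset.induction_on with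
  | empty => intro η hη; simpa using hη
  | insert i T hi ih =>
    intro η hη
    have := ih (fun j hj => hζ j (Finset.mem_insert_of_mem hj))
      (hη.sub ((hζ i (Finset.mem_insert_self i T)).const_smul (a i)))
    simpa only [Finset.sum_insert hi, sub_sub] using this

theorem sphereIntegral_sub_sum {ι : Type*} [DecidableEq ι] (T : Finset ι) (a : ι → ℝ)
    {ζ : ι → DiffForm 2} {q : E3} {r : ℝ}
    (hζ : ∀ i ∈ T, ∀ z, ContDiffAt ℝ ∞ (ζ i) (q + r • sphereMap z)) :
    ∀ {η : DiffForm 2}, (∀ z, ContDiffAt ℝ ∞ η (q + r • sphereMap z)) →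
      sphereIntegral q r (fun x => η x - ∑ i ∈ T, a i • ζ i x) =
        sphereIntegral q r η - ∑ i ∈ T, a i * sphereIntegral q r (ζ i) := by
  induction T using Finset.induction_on with
  | empty => intro η _; simp
  | insert i T hi ih =>
    intro η hη
    have hi' := fun z => (hζ i (Finset.mem_insert_self i T) z).const_smul (a i)
    have := ih (fun j hj => hζ j (Finset.mem_insert_of_mem hj)) (fun z => (hη z).sub (hi' z))
    simp only [Finset.sum_insert hi, ← sub_sub]
    rw [this, sphereIntegral_sub hη hi', sphereIntegral_smul]

/-- The residue theorem for closed 2-forms: the integral over a large sphere is the sum of the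
integrals over small spheres around the enclosed singularities. -/
theorem sphereIntegral_eq_sum_residues {Ω : Set E3} (hΩ : IsOpen Ω) {q : E3}
    (hq : StarConvex ℝ q Ω) (S : Finset E3) {η : DiffForm 2}
    (hη : IsClosedFormOn η (Ω \ S)) {κ : E3 → ℝ}
    (hκ : ∀ p ∈ S, ∀ᶠ r in 𝓝[>] (0 : ℝ), sphereIntegral p r η = κ p) {R : ℝ}
    (hR : ∀ z, q + R • sphereMap z ∈ Ω) (hSR : ∀ p ∈ S, ‖p - q‖ < R) :
    sphereIntegral q R η = ∑ p ∈ S, κ p := by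
  classical
  have hpi := Real.pi_pos
  -- A monopole has flux -4π, so these multiples cancel the residues. The remainder `ζ` is exact and
  -- integrates to zero over the large sphere.
  set a : E3 → ℝ := fun p => -(κ p / (4 * Real.pi)) with ha
  set ζ : DiffForm 2 := fun x => η x - ∑ p ∈ S, a p • monopole p x with hζ
  have hζc : IsClosedFormOn ζ (Ω \ S) := isClosedFormOn_sub_sum S a (fun p hp =>
    (isClosedFormOn_monopole p).mono fun x hx h => hx.2 (by
      rw [mem_singleton_iff.1 h]; exact hp)) hη
  have hfin : (S : Set E3).Finite := S.finite_toSet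
  have hdisc : IsDiscrete (S : Set E3) := hfin.isDiscrete
  have hper : ∀ p ∈ (S : Set E3) ∩ Ω, ∀ᶠ r in 𝓝[>] (0 : ℝ), sphereIntegral p r ζ = 0 := by
    rintro p ⟨hpS, hpΩ⟩
    obtain ⟨ρ, hρ, -⟩ := exists_disjoint_balls hΩ hdisc
    obtain ⟨hρ0, hρΩ, hρS⟩ := hρ p ⟨hpS, hpΩ⟩
    filter_upwards [hκ p hpS, Ioo_mem_nhdsGT hρ0] with r hr hr0
    have hmem : ∀ z, p + r • sphereMap z ∈ Ω \ S := fun z =>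
      ⟨hρΩ (sphere_mem_ball hr0.1.le hr0.2 z), fun h => sphere_ne_center hr0.1 z (by
        have : p + r • sphereMap z ∈ ball p (ρ p) ∩ S := ⟨sphere_mem_ball hr0.1.le hr0.2 z, h⟩
        rwa [hρS] at this)⟩
    rw [hζ, sphereIntegral_sub_sum S a (fun i hi z => (isClosedFormOn_monopole i _ fun h =>
      (hmem z).2 (by rw [mem_singleton_iff.1 h]; exact hi)).1) fun z => (hη _ (hmem z)).1, hr,
      Finset.sum_eq_single_of_mem p hpS, sphereIntegral_monopole_self hr0.1]
    · simp only [ha]; field_simp; ring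
    · intro i hi hip
      rw [sphereIntegral_eq_zero_of_isClosedFormOn_ball ((isClosedFormOn_monopole i).mono ?_)
        hr0.1.le hr0.2, mul_zero]
      rintro x hx rfl
      have : x ∈ ball p (ρ p) ∩ S := ⟨hx, hi⟩
      rw [hρS] at this
      exact hip this
  obtain ⟨α, hα⟩ := exists_primitive_of_sphereIntegral_eq_zero hΩ hq hfin.isClosed hdisc hζc hper
  have hmem : ∀ z, q + R • sphereMap z ∈ Ω \ S := fun z => ⟨hR z, fun h => by
    have h1 := hSR _ h
    have h2 := norm_sub_sphere (p := q) (s := R) ((norm_nonneg _).trans_lt h1).le z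
    linarith⟩
  have h0 : sphereIntegral q R ζ = 0 := sphereIntegral_extDeriv (fun z => (hα _ (hmem z)).1)
    fun z => (hα _ (hmem z)).2
  rw [hζ, sphereIntegral_sub_sum S a (fun i hi z => (isClosedFormOn_monopole i _ fun h =>
    (hmem z).2 (by rw [mem_singleton_iff.1 h]; exact hi)).1) fun z => (hη _ (hmem z)).1,
    sub_eq_zero] at h0
  rw [h0]
  refine Finset.sum_congr rfl fun p hp => ?_
  rw [sphereIntegral_monopole (hSR p hp)]
  simp only [ha]
  field_simp

end Newton

/-! ### Nonnegative functions near an isolated singularity -/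

section LocalAnalysis

open MeasureTheory Metric

theorem eq_of_hasDerivAt_zero_on_Ioo {f : ℝ → ℝ} {a b : ℝ}
    (hf : ∀ s ∈ Ioo a b, HasDerivAt f 0 s) {s t : ℝ} (hs : s ∈ Ioo a b) (ht : t ∈ Ioo a b) :
    f s = f t :=
  isOpen_Ioo.is_const_of_deriv_eq_zero isPreconnected_Ioo
    (fun s hs => (hf s hs).differentiableAt.differentiableWithinAt) (fun s hs => (hf s hs).deriv)
    hs ht

theorem sphere_mem_punctured_ball {p : E3} {s ρ : ℝ} (hs : s ∈ Ioo 0 ρ) (z : ℝ × ℝ) :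
    p + s • sphereMap z ∈ ball p ρ \ {p} :=
  ⟨sphere_mem_ball hs.1.le hs.2 z, sphere_ne_center hs.1 z⟩

/-- Spherical averages of a function whose gradient has constant flux `e`. -/
theorem exists_sphereAvg_eq {V : E3 → ℝ} {p : E3} {ρ e : ℝ}
    (hV : ∀ x ∈ ball p ρ \ {p}, ContDiffAt ℝ ∞ V x)
    (hflux : ∀ s ∈ Ioo 0 ρ, sphereIntegral p s (fluxForm (gradient V)) = e) :
    ∃ b, ∀ s ∈ Ioo 0 ρ, sphereAvg V p s = -e / s + b := by
  rcases le_or_gt ρ 0 with hρ | hρ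
  · exact ⟨0, fun s hs => absurd (hs.1.trans hs.2) hρ.not_gt⟩
  -- The mean has derivative e/s², which is also the derivative of -e/s.
  have hder : ∀ s ∈ Ioo 0 ρ, HasDerivAt (fun s => sphereAvg V p s + e * s⁻¹) 0 s := by
    intro s hs
    have h1 := hasDerivAt_sphereAvg hs.1.ne' fun z => hV _ (sphere_mem_punctured_ball hs z)
    rw [hflux s hs] at h1
    refine (h1.add ((hasDerivAt_inv hs.1.ne').const_mul e)).congr_deriv ?_
    have := hs.1.ne'
    field_simp
    ring
  refine ⟨sphereAvg V p (ρ / 2) + e * (ρ / 2)⁻¹, fun s hs => ?_⟩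
  have := eq_of_hasDerivAt_zero_on_Ioo hder hs (⟨half_pos hρ, half_lt_self hρ⟩ : ρ / 2 ∈ Ioo 0 ρ)
  rw [← this]
  ring

/-- The flux of a nonnegative function out of an isolated singularity is nonpositive. -/
theorem flux_nonpos {V : E3 → ℝ} {p : E3} {ρ e : ℝ} (hρ : 0 < ρ)
    (hV : ∀ x ∈ ball p ρ \ {p}, ContDiffAt ℝ ∞ V x) (hpos : ∀ x ∈ ball p ρ \ {p}, 0 ≤ V x)
    (hflux : ∀ s ∈ Ioo 0 ρ, sphereIntegral p s (fluxForm (gradient V)) = e) : e ≤ 0 := by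
  obtain ⟨b, hb⟩ := exists_sphereAvg_eq hV hflux
  by_contra he
  push Not at he
  -- If e > 0, a radius of at most e/(2(|b| + 1)) makes e/s exceed b, so the mean -e/s + b would be
  -- negative.
  have hs1 : 0 < min (ρ / 2) (e / (2 * (|b| + 1))) := by positivity
  set s := min (ρ / 2) (e / (2 * (|b| + 1)))
  have hs : s ∈ Ioo 0 ρ := ⟨hs1, (min_le_left _ _).trans_lt (half_lt_self hρ)⟩
  have h1 : 0 ≤ -e / s + b := by
    rw [← hb s hs]
    exact sphereAvg_nonneg fun z => hpos _ (sphere_mem_punctured_ball hs z)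
  have h2 : s * (2 * (|b| + 1)) ≤ e := by
    rw [← le_div_iff₀ (by positivity)]; exact min_le_right _ _
  have h3 : e / s ≤ b := by rw [neg_div] at h1; linarith
  rw [div_le_iff₀ hs1] at h3
  nlinarith [le_abs_self b, mul_nonneg (abs_nonneg b) hs1.le]

/-- For a nonnegative function `V` whose gradient has flux `e` out of an isolated singularity `p`,
and `u` smooth at `p`, the Green form `u dV - V du` has flux `u p * e`. -/
theorem greenFlux_eq {V u : E3 → ℝ} {p : E3} {ρ e κ L : ℝ} (hρ : 0 < ρ)
    (hV : ∀ x ∈ ball p ρ \ {p}, ContDiffAt ℝ ∞ V x) (hpos : ∀ x ∈ ball p ρ \ {p}, 0 ≤ V x)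
    (hu : ∀ x ∈ ball p ρ, ContDiffAt ℝ ∞ u x)
    (hL : ∀ x ∈ ball p ρ, ‖gradient u x‖ ≤ L) (hL' : ∀ x ∈ ball p ρ, |u x - u p| ≤ L * ‖x - p‖)
    (hflux : ∀ s ∈ Ioo 0 ρ, sphereIntegral p s (fluxForm (gradient V)) = e)
    (hκ : ∀ s ∈ Ioo 0 ρ, sphereIntegral p s
      (fluxForm fun x => u x • gradient V x - V x • gradient u x) = κ) : κ = u p * e := by
  obtain ⟨b, hb⟩ := exists_sphereAvg_eq hV hflux
  have hL0 : 0 ≤ L := (norm_nonneg _).trans (hL p (mem_ball_self hρ))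
  set C := |e| + |b| * ρ with hC
  have hC0 : 0 ≤ C := by positivity
  have hmem : ∀ {s}, s ∈ Ioo 0 ρ → ∀ z, p + s • sphereMap z ∈ ball p ρ \ {p} := fun hs z =>
    sphere_mem_punctured_ball hs z
  -- As V ≥ 0, its mean controls the mean of |V|: V is O(1/s) on average, which replaces a pointwise
  -- bound.
  have havg : ∀ s ∈ Ioo 0 ρ, sphereAvg V p s ≤ C / s := fun s hs => by
    rw [hb s hs, le_div_iff₀ hs.1, add_mul, div_mul_cancel₀ _ hs.1.ne', hC]
    have h1 := neg_abs_le e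
    have h2 : b * s ≤ |b| * ρ := (mul_le_mul_of_nonneg_right (le_abs_self b) hs.1.le).trans
      (mul_le_mul_of_nonneg_left hs.2.le (abs_nonneg b))
    linarith
  have hgV : ∀ {s}, s ∈ Ioo 0 ρ → ∀ z, ContDiffAt ℝ ∞ (gradient V) (p + s • sphereMap z) :=
    fun hs z => (hV _ (hmem hs z)).gradient
  have hgu : ∀ {s}, s ∈ Ioo 0 ρ → ∀ z, ContDiffAt ℝ ∞ (gradient u) (p + s • sphereMap z) :=
    fun hs z => (hu _ (hmem hs z).1).gradient
  -- The factor u - u(p) = O(s) keeps the mean of `f` bounded. Its gradient is (u∇V - V∇u) - u(p)∇V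
  -- + 2V∇u, of flux `lam + 2 * J s` with J = O(s). A nonzero `lam` would make the mean of `f` grow
  -- like 1/s.
  set f : E3 → ℝ := fun x => (u x - u p) * V x with hf
  have hfs : ∀ x ∈ ball p ρ \ {p}, ContDiffAt ℝ ∞ f x := fun x hx =>
    ((hu x hx.1).sub contDiffAt_const).mul (hV x hx)
  set J : ℝ → ℝ := fun s => sphereIntegral p s (fluxForm fun x => V x • gradient u x) with hJ
  have hJb : ∀ s ∈ Ioo 0 ρ, |J s| ≤ L * C * s := fun s hs => by
    have hs0 := hs.1
    simp only [hJ]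
    rw [sphereIntegral_fluxForm_eq_sphereAvg (X := fun x => V x • gradient u x) hs0.ne' fun z =>
      ((hV _ (hmem hs z)).smul (hgu hs z)).continuousAt, abs_mul, abs_of_nonneg (sq_nonneg s)]
    have h1 : |sphereAvg (fun x => ⟪V x • gradient u x, s⁻¹ • (x - p)⟫_ℝ) p s| ≤
        L * sphereAvg V p s := by
      refine abs_sphereAvg_le (fun z => (hV _ (hmem hs z)).continuousAt) fun z => ?_
      refine (abs_real_inner_le_norm _ _).trans ?_
      rw [norm_smul, norm_smul, norm_sub_sphere hs0.le, Real.norm_eq_abs, Real.norm_eq_abs,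
        abs_of_nonneg (hpos _ (hmem hs z)), abs_of_pos (inv_pos.2 hs0),
        inv_mul_cancel₀ hs0.ne', mul_one, mul_comm]
      exact mul_le_mul_of_nonneg_right (hL _ (hmem hs z).1) (hpos _ (hmem hs z))
    calc s ^ 2 * _ ≤ s ^ 2 * (L * (C / s)) := by
          refine mul_le_mul_of_nonneg_left (h1.trans ?_) (sq_nonneg s)
          exact mul_le_mul_of_nonneg_left (havg s hs) hL0
      _ = L * C * s := by field_simp
  have hN : ∀ s ∈ Ioo 0 ρ, |sphereAvg f p s| ≤ L * C := fun s hs => by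
    have h1 : |sphereAvg f p s| ≤ L * s * sphereAvg V p s := by
      refine abs_sphereAvg_le (fun z => (hV _ (hmem hs z)).continuousAt) fun z => ?_
      simp only [hf]
      rw [abs_mul, abs_of_nonneg (hpos _ (hmem hs z))]
      refine mul_le_mul_of_nonneg_right ?_ (hpos _ (hmem hs z))
      have := hL' _ (hmem hs z).1
      rwa [norm_sub_sphere hs.1.le] at this
    refine h1.trans ((mul_le_mul_of_nonneg_left (havg s hs) (mul_nonneg hL0 hs.1.le)).trans ?_)
    have := hs.1.ne'
    exact le_of_eq (by field_simp)
  set lam := κ - u p * e with hlam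
  have hfluxf : ∀ s ∈ Ioo 0 ρ, sphereIntegral p s (fluxForm (gradient f)) = lam + 2 * J s := by
    intro s hs
    have hW : ∀ z, ContDiffAt ℝ ∞ (fluxForm fun x => u x • gradient V x - V x • gradient u x)
        (p + s • sphereMap z) := fun z => (((hu _ (hmem hs z).1).smul (hgV hs z)).sub
      ((hV _ (hmem hs z)).smul (hgu hs z))).fluxForm
    have hX : ∀ z, ContDiffAt ℝ ∞ (fluxForm fun x => V x • gradient u x)
        (p + s • sphereMap z) := fun z => ((hV _ (hmem hs z)).smul (hgu hs z)).fluxForm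
    have h1 : sphereIntegral p s (fluxForm (gradient f)) = sphereIntegral p s (fun x =>
        ((fluxForm fun x => u x • gradient V x - V x • gradient u x) x -
          u p • fluxForm (gradient V) x) -
          (-2 : ℝ) • (fluxForm fun x => V x • gradient u x) x) := by
      refine sphereIntegral_congr fun z => ?_
      set x := p + s • sphereMap z
      have hx := hmem hs z
      have hg : gradient f x = (u x - u p) • gradient V x + V x • gradient u x := by
        refine ext_inner_right ℝ fun v => ?_
        have h2 : HasFDerivAt f _ x := ((((hu x hx.1).differentiableAt (by simp)).hasFDerivAt).sub_const
          (u p)).mul ((hV x hx).differentiableAt (by simp)).hasFDerivAt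
        rw [inner_gradient, h2.fderiv]
        simp [inner_add_left, inner_smul_left]
      simp only [fluxForm, hg, map_add, map_sub, map_smul]
      module
    rw [h1, sphereIntegral_sub (fun z => (hW z).sub ((hgV hs z).fluxForm.const_smul (u p)))
      (fun z => (hX z).const_smul (-2 : ℝ)), sphereIntegral_sub hW
      (fun z => (hgV hs z).fluxForm.const_smul (u p)), sphereIntegral_smul, sphereIntegral_smul,
      hκ s hs, hflux s hs]
    simp only [hJ, hlam]
    ring
  have hder : ∀ s ∈ Ioo 0 ρ, HasDerivAt (fun s => sphereAvg f p s + lam * s⁻¹)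
      (2 * J s / s ^ 2) s := fun s hs => by
    have h1 := hasDerivAt_sphereAvg hs.1.ne' fun z => hfs _ (hmem hs z)
    rw [hfluxf s hs] at h1
    refine (h1.add ((hasDerivAt_inv hs.1.ne').const_mul lam)).congr_deriv ?_
    have := hs.1.ne'
    field_simp
    ring
  -- The remaining derivative is only O(1/s), which is not integrable at 0; over [s, 2s], however,
  -- it contributes a bounded amount, while lam/s changes by lam/(2s).
  have hsmall : ∀ s ∈ Ioo 0 (ρ / 2), |lam| ≤ 8 * (L * C) * s := by
    intro s hs
    have hs0 := hs.1
    have hsub : ∀ t ∈ Icc s (2 * s), t ∈ Ioo 0 ρ := fun t ht =>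
      ⟨hs0.trans_le ht.1, by linarith [ht.2, hs.2]⟩
    have hmv := (convex_Icc s (2 * s)).norm_image_sub_le_of_norm_hasDerivWithin_le
      (C := 2 * (L * C) / s) (fun t ht => (hder t (hsub t ht)).hasDerivWithinAt) (fun t ht => by
        have ht0 := (hsub t ht).1
        rw [Real.norm_eq_abs, abs_div, abs_mul, abs_of_pos (by positivity : (0 : ℝ) < t ^ 2),
          abs_two, div_le_div_iff₀ (by positivity) hs0]
        have h1 := hJb t (hsub t ht)
        have h2 : 0 ≤ L * C := mul_nonneg hL0 hC0
        calc 2 * |J t| * s ≤ 2 * (L * C * t) * t := by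
              gcongr
              exact ht.1
          _ = 2 * (L * C) * t ^ 2 := by ring) (left_mem_Icc.2 (by linarith))
      (right_mem_Icc.2 (by linarith))
    have h1 := hN s (hsub s (left_mem_Icc.2 (by linarith)))
    have h2 := hN (2 * s) (hsub _ (right_mem_Icc.2 (by linarith)))
    rw [show 2 * s - s = s by ring, Real.norm_eq_abs, Real.norm_eq_abs, abs_of_pos hs0,
      div_mul_cancel₀ _ hs0.ne'] at hmv
    have h3 : |lam / (2 * s)| ≤ 4 * (L * C) := by
      have e1 : lam / (2 * s) = sphereAvg f p (2 * s) - sphereAvg f p s -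
          (sphereAvg f p (2 * s) + lam * (2 * s)⁻¹ - (sphereAvg f p s + lam * s⁻¹)) := by
        field_simp; ring
      rw [e1]
      rw [abs_le] at h1 h2 hmv ⊢
      constructor <;> linarith [h1.1, h1.2, h2.1, h2.2, hmv.1, hmv.2]
    rw [abs_div, abs_of_pos (by positivity : 0 < 2 * s), div_le_iff₀ (by positivity)] at h3
    linarith
  have hlim : Tendsto (fun s : ℝ => 8 * (L * C) * s) (𝓝[>] 0) (𝓝 0) := by
    have : Tendsto (fun s : ℝ => 8 * (L * C) * s) (𝓝 0) (𝓝 (8 * (L * C) * 0)) :=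
      (continuous_const.mul continuous_id).tendsto 0
    rw [mul_zero] at this
    exact this.mono_left nhdsWithin_le_nhds
  have h0 : |lam| ≤ 0 := ge_of_tendsto hlim (by
    filter_upwards [Ioo_mem_nhdsGT (half_pos hρ)] with s hs using hsmall s hs)
  have := abs_nonpos_iff.1 h0
  linarith

end LocalAnalysis

/-! ### Smoothness of a function from smoothness of its flux form -/

section Regularity

/-- The indices `i + 1` and `i + 2` are taken modulo 3, which gives the cyclic order of dy∧dz,
dz∧dx, dx∧dy. -/
theorem gradient_apply_eq_starD (V : E3 → ℝ) (x : E3) (i : Fin 3) :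
    gradient V x i = starD V x ![EuclideanSpace.single (i + 1) 1, EuclideanSpace.single (i + 2) 1] := by
  rw [starD_eq_fluxForm]
  change _ = volForm ![gradient V x, EuclideanSpace.single (i + 1) 1, EuclideanSpace.single (i + 2) 1]
  rw [volForm_apply]
  fin_cases i <;> simp

/-- A twice differentiable function whose flux form is smooth is smooth. -/
theorem contDiffAt_of_eqOn_starD {V : E3 → ℝ} {U : Set E3} (hU : IsOpen U)
    (hV : DifferentiableOn ℝ V U) {η : DiffForm 2} (hη : ∀ x ∈ U, ContDiffAt ℝ ∞ η x)
    (h : EqOn η (starD V) U) : ∀ x ∈ U, ContDiffAt ℝ ∞ V x := by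
  suffices ContDiffOn ℝ ∞ V U from fun x hx => this.contDiffAt (hU.mem_nhds hx)
  refine (contDiffOn_infty_iff_fderiv_of_isOpen hU).2 ⟨hV, ?_⟩
  have h1 : EqOn (fderiv ℝ V) (fun x => ∑ i : Fin 3,
      η x ![EuclideanSpace.single (i + 1) 1, EuclideanSpace.single (i + 2) 1] •
        (EuclideanSpace.proj i : E3 →L[ℝ] ℝ)) U := fun x hx => by
    ext v
    beta_reduce
    rw [← inner_gradient, h hx]
    simp only [← gradient_apply_eq_starD]
    rw [PiLp.inner_apply]
    simp [Fin.sum_univ_three, mul_comm]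
  refine ContDiffOn.congr (fun x hx => ContDiffAt.contDiffWithinAt ?_) h1
  exact ContDiffAt.sum fun i _ =>
    ((hη x hx).continuousAlternatingMap_apply_const _).smul contDiffAt_const

end Regularity

/-! ### Invariance of sphere integrals -/

section Periods

open Metric

/-- Cohomologous closed forms have the same integral over a sphere. -/
theorem sphereIntegral_eq_of_deRhamClass_eq {U : Set E3} {η ζ : closedForms 2 U}
    (h : deRhamClass η = deRhamClass ζ) {q : E3} {r : ℝ} (hU : ∀ z, q + r • sphereMap z ∈ U) :
    sphereIntegral q r (η : DiffForm 2) = sphereIntegral q r (ζ : DiffForm 2) := by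
  obtain ⟨α, hα⟩ := QuotientAddGroup.eq.1 h
  have h0 : sphereIntegral q r (fun x => (ζ : DiffForm 2) x - (η : DiffForm 2) x) = 0 :=
    sphereIntegral_extDeriv (fun z => (hα _ (hU z)).1) fun z => by
      rw [(hα _ (hU z)).2, sub_eq_neg_add]
      rfl
  rw [sphereIntegral_sub (fun z => (ζ.2 _ (hU z)).1) fun z => (η.2 _ (hU z)).1, sub_eq_zero] at h0
  exact h0.symm

theorem sphereIntegral_eq_of_isClosedFormOn_punctured_ball {η : DiffForm 2} {p : E3} {ρ : ℝ}
    (hη : IsClosedFormOn η (ball p ρ \ {p})) {s t : ℝ} (hs : s ∈ Ioo 0 ρ) (ht : t ∈ Ioo 0 ρ) :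
    sphereIntegral p t η = sphereIntegral p s η := by
  have := sphereIntegral_eq_of_closed (η := η) (q := p) (v := 0) (r := s) (s := t - s)
    fun τ hτ z => by
      have hm : s + τ * (t - s) ∈ Ioo 0 ρ := by
        have := (convex_Ioo 0 ρ).add_smul_sub_mem hs ht hτ
        simpa using this
      have := hη _ (sphere_mem_punctured_ball hm z)
      simpa [movingSphere] using this
  simpa using this

/-- Concentric spheres in the punctured ball are joined by a change of radius, so a value known for
small radii holds up to `ρ`. -/
theorem sphereIntegral_eq_of_eventually {η : DiffForm 2} {p : E3} {ρ a : ℝ}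
    (hη : IsClosedFormOn η (ball p ρ \ {p}))
    (h : ∀ᶠ r in 𝓝[>] (0 : ℝ), sphereIntegral p r η = a) : ∀ s ∈ Ioo 0 ρ, sphereIntegral p s η = a := by
  intro s hs
  obtain ⟨r, hr, hr0⟩ := (h.and (Ioo_mem_nhdsGT (hs.1.trans hs.2))).exists
  rw [sphereIntegral_eq_of_isClosedFormOn_punctured_ball hη hr0 hs, hr]

end Periods

/-! ### Green's identity and the mean value property -/

section Green

open Metric

theorem divergence_smul {f : E3 → ℝ} {X : E3 → E3} {x : E3} (hf : DifferentiableAt ℝ f x)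
    (hX : DifferentiableAt ℝ X x) :
    divergence (fun y => f y • X y) x = ⟪gradient f x, X x⟫_ℝ + f x * divergence X x := by
  have h : ∀ i : Fin 3, fderiv ℝ (fun y => (f y • X y) i) x (EuclideanSpace.single i 1) =
      gradient f x i * X x i + f x * fderiv ℝ (fun y => X y i) x (EuclideanSpace.single i 1) := by
    intro i
    have h1 : HasFDerivAt (fun y => (f y • X y) i) _ x := hf.hasFDerivAt.mul
      (((EuclideanSpace.proj i : E3 →L[ℝ] ℝ).differentiableAt.comp x hX).hasFDerivAt)
    rw [h1.fderiv, gradient_apply_eq]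
    simp only [FunLike.coe_add, FunLike.coe_smul, Pi.add_apply, Pi.smul_apply, smul_eq_mul]
    rw [add_comm, mul_comm]
    rfl
  simp only [divergence, h, PiLp.inner_apply, Finset.sum_add_distrib, Finset.mul_sum]
  simp [mul_comm]

theorem divergence_sub {X Y : E3 → E3} {x : E3} (hX : DifferentiableAt ℝ X x)
    (hY : DifferentiableAt ℝ Y x) :
    divergence (fun y => X y - Y y) x = divergence X x - divergence Y x := by
  simp only [divergence, ← Finset.sum_sub_distrib]
  refine Finset.sum_congr rfl fun i _ => ?_
  have h1 := ((EuclideanSpace.proj i : E3 →L[ℝ] ℝ).differentiableAt.comp x hX).hasFDerivAt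
  have h2 := ((EuclideanSpace.proj i : E3 →L[ℝ] ℝ).differentiableAt.comp x hY).hasFDerivAt
  have h3 : HasFDerivAt (fun y => (X y - Y y) i) _ x := h1.sub h2
  rw [h3.fderiv]
  rfl

/-- The vector field `u ∇V - V ∇u`. -/
def greenField (u V : E3 → ℝ) (x : E3) : E3 := u x • gradient V x - V x • gradient u x

/-- `f` is smooth at `x`, and its Laplacian vanishes there. -/
def SmoothHarmonicAt (f : E3 → ℝ) (x : E3) : Prop :=
  ContDiffAt ℝ ∞ f x ∧ divergence (gradient f) x = 0

theorem isClosedFormOn_gradient {V : E3 → ℝ} {S : Set E3} (h : ∀ x ∈ S, SmoothHarmonicAt V x) :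
    IsClosedFormOn (fluxForm (gradient V)) S :=
  isClosedFormOn_fluxForm (fun x hx => (h x hx).1.gradient) fun x hx => (h x hx).2

theorem isClosedFormOn_greenField {u V : E3 → ℝ} {S : Set E3}
    (hu : ∀ x ∈ S, SmoothHarmonicAt u x) (hV : ∀ x ∈ S, SmoothHarmonicAt V x) :
    IsClosedFormOn (fluxForm (greenField u V)) S := by
  refine isClosedFormOn_fluxForm (fun x hx => ((hu x hx).1.smul (hV x hx).1.gradient).sub
    ((hV x hx).1.smul (hu x hx).1.gradient)) fun x hx => ?_
  have d : ∀ {f : E3 → ℝ}, ContDiffAt ℝ ∞ f x → DifferentiableAt ℝ f x := fun h =>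
    h.differentiableAt (by simp)
  have dg : ∀ {f : E3 → ℝ}, ContDiffAt ℝ ∞ f x → DifferentiableAt ℝ (gradient f) x := fun h =>
    h.gradient.differentiableAt (by simp)
  obtain ⟨hu1, hu2⟩ := hu x hx
  obtain ⟨hV1, hV2⟩ := hV x hx
  change divergence (fun y => u y • gradient V y - V y • gradient u y) x = 0
  rw [divergence_sub (X := fun y => u y • gradient V y) (Y := fun y => V y • gradient u y) ((d hu1).smul (dg hV1)) ((d hV1).smul (dg hu1)),
    divergence_smul (d hu1) (dg hV1), divergence_smul (d hV1) (dg hu1), hu2, hV2,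
    real_inner_comm]
  ring

/-- Passing to half the radius gives a compact ball on which ∇u is bounded by some `L`; the mean
value inequality then supplies the Lipschitz bound, as `greenFlux_eq` requires. -/
theorem eventually_sphereIntegral_greenField {u V : E3 → ℝ} {p : E3} {ρ e : ℝ} (hρ : 0 < ρ)
    (hV : ∀ x ∈ ball p ρ \ {p}, SmoothHarmonicAt V x) (hpos : ∀ x ∈ ball p ρ \ {p}, 0 ≤ V x)
    (hu : ∀ x ∈ ball p ρ, SmoothHarmonicAt u x)
    (hflux : ∀ᶠ r in 𝓝[>] (0 : ℝ), sphereIntegral p r (fluxForm (gradient V)) = e) :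
    ∀ᶠ r in 𝓝[>] (0 : ℝ), sphereIntegral p r (fluxForm (greenField u V)) = u p * e := by
  have hcb : closedBall p (ρ / 2) ⊆ ball p ρ := closedBall_subset_ball (half_lt_self hρ)
  have hsub : ball p (ρ / 2) ⊆ ball p ρ := ball_subset_closedBall.trans hcb
  obtain ⟨L, hL⟩ := (isCompact_closedBall p (ρ / 2)).exists_bound_of_continuousOn
    (f := gradient u) fun x hx => (hu x (hcb hx)).1.gradient.continuousAt.continuousWithinAt
  have hW : IsClosedFormOn (fluxForm (greenField u V)) (ball p ρ \ {p}) :=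
    isClosedFormOn_greenField (fun x hx => hu x hx.1) hV
  have hmem : ρ / 4 ∈ Ioo 0 (ρ / 2) := ⟨by positivity, by linarith⟩
  have hmem' : ∀ s ∈ Ioo 0 (ρ / 2), s ∈ Ioo 0 ρ := fun s hs => ⟨hs.1, by linarith [hs.2]⟩
  have hκ : ∀ s ∈ Ioo 0 (ρ / 2), sphereIntegral p s (fluxForm (greenField u V)) =
      sphereIntegral p (ρ / 4) (fluxForm (greenField u V)) := fun s hs =>
    sphereIntegral_eq_of_isClosedFormOn_punctured_ball hW (hmem' _ hmem) (hmem' _ hs)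
  have key := greenFlux_eq (half_pos hρ) (fun x hx => (hV x ⟨hsub hx.1, hx.2⟩).1)
    (fun x hx => hpos x ⟨hsub hx.1, hx.2⟩) (fun x hx => (hu x (hsub hx)).1)
    (fun x hx => hL x (ball_subset_closedBall hx)) (fun x hx => by
      have := (convex_ball p (ρ / 2)).norm_image_sub_le_of_norm_fderiv_le (𝕜 := ℝ) (f := u) (C := L)
        (fun y hy => (hu y (hsub hy)).1.differentiableAt (by simp)) (fun y hy => by
          have := hL y (ball_subset_closedBall hy)
          rwa [gradient, LinearIsometryEquiv.norm_map] at this)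
        (mem_ball_self (half_pos hρ)) hx
      simpa using this)
    (fun s hs => sphereIntegral_eq_of_eventually (isClosedFormOn_gradient hV) hflux s (hmem' s hs))
    hκ
  filter_upwards [Ioo_mem_nhdsGT (half_pos hρ)] with s hs
  rw [hκ s hs, key]

theorem gradient_sub_const (f : E3 → ℝ) (c : ℝ) : gradient (fun x => f x - c) = gradient f := by
  funext x
  simp only [gradient, fderiv_sub_const]

theorem smoothHarmonicAt_newton {p x : E3} (hx : x ≠ p) (c : ℝ) :
    SmoothHarmonicAt (fun y => newton p y - c) x :=
  ⟨(contDiffAt_newton hx).sub contDiffAt_const, by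
    rw [gradient_sub_const, divergence_gradient_newton hx]⟩

/-- On the sphere, u is the constant 1/s - c and ∇u is the inward unit normal over s². With c = 1/s
only the mean of `V` remains, as on the large sphere; with zero flux of ∇V the same formula gives
the residue at `q`. -/
theorem sphereIntegral_greenField_newton {V : E3 → ℝ} {q : E3} {s : ℝ} (hs : 0 < s) (c : ℝ)
    (hV : ∀ z, ContDiffAt ℝ ∞ V (q + s • sphereMap z)) :
    sphereIntegral q s (fluxForm (greenField (fun x => newton q x - c) V)) =
      (s⁻¹ - c) * sphereIntegral q s (fluxForm (gradient V)) + sphereAvg V q s := by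
  have hne := fun z => sphere_ne_center (p := q) hs z
  have h1 : sphereIntegral q s (fluxForm (greenField (fun x => newton q x - c) V)) =
      sphereIntegral q s (fun x => (s⁻¹ - c) • fluxForm (gradient V) x -
        fluxForm (fun x => V x • newtonField q x) x) := sphereIntegral_congr fun z => by
    simp only [fluxForm, greenField, gradient_sub_const, gradient_newton (hne z), map_sub, map_smul]
    simp only [newton, norm_sub_sphere hs.le]
  have hVn : ∀ z, ContDiffAt ℝ ∞ (fun x => V x • newtonField q x) (q + s • sphereMap z) :=
    fun z => (hV z).smul (contDiffAt_newtonField (hne z))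
  rw [h1, sphereIntegral_sub (fun z => (hV z).gradient.fluxForm.const_smul _)
    fun z => (hVn z).fluxForm, sphereIntegral_smul,
    sphereIntegral_fluxForm_eq_sphereAvg (X := fun x => V x • newtonField q x) hs.ne'
      fun z => (hVn z).continuousAt]
  have h2 : sphereAvg (fun x => ⟪V x • newtonField q x, s⁻¹ • (x - q)⟫_ℝ) q s =
      -((s ^ 2)⁻¹ * sphereAvg V q s) := by
    simp only [sphereAvg]
    rw [← MeasureTheory.integral_const_mul, ← MeasureTheory.integral_neg]
    refine MeasureTheory.integral_congr_ae (.of_forall fun z => ?_)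
    simp only [newtonField, norm_sub_sphere hs.le, real_inner_smul_left, real_inner_smul_right,
      real_inner_self_eq_norm_sq]
    have := hs.ne'
    field_simp
  rw [h2]
  have := hs.ne'
  field_simp
  ring

/-- The mean value property. -/
theorem sphereAvg_eq_of_smoothHarmonicAt {V : E3 → ℝ} {q : E3} {ρ : ℝ}
    (hV : ∀ x ∈ ball q ρ, SmoothHarmonicAt V x) {s : ℝ} (hs : s ∈ Ioo 0 ρ) :
    sphereAvg V q s = 4 * Real.pi * V q := by
  have hρ := hs.1.trans hs.2
  obtain ⟨b, hb⟩ := exists_sphereAvg_eq (fun x hx => (hV x hx.1).1) fun s hs =>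
    sphereIntegral_eq_zero_of_isClosedFormOn_ball (isClosedFormOn_gradient hV) hs.1.le hs.2
  simp only [neg_zero, zero_div, zero_add] at hb
  rw [hb s hs, ← sphereAvg_zero]
  -- The mean is constant in the radius; its limit at radius 0 identifies the constant.
  have h1 : Tendsto (sphereAvg V q) (𝓝[>] 0) (𝓝 (sphereAvg V q 0)) :=
    (continuousAt_sphereAvg_zero (hV q (mem_ball_self hρ)).1).tendsto.mono_left
      nhdsWithin_le_nhds
  refine tendsto_nhds_unique (tendsto_const_nhds.congr' ?_) h1
  filter_upwards [Ioo_mem_nhdsGT hρ] with t ht using (hb t ht).symm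

end Green

/-! ### Necessity: the potential of the fluxes is bounded by the function -/

section Forward

open Metric

/-- Only finitely many distances from `q` to points of `A` are at most M + 1, so some radius in (M,
M + 1) has a margin free of them. The form is then closed near the sphere, with finitely many
singularities inside. -/
theorem exists_gap {A : Set E3} (hAc : IsClosed A) (hA : IsDiscrete A) (q : E3) (M : ℝ) :
    ∃ R R' : ℝ, M < R ∧ R < R' ∧ (A ∩ ball q R).Finite ∧ A ∩ ball q R' ⊆ ball q R := by
  have hfin : (A ∩ closedBall q (M + 1)).Finite :=
    ((isCompact_closedBall q (M + 1)).inter_left hAc).finite (hA.mono inter_subset_left)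
  set D := (fun x => dist x q) '' (A ∩ closedBall q (M + 1))
  have hD : D.Finite := hfin.image _
  obtain ⟨R, hR, hRD⟩ := ((Ioo_infinite (lt_add_one M)).sdiff hD).nonempty
  obtain ⟨ε, hε, hεs⟩ := Metric.isOpen_iff.1 (isOpen_Ioo.sdiff hD.isClosed) R ⟨hR, hRD⟩
  refine ⟨R, R + ε, hR.1, by linarith, hfin.subset (inter_subset_inter_right _
    (ball_subset_closedBall.trans (closedBall_subset_closedBall hR.2.le))), ?_⟩
  rintro x ⟨hxA, hx⟩
  by_contra hx'
  rw [mem_ball] at hx hx'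
  push Not at hx'
  have h1 : dist x q ∈ ball R ε := by
    rw [mem_ball, Real.dist_eq, abs_of_nonneg (by linarith)]; linarith
  have h2 := hεs h1
  exact h2.2 ⟨x, ⟨hxA, mem_closedBall.2 h2.1.2.le⟩, rfl⟩

/-- The fluxes out of the singularities of a nonnegative harmonic function are nonpositive, and the
potential they generate is controlled by the function. -/
theorem flux_sum_le {A : Set E3} (hAc : IsClosed A) (hA : IsDiscrete A) {V : E3 → ℝ}
    (hV : ∀ x ∈ Aᶜ, SmoothHarmonicAt V x) (hpos : ∀ x ∈ Aᶜ, 0 ≤ V x) {κ : E3 → ℝ}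
    (hκ : ∀ p ∈ A, ∀ᶠ r in 𝓝[>] (0 : ℝ), sphereIntegral p r (fluxForm (gradient V)) = κ p) :
    (∀ p ∈ A, κ p ≤ 0) ∧ ∀ q ∈ Aᶜ, ∀ T : Finset E3, (T : Set E3) ⊆ A →
      ∑ p ∈ T, |κ p| / ‖q - p‖ ≤ 4 * Real.pi * V q := by
  classical
  have hball : ∀ p ∈ A, ∃ ρ > 0, ball p ρ \ {p} ⊆ Aᶜ := fun p hp => by
    obtain ⟨ρ, hρ, -⟩ := exists_disjoint_balls isOpen_univ hA
    obtain ⟨h0, -, h1⟩ := hρ p ⟨hp, mem_univ p⟩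
    refine ⟨ρ p, h0, fun x hx hxA => hx.2 ?_⟩
    rw [← h1]; exact ⟨hx.1, hxA⟩
  have hκ0 : ∀ p ∈ A, κ p ≤ 0 := fun p hp => by
    obtain ⟨ρ, h0, hsub⟩ := hball p hp
    exact flux_nonpos h0 (fun x hx => (hV x (hsub hx)).1) (fun x hx => hpos x (hsub hx))
      (sphereIntegral_eq_of_eventually (isClosedFormOn_gradient fun x hx => hV x (hsub hx))
        (hκ p hp))
  refine ⟨hκ0, fun q hq T hT => ?_⟩
  -- Green's identity on the ball of radius `R` about `q`, with the function 1/|x - q| - 1/R that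
  -- vanishes on its boundary.
  have main : ∀ M, ∃ R > M, ∑ p ∈ T.filter (fun p => p ∈ ball q R), |κ p| * (‖q - p‖⁻¹ - R⁻¹) ≤
      4 * Real.pi * V q := by
    intro M
    obtain ⟨R, R', hMR, hRR, hfin, hgap⟩ := exists_gap hAc hA q (max M 0)
    have hR0 : 0 < R := (le_max_right M 0).trans_lt hMR
    refine ⟨R, (le_max_left M 0).trans_lt hMR, ?_⟩
    set u : E3 → ℝ := fun x => newton q x - R⁻¹ with hu
    set S := hfin.toFinset with hS
    have hSA : ∀ p ∈ S, p ∈ A ∧ p ∈ ball q R := fun p hp => by simpa [hS] using hp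
    have hqS : q ∉ S := fun h => hq (hSA q h).1
    have hset : ∀ x ∈ ball q R' \ (insert q S : Finset E3), x ∈ Aᶜ ∧ x ≠ q := by
      rintro x ⟨hx, hxS⟩
      simp only [Finset.coe_insert, mem_insert_iff, Finset.mem_coe, not_or, hS,
        Finite.mem_toFinset] at hxS
      exact ⟨fun hxA => hxS.2 ⟨hxA, hgap ⟨hxA, hx⟩⟩, hxS.1⟩
    have hW : IsClosedFormOn (fluxForm (greenField u V)) (ball q R' \ (insert q S : Finset E3)) :=
      isClosedFormOn_greenField (fun x hx => smoothHarmonicAt_newton (hset x hx).2 _)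
        fun x hx => hV x (hset x hx).1
    -- The residues: 4πV(q) at the pole of `u`, and u(p)κ(p) at the singularities of `V`.
    set κ' : E3 → ℝ := Function.update (fun p => u p * κ p) q (4 * Real.pi * V q) with hκ'
    have hres : ∀ p ∈ insert q S, ∀ᶠ r in 𝓝[>] (0 : ℝ),
        sphereIntegral p r (fluxForm (greenField u V)) = κ' p := by
      intro p hp
      rcases Finset.mem_insert.1 hp with rfl | hp
      · obtain ⟨ρ, hρ, hρA⟩ := Metric.isOpen_iff.1 hAc.isOpen_compl p hq
        filter_upwards [Ioo_mem_nhdsGT hρ] with s hs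
        have hVb : ∀ x ∈ ball p ρ, SmoothHarmonicAt V x := fun x hx => hV x (hρA hx)
        rw [hu, sphereIntegral_greenField_newton hs.1 _ fun z =>
          (hVb _ (sphere_mem_ball hs.1.le hs.2 z)).1,
          sphereIntegral_eq_zero_of_isClosedFormOn_ball (isClosedFormOn_gradient hVb) hs.1.le hs.2,
          sphereAvg_eq_of_smoothHarmonicAt hVb hs, hκ', Function.update_self]
        ring
      · have hpq : p ≠ q := fun h => hqS (h ▸ hp)
        obtain ⟨ρ, h0, hsub⟩ := hball p (hSA p hp).1
        have hd := norm_pos_iff.2 (sub_ne_zero.2 hpq)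
        rw [hκ', Function.update_of_ne hpq]
        -- The radius is also capped by the distance to `q`, so that `u` is harmonic on the whole
        -- ball about `p`.
        have hb : ball p (min ρ ‖p - q‖) ⊆ ball p ρ := ball_subset_ball (min_le_left _ _)
        refine eventually_sphereIntegral_greenField (lt_min h0 hd)
          (fun x hx => hV x (hsub ⟨hb hx.1, hx.2⟩)) (fun x hx => hpos x (hsub ⟨hb hx.1, hx.2⟩))
          (fun x hx => smoothHarmonicAt_newton ?_ _) (hκ p (hSA p hp).1)
        rintro rfl
        rw [mem_ball, dist_comm, dist_eq_norm] at hx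
        exact (hx.trans_le (min_le_right _ _)).false
    have hsphere : ∀ z, q + R • sphereMap z ∈ ball q R' := sphere_mem_ball hR0.le hRR
    have key := sphereIntegral_eq_sum_residues isOpen_ball
      ((convex_ball q R').starConvex (mem_ball_self (hR0.trans hRR))) (insert q S) hW hres hsphere
      (fun p hp => by
        rcases Finset.mem_insert.1 hp with rfl | hp
        · simpa using hR0
        · have := (hSA p hp).2
          rwa [mem_ball, dist_eq_norm] at this)
    have hsA : ∀ z, q + R • sphereMap z ∈ Aᶜ := fun z hz => by
      have := hgap ⟨hz, hsphere z⟩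
      rw [mem_ball, dist_eq_norm, norm_sub_sphere hR0.le] at this
      exact this.false
    rw [hu, sphereIntegral_greenField_newton hR0 _ fun z => (hV _ (hsA z)).1, sub_self, zero_mul,
      zero_add, Finset.sum_insert hqS, hκ', Function.update_self] at key
    have hsum : ∑ p ∈ S, Function.update (fun p => u p * κ p) q (4 * Real.pi * V q) p =
        -∑ p ∈ S, |κ p| * (‖q - p‖⁻¹ - R⁻¹) := by
      rw [← Finset.sum_neg_distrib]
      refine Finset.sum_congr rfl fun p hp => ?_
      have hpq : p ≠ q := fun h => hqS (h ▸ hp)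
      rw [Function.update_of_ne hpq, abs_of_nonpos (hκ0 p (hSA p hp).1)]
      simp only [hu, newton]
      rw [norm_sub_rev p q]
      ring
    rw [hsum] at key
    have h0 : 0 ≤ sphereAvg V q R := sphereAvg_nonneg fun z => hpos _ (hsA z)
    -- Every term is nonnegative because the points lie inside the ball of radius `R`, so dropping
    -- those outside `T` only decreases the sum.
    refine le_trans (Finset.sum_le_sum_of_subset_of_nonneg (t := S) ?_ ?_) (by linarith)
    · intro p hp
      rw [Finset.mem_filter] at hp
      simpa [hS] using ⟨hT hp.1, hp.2⟩
    · intro p hp _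
      have h1 := (hSA p hp).2
      rw [mem_ball, dist_eq_norm, norm_sub_rev] at h1
      refine mul_nonneg (abs_nonneg _) (sub_nonneg.2 (inv_anti₀ ?_ h1.le))
      exact norm_pos_iff.2 (sub_ne_zero.2 fun h => hqS (by rwa [h]))
  refine le_of_forall_pos_le_add fun ε hε => ?_
  have hK : 0 ≤ ∑ p ∈ T, |κ p| := Finset.sum_nonneg fun _ _ => abs_nonneg _
  -- Such an `R` makes the correction (∑|κ|)/R at most `ε`, and it exceeds every |q - p| with p in
  -- `T`, so the filter removes nothing.
  obtain ⟨R, hR, hRle⟩ := main ((∑ p ∈ T, |κ p|) / ε + ∑ p ∈ T, ‖q - p‖)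
  have hN : 0 ≤ ∑ p ∈ T, ‖q - p‖ := Finset.sum_nonneg fun _ _ => norm_nonneg _
  have hKε : 0 ≤ (∑ p ∈ T, |κ p|) / ε := by positivity
  have hR0 : 0 < R := by linarith
  rw [Finset.filter_true_of_mem fun p hp => by
    have := Finset.single_le_sum (f := fun p => ‖q - p‖) (fun _ _ => norm_nonneg _) hp
    rw [mem_ball, dist_eq_norm, norm_sub_rev]
    linarith] at hRle
  have h1 : (∑ p ∈ T, |κ p|) * R⁻¹ ≤ ε := by
    rw [← div_eq_mul_inv, div_le_iff₀ hR0, mul_comm, ← div_le_iff₀ hε]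
    linarith
  simp only [mul_sub, Finset.sum_sub_distrib, ← Finset.sum_mul] at hRle
  simp only [div_eq_mul_inv]
  linarith

end Forward

/-! ### Harmonicity of infinite sums of point potentials -/

section ParametricHarmonic

open MeasureTheory

variable {P : Type} [NormedAddCommGroup P] [NormedSpace ℝ P]

theorem fderiv_slice_apply {H : E3 × P → ℝ} {x : E3} {m : P} (hH : DifferentiableAt ℝ H (x, m))
    (v : E3) : fderiv ℝ (fun y => H (y, m)) x v = fderiv ℝ H (x, m) (v, 0) := by
  have h : HasFDerivAt (fun y : E3 => (y, m)) (ContinuousLinearMap.inl ℝ E3 P) x :=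
    (hasFDerivAt_id x).prodMk (hasFDerivAt_const m x)
  have h' : HasFDerivAt (fun y => H (y, m)) _ x := hH.hasFDerivAt.comp x h
  rw [h'.fderiv]
  simp

variable [MeasurableSpace P] [BorelSpace P]

theorem fderiv_setIntegral_apply {μ : Measure P} [IsFiniteMeasureOnCompacts μ] {K : Set P}
    (hK : IsCompact K) {H : E3 × P → ℝ} {x : E3} (hH : ∀ m ∈ K, ContDiffAt ℝ ∞ H (x, m)) (v : E3) :
    fderiv ℝ (fun x => ∫ m in K, H (x, m) ∂μ) x v = ∫ m in K, fderiv ℝ H (x, m) (v, 0) ∂μ := by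
  rw [(hasFDerivAt_setIntegral_of_contDiffAt hK fun m hm => (hH m hm).of_le (by simp)).fderiv,
    ContinuousLinearMap.integral_apply]
  · simp
  · refine ContinuousOn.integrableOn_compact hK fun m hm => ContinuousAt.continuousWithinAt ?_
    have h1 : ContinuousAt (fderiv ℝ H) (x, m) :=
      ((hH m hm).fderiv_right (m := 0) (by simp)).continuousAt
    exact (h1.comp (f := fun m => (x, m)) (by fun_prop)).clm_comp continuousAt_const

/-- An integral over a compact set of harmonic functions is harmonic. -/
theorem smoothHarmonicAt_setIntegral {μ : Measure P} [IsFiniteMeasureOnCompacts μ] {K : Set P}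
    (hK : IsCompact K) {H : E3 × P → ℝ} {x : E3} (hH : ∀ m ∈ K, ContDiffAt ℝ ∞ H (x, m))
    (hd : ∀ m ∈ K, divergence (gradient fun y => H (y, m)) x = 0) :
    SmoothHarmonicAt (fun x => ∫ m in K, H (x, m) ∂μ) x := by
  refine ⟨contDiffAt_setIntegral hK hH, ?_⟩
  have hev : ∀ᶠ y in 𝓝 x, ∀ m ∈ K, ContDiffAt ℝ 1 H (y, m) := by
    refine hK.eventually_forall_of_forall_eventually fun m hm => ?_
    exact ((hH m hm).of_le (by simp : (1 : WithTop ℕ∞) ≤ ∞)).eventually (by simp)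
  set D : Fin 3 → E3 × P → ℝ := fun i z => fderiv ℝ H z (EuclideanSpace.single i 1, 0)
  have hD : ∀ i, ∀ m ∈ K, ContDiffAt ℝ ∞ (D i) (x, m) := fun i m hm =>
    ((hH m hm).fderiv_right (m := ∞) (by simp)).clm_apply contDiffAt_const
  have h1 : ∀ i, (fun y => gradient (fun x => ∫ m in K, H (x, m) ∂μ) y i) =ᶠ[𝓝 x]
      fun y => ∫ m in K, D i (y, m) ∂μ := fun i => by
    filter_upwards [hev] with y hy
    rw [gradient_apply_eq, (hasFDerivAt_setIntegral_of_contDiffAt hK hy).fderiv,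
      ContinuousLinearMap.integral_apply]
    · simp [D]
    · refine ContinuousOn.integrableOn_compact hK fun m hm => ContinuousAt.continuousWithinAt ?_
      have h1 : ContinuousAt (fderiv ℝ H) (y, m) :=
        ((hy m hm).fderiv_right (m := 0) (by simp)).continuousAt
      exact (h1.comp (f := fun m => (y, m)) (by fun_prop)).clm_comp continuousAt_const
  have h2 : ∀ i, ∀ m ∈ K, (fun y => gradient (fun y => H (y, m)) y i) =ᶠ[𝓝 x]
      fun y => D i (y, m) := fun i m hm => by
    filter_upwards [hev] with y hy
    rw [gradient_apply_eq, fderiv_slice_apply ((hy m hm).differentiableAt (by simp))]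
  have h3 : divergence (gradient fun x => ∫ m in K, H (x, m) ∂μ) x =
      ∑ i, ∫ m in K, fderiv ℝ (D i) (x, m) (EuclideanSpace.single i 1, 0) ∂μ :=
    Finset.sum_congr rfl fun i _ => by
      rw [(h1 i).fderiv_eq, fderiv_setIntegral_apply hK (hD i)]
  rw [h3, ← integral_finsetSum]
  · refine setIntegral_eq_zero_of_forall_eq_zero fun m hm => ?_
    rw [← hd m hm]
    refine Finset.sum_congr rfl fun i _ => ?_
    rw [(h2 i m hm).fderiv_eq, fderiv_slice_apply ((hD i m hm).differentiableAt (by simp))]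
  · intro i _
    refine ContinuousOn.integrableOn_compact hK fun m hm => ContinuousAt.continuousWithinAt ?_
    have h1 : ContinuousAt (fderiv ℝ (D i)) (x, m) :=
      ((hD i m hm).fderiv_right (m := 0) (by simp)).continuousAt
    exact (h1.comp (f := fun m => (x, m)) (by fun_prop)).clm_apply continuousAt_const

theorem divergence_gradient_const_smul {f : E3 → ℝ} {x : E3} (hf : ContDiffAt ℝ ∞ f x) (a : ℝ) :
    divergence (gradient fun y => a * f y) x = a * divergence (gradient f) x := by
  have h : (gradient fun y => a * f y) =ᶠ[𝓝 x] fun y => a • gradient f y := by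
    filter_upwards [(hf.of_le (by simp : (1 : WithTop ℕ∞) ≤ ∞)).eventually (by simp)] with y hy
    have hd : DifferentiableAt ℝ f y := hy.differentiableAt (by simp)
    refine ext_inner_right ℝ fun v => ?_
    rw [inner_gradient, real_inner_smul_left, inner_gradient, fderiv_const_mul hd]
    rfl
  rw [divergence_congr h, divergence_smul (f := fun _ => a) (differentiableAt_const a)
    (hf.gradient.differentiableAt (by simp))]
  simp [gradient]

/-- The potential of point charges at positive distance is harmonic. -/
theorem smoothHarmonicAt_tsum_newton {β : Type*} [Countable β] {a : β → E3} {w : β → ℝ} {x₀ : E3}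
    {ρ : ℝ} (hρ : 0 < ρ) (ha : ∀ b, ρ ≤ ‖x₀ - a b‖) (hw : ∀ b, 0 ≤ w b)
    (hs : Summable fun b => w b / ‖x₀ - a b‖) :
    SmoothHarmonicAt (fun x => ∑' b, w b * newton (a b) x) x₀ := by
  have hd : ∀ b, 0 < ‖x₀ - a b‖ := fun b => hρ.trans_le (ha b)
  -- With τ = 1/|x₀ - a| and v the unit vector along x₀ - a, one has 1/|x - a| = τ/|τ(x - x₀) + v|.
  -- Far charges correspond to τ near 0, so the parameters fill a compact set. The factor τ goes
  -- into the weights, whose total mass is the convergent series at x₀.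
  set pt : β → ℝ × E3 := fun b => (‖x₀ - a b‖⁻¹, ‖x₀ - a b‖⁻¹ • (x₀ - a b)) with hpt
  set wt : β → ENNReal := fun b => ENNReal.ofReal (w b / ‖x₀ - a b‖) with hwt
  set μ : Measure (ℝ × E3) := Measure.sum fun b => wt b • Measure.dirac (pt b) with hμ
  have : IsFiniteMeasure μ := ⟨by
    rw [hμ, Measure.sum_apply _ MeasurableSet.univ]
    simpa [hwt] using hs.tsum_ofReal_lt_top⟩
  set K : Set (ℝ × E3) := Icc 0 ρ⁻¹ ×ˢ Metric.sphere 0 1 with hK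
  have hKc : IsCompact K := isCompact_Icc.prod (isCompact_sphere 0 1)
  have hpK : ∀ b, pt b ∈ K := fun b => by
    refine ⟨⟨(inv_pos.2 (hd b)).le, inv_anti₀ hρ (ha b)⟩, ?_⟩
    rw [mem_sphere_zero_iff_norm, hpt, norm_smul, norm_inv, norm_norm, inv_mul_cancel₀ (hd b).ne']
  have hμK : μ.restrict K = μ := Measure.restrict_eq_self_of_ae_mem <| by
    rw [hμ, Measure.ae_sum_iff]
    exact fun b => Measure.ae_smul_measure
      ((ae_dirac_iff (p := (· ∈ K)) hKc.measurableSet).2 (hpK b)) _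
  set H : E3 × (ℝ × E3) → ℝ := fun z => ‖z.2.1 • (z.1 - x₀) + z.2.2‖⁻¹ with hH
  have hF : (fun x => ∑' b, w b * newton (a b) x) = fun x => ∫ m in K, H (x, m) ∂μ := by
    funext x
    rw [hμK, hμ, integral_sum_dirac fun b => ENNReal.ofReal_ne_top]
    refine tsum_congr fun b => ?_
    have hb := (hd b).ne'
    rw [ENNReal.toReal_ofReal (div_nonneg (hw b) (norm_nonneg _)), newton]
    have : ‖x₀ - a b‖⁻¹ • (x - x₀) + ‖x₀ - a b‖⁻¹ • (x₀ - a b) = ‖x₀ - a b‖⁻¹ • (x - a b) := by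
      rw [← smul_add, sub_add_sub_cancel]
    simp only [hH, hpt, this, norm_smul, norm_inv, norm_norm, smul_eq_mul, mul_inv, inv_inv]
    field_simp
  rw [hF]
  refine smoothHarmonicAt_setIntegral hKc (fun m hm => ?_) fun m hm => ?_
  · have h1 : ‖m.2‖ = 1 := mem_sphere_zero_iff_norm.1 hm.2
    have h2 : m.1 • (x₀ - x₀) + m.2 ≠ 0 := by
      rw [sub_self, smul_zero, zero_add, ← norm_ne_zero_iff, h1]; exact one_ne_zero
    have h3 : ContDiff ℝ ∞ fun z : E3 × (ℝ × E3) => z.2.1 • (z.1 - x₀) + z.2.2 :=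
      (contDiff_snd.fst.smul (contDiff_fst.sub contDiff_const)).add contDiff_snd.snd
    have h4 : ContDiffAt ℝ ∞ (fun z : E3 × (ℝ × E3) => ‖z.2.1 • (z.1 - x₀) + z.2.2‖) (x₀, m) :=
      ContDiffAt.norm ℝ h3.contDiffAt h2
    exact h4.inv (norm_ne_zero_iff.2 h2)
  · obtain ⟨τ, v⟩ := m
    have hv : ‖v‖ = 1 := mem_sphere_zero_iff_norm.1 hm.2
    rcases hm.1.1.eq_or_lt with h | h
    -- At τ = 0 the kernel is constant in `x`; for τ > 0 it is a multiple of a Newton kernel.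
    · simp only at h
      subst h
      simp [hH, gradient, divergence]
    · simp only at h
      have hne : x₀ ≠ x₀ - τ⁻¹ • v := fun h' => by
        have := norm_eq_zero.2 (sub_eq_zero.2 h')
        rw [sub_sub_cancel, norm_smul, hv, mul_one, norm_inv, inv_eq_zero, norm_eq_zero] at this
        exact h.ne' this
      have hHe : (fun y => H (y, (τ, v))) = fun y => τ⁻¹ * newton (x₀ - τ⁻¹ • v) y := by
        funext y
        have : τ • (y - x₀) + v = τ • (y - (x₀ - τ⁻¹ • v)) := by
          rw [sub_sub_eq_add_sub, add_sub_right_comm, smul_add, smul_smul, mul_inv_cancel₀ h.ne',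
            one_smul]
        simp only [hH, this, norm_smul, mul_inv, newton, Real.norm_eq_abs, abs_of_pos h]
      rw [hHe, divergence_gradient_const_smul (contDiffAt_newton hne), divergence_gradient_newton hne,
        mul_zero]

end ParametricHarmonic

/-! ### Sufficiency: convergence and flux of the potential -/

section Backward

open Metric

/-- By the triangle inequality |x₁ - a|/|x₀ - a| ≤ 1 + |x₁ - x₀|/ρ uniformly in `a`, so convergence
passes from one point to another. -/
theorem summable_div_norm_sub {β : Type*} {a : β → E3} {w : β → ℝ} (hw : ∀ b, 0 ≤ w b)
    {x₁ x₀ : E3} (h₁ : ∀ b, x₁ ≠ a b) (hs : Summable fun b => w b / ‖x₁ - a b‖) {ρ : ℝ} (hρ : 0 < ρ)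
    (ha : ∀ b, ρ ≤ ‖x₀ - a b‖) : Summable fun b => w b / ‖x₀ - a b‖ := by
  refine (hs.mul_left (‖x₁ - x₀‖ / ρ + 1)).of_nonneg_of_le
    (fun b => div_nonneg (hw b) (norm_nonneg _)) fun b => ?_
  have h0 : 0 < ‖x₀ - a b‖ := hρ.trans_le (ha b)
  have h1 : 0 < ‖x₁ - a b‖ := norm_pos_iff.2 (sub_ne_zero.2 (h₁ b))
  have h2 : ‖x₁ - a b‖ ≤ (‖x₁ - x₀‖ / ρ + 1) * ‖x₀ - a b‖ := by
    have h3 : ‖x₁ - x₀‖ ≤ ‖x₁ - x₀‖ / ρ * ‖x₀ - a b‖ := by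
      rw [div_mul_eq_mul_div, le_div_iff₀ hρ]
      exact mul_le_mul_of_nonneg_left (ha b) (norm_nonneg _)
    linarith [norm_sub_le_norm_sub_add_norm_sub x₁ x₀ (a b)]
  rw [← mul_div_assoc, div_le_div_iff₀ h0 h1]
  nlinarith [mul_le_mul_of_nonneg_left h2 (hw b)]

theorem exists_le_norm_sub {A : Set E3} (hA : IsClosed A) {x : E3} (hx : x ∉ A) :
    ∃ ρ > 0, ∀ p ∈ A, ρ ≤ ‖x - p‖ := by
  obtain ⟨ρ, hρ, h⟩ := Metric.isOpen_iff.1 hA.isOpen_compl x hx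
  refine ⟨ρ, hρ, fun p hp => ?_⟩
  by_contra hlt
  push Not at hlt
  exact h (by rwa [mem_ball, dist_comm, dist_eq_norm] : p ∈ ball x ρ) hp

/-- The flux of the potential of point charges. -/
theorem eventually_sphereIntegral_tsum_newton {ι : Type*} [Countable ι] {p : ι → E3}
    (hp : Function.Injective p) (hclosed : IsClosed (range p)) (hdiscrete : IsDiscrete (range p))
    {w : ι → ℝ} (hw : ∀ j, 0 ≤ w j)
    (hs : ∀ x ∈ (range p)ᶜ, Summable fun j => w j / ‖x - p j‖) (j : ι) :
    ∀ᶠ r in 𝓝[>] (0 : ℝ), sphereIntegral (p j) r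
      (fluxForm (gradient fun x => ∑' i, w i * newton (p i) x)) = -(4 * Real.pi * w j) := by
  obtain ⟨ρ, hρ, -⟩ := exists_disjoint_balls isOpen_univ hdiscrete
  obtain ⟨h0, -, hball⟩ := hρ (p j) ⟨mem_range_self j, mem_univ _⟩
  -- The potential of all other charges is harmonic at `p j` too and contributes no flux; only the
  -- monopole at `p j` remains.
  set G : E3 → ℝ := fun x => ∑' i : ({j}ᶜ : Set ι), w i * newton (p i) x with hG
  have hU : ∀ x ∈ ball (p j) (ρ (p j)) \ {p j}, x ∈ (range p)ᶜ := fun x hx hxA => hx.2 (by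
    rw [← hball]; exact ⟨hx.1, hxA⟩)
  have hsub : ∀ x ∈ ball (p j) (ρ (p j)), x ∉ p '' {j}ᶜ := by
    rintro x hx ⟨i, hi, rfl⟩
    have : p i ∈ ball (p j) (ρ (p j)) ∩ range p := ⟨hx, mem_range_self i⟩
    rw [hball] at this
    exact hi (hp this)
  have hcl : IsClosed (p '' {j}ᶜ) := by
    have : p '' {j}ᶜ = range p \ ball (p j) (ρ (p j)) := by
      ext x
      constructor
      · rintro ⟨i, hi, rfl⟩
        exact ⟨mem_range_self i, fun h => hsub _ h ⟨i, hi, rfl⟩⟩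
      · rintro ⟨⟨i, rfl⟩, hx⟩
        exact ⟨i, fun h => hx (by rw [mem_singleton_iff.1 h]; exact mem_ball_self h0), rfl⟩
    rw [this]
    exact hclosed.sdiff isOpen_ball
  have hGh : ∀ x ∈ ball (p j) (ρ (p j)), SmoothHarmonicAt G x := fun x hx => by
    obtain ⟨δ, hδ, hδp⟩ := exists_le_norm_sub hcl (hsub x hx)
    have hδ' : ∀ i : ({j}ᶜ : Set ι), δ ≤ ‖x - p i‖ := fun i => hδp _ ⟨i, i.2, rfl⟩
    -- Convergence is only assumed off the charges, while `x` may be `p j` itself; it is imported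
    -- from a nearby point of the punctured ball.
    obtain ⟨x₁, hx₁⟩ : ∃ x₁, x₁ ∈ (range p)ᶜ :=
      ⟨_, hU _ (sphere_mem_punctured_ball ⟨half_pos h0, half_lt_self h0⟩ (0, 0))⟩
    exact smoothHarmonicAt_tsum_newton hδ hδ' (fun i => hw i)
      (summable_div_norm_sub (fun i : ({j}ᶜ : Set ι) => hw i)
        (fun i h => hx₁ ⟨i, h.symm⟩) ((hs x₁ hx₁).subtype _) hδ hδ')
  have hV : ∀ x ∈ ball (p j) (ρ (p j)) \ {p j},
      ∑' i, w i * newton (p i) x = w j * newton (p j) x + G x := fun x hx => by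
    have hsx : Summable fun i => w i * newton (p i) x := hs x (hU x hx)
    have := hsx.tsum_subtype_add_tsum_subtype_compl {j}
    rw [← this, tsum_singleton j fun i => w i * newton (p i) x]
  have hopen : IsOpen (ball (p j) (ρ (p j)) \ {p j}) := isOpen_ball.sdiff isClosed_singleton
  filter_upwards [Ioo_mem_nhdsGT h0] with s hs
  have hm := sphere_mem_punctured_ball (p := p j) hs
  have h1 : sphereIntegral (p j) s (fluxForm (gradient fun x => ∑' i, w i * newton (p i) x)) =
      sphereIntegral (p j) s (fun x => fluxForm (gradient G) x - (-w j) • monopole (p j) x) := by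
    refine sphereIntegral_congr fun z => ?_
    set x := p j + s • sphereMap z
    have hx : x ∈ ball (p j) (ρ (p j)) \ {p j} := hm z
    have hg : gradient (fun x => ∑' i, w i * newton (p i) x) x =
        gradient G x + w j • newtonField (p j) x := by
      have he : (fun x => ∑' i, w i * newton (p i) x) =ᶠ[𝓝 x]
          fun x => w j * newton (p j) x + G x := by
        filter_upwards [hopen.mem_nhds hx] with y hy using hV y hy
      have hd := ((((contDiffAt_newton hx.2).differentiableAt (by simp)).hasFDerivAt.const_mul
        (w j)).add ((hGh x hx.1).1.differentiableAt (by simp)).hasFDerivAt).congr_of_eventuallyEq he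
      refine ext_inner_right ℝ fun v => ?_
      rw [inner_gradient, hd.fderiv, inner_add_left, real_inner_smul_left, inner_gradient,
        ← gradient_newton hx.2, inner_gradient, add_comm]
      rfl
    simp only [fluxForm, monopole, hg, map_add, map_smul]
    module
  rw [h1, sphereIntegral_sub (fun z => (hGh _ (hm z).1).1.gradient.fluxForm)
    (fun z => (isClosedFormOn_monopole _ _ (hm z).2).1.const_smul _), sphereIntegral_smul,
    sphereIntegral_monopole_self hs.1,
    sphereIntegral_eq_zero_of_isClosedFormOn_ball (isClosedFormOn_gradient hGh) hs.1.le hs.2]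
  ring

end Backward

/-! ### Harmonic functions and classes in terms of smooth forms -/

section Characterization

open Metric

theorem SmoothHarmonicAt.harmonicOnNhd {V : E3 → ℝ} {U : Set E3} (hU : IsOpen U)
    (hV : ∀ x ∈ U, SmoothHarmonicAt V x) : HarmonicOnNhd V U := fun x hx =>
  ⟨(hV x hx).1.of_le (le_minSmoothness.trans two_le_smooth), by
    filter_upwards [hU.mem_nhds hx] with y hy
    rw [laplacian_eq_divergence_gradient ((hV y hy).1.of_le (le_minSmoothness.trans two_le_smooth)), (hV y hy).2]
    rfl⟩

/-- Harmonicity as given provides two derivatives only. Smoothness is read off from the smooth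
representative that agrees with ⋆dV, without elliptic regularity. -/
theorem smoothHarmonicAt_of_starDRepresents {V : E3 → ℝ} {U : Set E3} (hU : IsOpen U)
    {c : DeRhamH2 U} (hV : HarmonicOnNhd V U) (h : StarDRepresents V c) :
    ∀ x ∈ U, SmoothHarmonicAt V x := by
  obtain ⟨η, hη, -⟩ := h
  have hs := contDiffAt_of_eqOn_starD hU
    (fun x hx => ((hV x hx).1.differentiableAt (by simp)).differentiableWithinAt)
    (fun x hx => (η.2 x hx).1) hη
  refine fun x hx => ⟨hs x hx, ?_⟩
  rw [← laplacian_eq_divergence_gradient (hV x hx).1, (hV x hx).2.self_of_nhds]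
  rfl

/-- The definition provides a single representative with the prescribed integrals. Small spheres
avoid `A`, so Stokes carries the value over to every representative. -/
theorem HasSphereValue.eventually_eq {A : Set E3} (hA : IsDiscrete A) {c : DeRhamH2 Aᶜ} {q : E3}
    (hq : q ∈ A) {a : ℝ} (h : HasSphereValue c q a) (η : closedForms 2 Aᶜ)
    (hη : deRhamClass η = c) :
    ∀ᶠ r in 𝓝[>] (0 : ℝ), sphereIntegral q r (η : DiffForm 2) = a := by
  obtain ⟨ζ, hζ, hr⟩ := h
  obtain ⟨ρ, hρ, -⟩ := exists_disjoint_balls isOpen_univ hA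
  obtain ⟨h0, -, hball⟩ := hρ q ⟨hq, mem_univ _⟩
  filter_upwards [hr, Ioo_mem_nhdsGT h0] with r hr hr0
  rw [sphereIntegral_eq_of_deRhamClass_eq (hη.trans hζ.symm), hr]
  intro z hz
  have hm := sphere_mem_punctured_ball (p := q) hr0 z
  exact hm.2 (by rw [← hball]; exact ⟨hm.1, hz⟩)

end Characterization

/-! ### The two implications -/

theorem deRhamClass_eq_of_isPrimitiveOn {U : Set E3} {η ζ : closedForms 2 U} {α : DiffForm 1}
    (h : IsPrimitiveOn α (fun x => (ζ : DiffForm 2) x - (η : DiffForm 2) x) U) :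
    deRhamClass η = deRhamClass ζ :=
  QuotientAddGroup.eq.2 ⟨α, fun x hx => ⟨(h x hx).1, (h x hx).2.trans (sub_eq_neg_add _ _)⟩⟩

theorem deRhamClass_eq_of_eqOn {U : Set E3} {η ζ : closedForms 2 U}
    (h : EqOn (η : DiffForm 2) (ζ : DiffForm 2) U) : deRhamClass η = deRhamClass ζ :=
  deRhamClass_eq_of_isPrimitiveOn (α := 0) fun x hx => ⟨contDiffAt_const, by
    beta_reduce
    rw [h hx, sub_self]
    simpa using extDeriv_smul (x := x) (0 : ℝ) (0 : DiffForm 1)⟩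

theorem StarDRepresents.deRhamClass_eq {U : Set E3} {V : E3 → ℝ} {c : DeRhamH2 U}
    (h : StarDRepresents V c) (hcl : starD V ∈ closedForms 2 U) :
    deRhamClass ⟨starD V, hcl⟩ = c := by
  obtain ⟨η, hη, rfl⟩ := h
  exact deRhamClass_eq_of_eqOn hη.symm

theorem summable_of_starDRepresents {ι : Type*} [Countable ι] {p : ι → E3}
    (hp : Function.Injective p) (hclosed : IsClosed (range p)) (hdiscrete : IsDiscrete (range p))
    {c : DeRhamH2 (range p)ᶜ} {e : ι → ℤ} (hce : IsIntegralClass p c e) {V : E3 → ℝ}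
    (hV : HarmonicOnNhd V (range p)ᶜ) (hpos : ∀ x ∈ (range p)ᶜ, 0 ≤ V x)
    (hc : StarDRepresents V c) :
    (∀ j, e j ≤ 0) ∧ ∀ x ∈ (range p)ᶜ, Summable fun j => |(e j : ℝ)| / ‖x - p j‖ := by
  have hVs := smoothHarmonicAt_of_starDRepresents hclosed.isOpen_compl hV hc
  have hcl : starD V ∈ closedForms 2 (range p)ᶜ := isClosedFormOn_gradient hVs
  have hVc := hc.deRhamClass_eq hcl
  -- `flux_sum_le` indexes fluxes by points, so `e` is transported along the injection `p`; the
  -- values off its range play no role.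
  obtain ⟨κ, hκp⟩ : ∃ κ : E3 → ℝ, ∀ j, κ (p j) = e j :=
    ⟨Function.extend p (fun j => (e j : ℝ)) 0, fun j => hp.extend_apply _ _ j⟩
  have hflux : ∀ q ∈ range p, ∀ᶠ r in 𝓝[>] (0 : ℝ), sphereIntegral q r (starD V) = κ q := by
    rintro _ ⟨j, rfl⟩
    rw [hκp]
    exact (hce j).eventually_eq hdiscrete (mem_range_self j) ⟨starD V, hcl⟩ hVc
  obtain ⟨h1, h2⟩ := flux_sum_le hclosed hdiscrete hVs hpos hflux
  refine ⟨fun j => ?_, fun x hx => ?_⟩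
  · have := h1 _ (mem_range_self j)
    rw [hκp] at this
    exact_mod_cast this
  refine summable_of_sum_le (c := 4 * Real.pi * V x)
    (fun j => div_nonneg (abs_nonneg _) (norm_nonneg _)) fun T => ?_
  have hT : (T.map ⟨p, hp⟩ : Set E3) ⊆ range p := by
    rw [Finset.coe_map]
    exact image_subset_range _ _
  have := h2 x hx _ hT
  rw [Finset.sum_map] at this
  refine le_of_eq_of_le (Finset.sum_congr rfl fun j _ => ?_) this
  rw [Function.Embedding.coeFn_mk, hκp]

theorem exists_harmonic_of_summable {ι : Type*} [Countable ι] {p : ι → E3}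
    (hp : Function.Injective p) (hclosed : IsClosed (range p)) (hdiscrete : IsDiscrete (range p))
    {c : DeRhamH2 (range p)ᶜ} {e : ι → ℤ} (hce : IsIntegralClass p c e) (he : ∀ j, e j ≤ 0)
    {x₁ : E3} (hx₁ : x₁ ∈ (range p)ᶜ) (hs : Summable fun j => |(e j : ℝ)| / ‖x₁ - p j‖) :
    ∃ V : E3 → ℝ, HarmonicOnNhd V (range p)ᶜ ∧ (∀ x ∈ (range p)ᶜ, 0 < V x) ∧
      StarDRepresents V c := by
  have hpi := Real.pi_pos
  -- A unit Newton kernel has flux -4π, hence the normalization of the charges.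
  set w : ι → ℝ := fun j => |(e j : ℝ)| / (4 * Real.pi) with hwd
  have hw : ∀ j, 0 ≤ w j := fun j => by positivity
  have hs₁ : Summable fun j => w j / ‖x₁ - p j‖ := by
    refine (hs.div_const (4 * Real.pi)).congr fun j => ?_
    simp only [hwd]
    rw [div_right_comm]
  have hsU : ∀ x ∈ (range p)ᶜ, Summable fun j => w j / ‖x - p j‖ := fun x hx => by
    obtain ⟨ρ, hρ, h⟩ := exists_le_norm_sub hclosed hx
    exact summable_div_norm_sub hw (fun j h => hx₁ ⟨j, h.symm⟩) hs₁ hρ fun j => h _ (mem_range_self j)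
  set F : E3 → ℝ := fun x => ∑' j, w j * newton (p j) x with hF
  have hFh : ∀ x ∈ (range p)ᶜ, SmoothHarmonicAt F x := fun x hx => by
    obtain ⟨ρ, hρ, h⟩ := exists_le_norm_sub hclosed hx
    exact smoothHarmonicAt_tsum_newton hρ (fun j => h _ (mem_range_self j)) hw (hsU x hx)
  -- The added constant 1 makes the nonnegative potential strictly positive; it is written as
  -- subtraction of -1 to match `gradient_sub_const`.
  set V : E3 → ℝ := fun x => F x - (-1) with hV
  have hgV : gradient V = gradient F := gradient_sub_const F (-1)
  have hVh : ∀ x ∈ (range p)ᶜ, SmoothHarmonicAt V x := fun x hx =>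
    ⟨(hFh x hx).1.sub contDiffAt_const, by rw [hgV]; exact (hFh x hx).2⟩
  have hcl : IsClosedFormOn (starD V) (range p)ᶜ := isClosedFormOn_gradient hVh
  refine ⟨V, SmoothHarmonicAt.harmonicOnNhd hclosed.isOpen_compl hVh, fun x _ => ?_,
    ⟨starD V, hcl⟩, fun _ _ => rfl, ?_⟩
  · have : 0 ≤ F x := tsum_nonneg fun j => mul_nonneg (hw j) (inv_nonneg.2 (norm_nonneg _))
    simp only [hV]
    linarith
  obtain ⟨η, rfl⟩ := QuotientAddGroup.mk_surjective c
  -- All periods of this difference vanish, since e_j + |e_j| = 0; exactness of the difference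
  -- identifies the two classes.
  have hζ : IsClosedFormOn (fun x => (η : DiffForm 2) x - starD V x) (univ \ range p) := by
    rw [← compl_eq_univ_sdiff]
    exact IsClosedFormOn.sub η.2 hcl
  obtain ⟨α, hα⟩ := exists_primitive_of_sphereIntegral_eq_zero isOpen_univ
    (starConvex_univ (0 : E3)) hclosed hdiscrete hζ (by
      rintro _ ⟨⟨j, rfl⟩, -⟩
      obtain ⟨ρ, hρ, -⟩ := exists_disjoint_balls isOpen_univ hdiscrete
      obtain ⟨h0, -, hball⟩ := hρ (p j) ⟨mem_range_self j, mem_univ _⟩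
      filter_upwards [(hce j).eventually_eq hdiscrete (mem_range_self j) η rfl,
        eventually_sphereIntegral_tsum_newton hp hclosed hdiscrete hw hsU j,
        Ioo_mem_nhdsGT h0] with r hr hr' hr0
      have hm : ∀ z, p j + r • sphereMap z ∈ (range p)ᶜ := fun z hz => by
        have hm := sphere_mem_punctured_ball (p := p j) hr0 z
        exact hm.2 (by rw [← hball]; exact ⟨hm.1, hz⟩)
      rw [sphereIntegral_sub (fun z => (η.2 _ (hm z)).1) (fun z => (hcl _ (hm z)).1), hr,
        starD_eq_fluxForm, hgV, hr']
      simp only [hwd]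
      rw [abs_of_nonpos (by exact_mod_cast he j)]
      field_simp
      ring)
  exact deRhamClass_eq_of_isPrimitiveOn fun x hx => hα x ⟨mem_univ x, hx⟩

end

theorem theorem1p1 {ι : Type*} [Countable ι] (p : ι → E3) (hp : Function.Injective p)
    (hclosed : IsClosed (range p)) (hdiscrete : IsDiscrete (range p))
    (c : DeRhamH2 (range p)ᶜ) (e : ι → ℤ) (hce : IsIntegralClass p c e) (hc : c ≠ 0) :
    (∃ V : E3 → ℝ, HarmonicOnNhd V (range p)ᶜ ∧ (∀ x ∈ (range p)ᶜ, 0 < V x) ∧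
        StarDRepresents V c) ↔
      (∀ j, e j ≤ 0) ∧
        ∃ x ∈ (range p)ᶜ, Summable (fun j => |(e j : ℝ)| / ‖x - p j‖) := by
  constructor
  · rintro ⟨V, hV, hpos, hVc⟩
    obtain ⟨h1, h2⟩ := summable_of_starDRepresents hp hclosed hdiscrete hce hV
      (fun x hx => (hpos x hx).le) hVc
    -- The bound holds at every point of the complement, which is nonempty because a countable set
    -- has dense complement.
    obtain ⟨x, hx⟩ := ((countable_range p).dense_compl ℝ).nonempty
    exact ⟨h1, x, hx, h2 x hx⟩
  · rintro ⟨he, x, hx, hs⟩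
    exact exists_harmonic_of_summable hp hclosed hdiscrete hce he hx hs
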